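/- Let $z_1,\dots,z_n\in\mathbb C$ be distinct points and $\Sigma=\mathbb C\setminus\{z_1,\dots,z_n\}$. Let $\mathfrak t_{n+2}$ be the Drinfeld–Kohno Lie algebra over $\mathbb C$ on the strands $1,\dots,n,z,w$: its generators are $t_{ab}=t_{ba}$ ($a\ne b$), and its relations are $[t_{ab},t_{cd}]=0$ and $[t_{ab}+t_{ac},t_{bc}]=0$ for distinct $a,b,c,d$. Universal enveloping algebras are completed with respect to the powers of the augmentation ideal (equivalently, with respect to the degree). Put $$A_z=\frac1{2\pi i}\sum_{k} t_{kz}\,d\log(z-z_k),\qquad A_w=\frac1{2\pi i}\sum_{k} t_{kw}\,d\log(w-z_k),\qquad A_{z,w}=A_z+A_w+\frac1{2\pi i}t_{zw}\,d\log(z-w).$$ **The path.** Let $i\neq j$, let $v_i,v_j\in\mathbb C\setminus\{0\}$, and let $\gamma:[0,1]\to\mathbb C$ be smooth with $\dot\gamma\ne0$ and $\gamma(t)\in\Sigma$ for $0<t<1$, with $\gamma(t)=z_i+v_it$ near $t=0$ and $\gamma(t)=z_j+v_j(1-t)$ near $t=1$. Assume that there are only finitely many pairs $0<t_l<s_l<1$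 with $\gamma(t_l)=\gamma(s_l)=:a_l$, that these self-intersections are transverse, that $\gamma$ is linear near each $t_l$ and $s_l$, and that the points $(t_l,s_l)$ lie on distinct rays from $(0,1)$ in the $(t,s)$-plane. **Regularized holonomy.** Let $A=\frac1{2\pi i}\sum_kT_k\,d\log(x-z_k)$, with coefficients $T_k$ in a complex Lie algebra. To a regular point $p\in\Sigma$ one associates the local solution of $d\Psi=A\Psi$ with $\Psi_p(p)=1$. To a tangential base point $(z_k,v)$ one associates the local solution $$\Psi_{z_k,v}(x)=f\!\left(\tfrac{x-z_k}{v}\right)\exp\!\left(\tfrac{T_k}{2\pi i}\log\tfrac{x-z_k}{v}\right),\qquad f\text{ analytic near }0,\ f(0)=1,$$ on a small disc around $z_k$ slit along the direction $-v$. For a path with initial base point $p$ and final base point $q$, $\mathrm{Hol}^{\mathrm{reg}}(A,\cdot)=\Psi_q^{-1}\Psi_p$, where both solutions are continued along the path. The path $\gamma|_{[0,t_l]}$ goes from $(z_i,v_i)$ to the regular point $a_l$, and $\gamma|_{[1,s_l]}$ goes backwards along $\gamma$ from $(z_j,v_j)$ to the regular point $a_l$. **The factors $C_l$.** Number the self-intersections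 counterclockwise according to their rays from $(0,1)$ in the triangle $0<t<s<1$. Let $V_{l+1}$ be the open sector of the triangle between the ray through $(t_l,s_l)$ and the next one counterclockwise. Let $L_l$ be the segment from $(0,1)$ to $(t_l,s_l)$, let $u_l$ be the $t$-derivative of $w-z=\gamma(s)-\gamma(t)$ along $L_l$ at $t=t_l$, and let $\epsilon_l=\operatorname{sign}\operatorname{Im}(\dot\gamma(s_l)/\dot\gamma(t_l))$. Let $\Psi_5$ be the solution of $d\Psi=A_{z,w}\Psi$ for $z$ near $z_i$ and $w$ near $z_j$ of the form $$f\!\left(\tfrac{z-z_i}{v_i},\tfrac{w-z_j}{v_j}\right)\left(\tfrac{z-z_i}{v_i}\right)^{t_{iz}/2\pi i}\left(\tfrac{w-z_j}{v_j}\right)^{t_{jw}/2\pi i},\qquad f\text{ analytic near }(0,0),\ f(0,0)=1.$$ Let $\Psi_{5,l+1}$ be the flat section, on $V_{l+1}$, of the pullback of $A_{z,w}$ by $(t,s)\mapsto(\gamma(t),\gamma(s))$ that coincides with $\Psi_5$ near $(0,1)$. Let $\Psi_{a_l,u}$ be the solution near $(a_l,a_l)$ of the form $$f(z-a_l,w-z)\,\exp\!\left(\Big(\tfrac{1}{2\pi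 i}\log\tfrac{w-z}{u_l}+\tfrac{\epsilon_l}{2}\Big)t_{zw}\right),\qquad f\text{ analytic near }(0,0),\ f(0,0)=1,$$ where $\log$ is the principal branch; when one approaches $L_l$ near $(t_l,s_l)$ from inside $V_{l+1}$, the exponential tends to $(t_l-t)^{t_{zw}/2\pi i}$. Put $C_l=\Psi_{a_l,u}^{-1}\Psi_{5,l+1}$, evaluated at points of $V_{l+1}$ near $(t_l,s_l)$. **Theorem.** Let $\tau=\mathfrak t_{n+2}/\langle t_{zw}\rangle$ be the quotient by the Lie ideal generated by $t_{zw}$, and let $\pi:\mathfrak t_{n+2}\to\tau$ be the projection, also on completed enveloping algebras. Then: 1. The elements $\pi(t_{kz})$ and $\pi(t_{kw})$, $1\le k\le n$, generate a Lie subalgebra of $\tau$ isomorphic to $\mathfrak f_z\oplus\mathfrak f_w$, where $\mathfrak f_z$ and $\mathfrak f_w$ are the free Lie algebras on the $\pi(t_{kz})$ and on the $\pi(t_{kw})$ respectively. 2. For every self-intersection $l$, the factor $C_l$ and the regularized holonomies below exist and are uniquely determined, and $$\pi(C_l)=\mathrm{Hol}^{\mathrm{reg}}(\pi(A_z),\gamma|_{[0,t_l]})\;\mathrm{Hol}^{\mathrm{reg}}(\pi(A_w),\gamma|_{[1,s_l]}).$$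 3. Equivalently, in the completion of $U(\mathfrak t_{n+2})$, $$C_l=\mathrm{Hol}^{\mathrm{reg}}(A_z,\gamma|_{[0,t_l]})\;\mathrm{Hol}^{\mathrm{reg}}(A_w,\gamma|_{[1,s_l]})+O(t_{zw}),$$ where $O(t_{zw})$ denotes an element of the closed two-sided ideal generated by $t_{zw}$. -/

import Mathlib

open Complex Set Filter Topology

noncomputable section

namespace KZ

/-! ### The completed universal enveloping algebra of a complex Lie algebra -/

section Completion

attribute [local instance 100] LieRing.ofAssociativeRing

/-- The counit `U(L) → ℂ`, sending every element of `L` to `0`. -/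
def counit (L : Type*) [LieRing L] [LieAlgebra ℂ L] :
    UniversalEnvelopingAlgebra ℂ L →ₐ[ℂ] ℂ :=
  UniversalEnvelopingAlgebra.lift ℂ (0 : L →ₗ⁅ℂ⁆ ℂ)

/-- The augmentation ideal of `U(L)`, a two-sided ideal. -/
abbrev augIdeal (L : Type*) [LieRing L] [LieAlgebra ℂ L] :
    Ideal (UniversalEnvelopingAlgebra ℂ L) :=
  RingHom.ker (counit L)

/-- The truncation `U(L) / I ^ N` by powers of the augmentation ideal `I`. If `L` is graded and
generated in degree one, `I ^ N` is the part of degree at least `N`. -/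
abbrev Trunc (L : Type*) [LieRing L] [LieAlgebra ℂ L] (N : ℕ) : Type _ :=
  UniversalEnvelopingAlgebra ℂ L ⧸ augIdeal L ^ N

/-- The projection from `U(L) / I ^ N` to `U(L) / I ^ M` for `M ≤ N`. -/
def truncMap (L : Type*) [LieRing L] [LieAlgebra ℂ L] {M N : ℕ} (h : M ≤ N) :
    Trunc L N →ₐ[ℂ] Trunc L M :=
  Ideal.Quotient.factorₐ ℂ (Ideal.pow_le_pow_right h)

/-- The completed universal enveloping algebra `lim_N U(L) / I ^ N`. -/
def completedSubalgebra (L : Type*) [LieRing L] [LieAlgebra ℂ L] :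
    Subalgebra ℂ (∀ N, Trunc L N) where
  carrier := {x | ∀ (M N : ℕ) (h : M ≤ N), truncMap L h (x N) = x M}
  mul_mem' := by
    intro x y hx hy M N h
    simp only [Pi.mul_apply, map_mul, hx M N h, hy M N h]
  add_mem' := by
    intro x y hx hy M N h
    simp only [Pi.add_apply, map_add, hx M N h, hy M N h]
  algebraMap_mem' := by
    intro r M N h
    simp only [Pi.algebraMap_apply, AlgHom.commutes]

/-- The completed universal enveloping algebra, as a type. For `x : CompletedU L`, `x.1 N` is the
class of `x` in `U(L) / I ^ N`. -/
abbrev CompletedU (L : Type*) [LieRing L] [LieAlgebra ℂ L] : Type _ :=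
  completedSubalgebra L

variable {L : Type*} [LieRing L] [LieAlgebra ℂ L] {L' : Type*} [LieRing L'] [LieAlgebra ℂ L']

/-- The canonical map from `L` to its completed universal enveloping algebra. -/
def ofLie (y : L) : CompletedU L :=
  ⟨fun N => Ideal.Quotient.mkₐ ℂ (augIdeal L ^ N) (UniversalEnvelopingAlgebra.ι ℂ y),
    fun _ _ _ => rfl⟩

theorem iota_mem_augIdeal (y : L) : UniversalEnvelopingAlgebra.ι ℂ y ∈ augIdeal L := by
  simp [augIdeal, RingHom.mem_ker, counit]

/-- The exponential `∑ y ^ k / k!` of `y : L` in the completed universal enveloping algebra.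
In `U(L) / I ^ N` the powers `y ^ k` with `k ≥ N` vanish. -/
def expLie (y : L) : CompletedU L :=
  ⟨fun N => Ideal.Quotient.mkₐ ℂ (augIdeal L ^ N)
      (∑ k ∈ Finset.range N, ((k.factorial : ℂ)⁻¹) • (UniversalEnvelopingAlgebra.ι ℂ y) ^ k), by
    intro M N h
    change Ideal.Quotient.mkₐ ℂ (augIdeal L ^ M) _ = Ideal.Quotient.mkₐ ℂ (augIdeal L ^ M) _
    rw [← Finset.sum_range_add_sum_Ico _ h, map_add, add_eq_left]
    rw [Ideal.Quotient.mkₐ_eq_mk, Ideal.Quotient.eq_zero_iff_mem]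
    refine Ideal.sum_mem _ fun k hk => ?_
    rw [Algebra.smul_def]
    exact Ideal.mul_mem_left _ _ (Ideal.pow_le_pow_right (Finset.mem_Ico.1 hk).1
      (Ideal.pow_mem_pow (iota_mem_augIdeal y) k))⟩

/-- The algebra map `U(L) → U(L')` induced by a morphism of Lie algebras. -/
def mapU (φ : L →ₗ⁅ℂ⁆ L') :
    UniversalEnvelopingAlgebra ℂ L →ₐ[ℂ] UniversalEnvelopingAlgebra ℂ L' :=
  UniversalEnvelopingAlgebra.lift ℂ ((UniversalEnvelopingAlgebra.ι ℂ).comp φ)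

theorem counit_comp_mapU (φ : L →ₗ⁅ℂ⁆ L') : (counit L').comp (mapU φ) = counit L := by
  apply UniversalEnvelopingAlgebra.hom_ext
  ext y
  simp [counit, mapU]

theorem augIdeal_pow_le_comap (φ : L →ₗ⁅ℂ⁆ L') (N : ℕ) :
    augIdeal L ^ N ≤ (augIdeal L' ^ N).comap (mapU φ) := by
  have h1 : augIdeal L ≤ (augIdeal L').comap (mapU φ) := by
    intro x hx
    have h2 := DFunLike.congr_fun (counit_comp_mapU φ) x
    simp only [augIdeal, RingHom.mem_ker, Ideal.mem_comap] at hx ⊢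
    exact h2.trans hx
  induction N with
  | zero =>
    intro x _
    simp only [Ideal.mem_comap, Submodule.pow_zero, Ideal.one_eq_top, Submodule.mem_top]
  | succ N ih =>
    rw [Submodule.pow_succ, Submodule.pow_succ, Ideal.mul_le]
    intro r hr s hs
    rw [Ideal.mem_comap, map_mul]
    exact Ideal.mul_mem_mul (ih hr) (h1 hs)

/-- The map `U(L) / I ^ N → U(L') / I' ^ N` induced by a morphism of Lie algebras. -/
def mapTrunc (φ : L →ₗ⁅ℂ⁆ L') (N : ℕ) : Trunc L N →ₐ[ℂ] Trunc L' N :=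
  Ideal.quotientMapₐ (augIdeal L' ^ N) (mapU φ) (augIdeal_pow_le_comap φ N)

/-- The map of completed universal enveloping algebras induced by a morphism of Lie algebras. -/
def mapCompleted (φ : L →ₗ⁅ℂ⁆ L') (x : CompletedU L) : CompletedU L' :=
  ⟨fun N => mapTrunc φ N (x.1 N), by
    intro M N h
    change truncMap L' h (mapTrunc φ N (x.1 N)) = mapTrunc φ M (x.1 M)
    rw [← x.2 M N h]
    obtain ⟨u, hu⟩ := Ideal.Quotient.mk_surjective (x.1 N)
    rw [← hu]
    rfl⟩

/-- `x = O(y)`: modulo every `I ^ N`, `x` lies in the two-sided ideal generated by `y`; that is,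
`x` lies in the closed two-sided ideal generated by `y`. -/
def IsBigOLie (x : CompletedU L) (y : L) : Prop :=
  ∀ N, x.1 N ∈ TwoSidedIdeal.span {(ofLie y).1 N}

end Completion

/-! ### The Drinfeld--Kohno Lie algebras -/

/-- The relators of the Drinfeld--Kohno Lie algebra on the set `ι` of strands. The generators are
indexed by all pairs; those with equal indices are put equal to zero. -/
inductive DKRel (ι : Type*) : FreeLieAlgebra ℂ (ι × ι) → Prop
  | diag (i : ι) : DKRel ι (FreeLieAlgebra.of ℂ (i, i))
  | symm (i j : ι) : DKRel ι (FreeLieAlgebra.of ℂ (i, j) - FreeLieAlgebra.of ℂ (j, i))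
  | comm (i j k l : ι) (hij : i ≠ j) (hik : i ≠ k) (hil : i ≠ l) (hjk : j ≠ k) (hjl : j ≠ l)
      (hkl : k ≠ l) : DKRel ι ⁅FreeLieAlgebra.of ℂ (i, j), FreeLieAlgebra.of ℂ (k, l)⁆
  | triple (i j k : ι) (hij : i ≠ j) (hik : i ≠ k) (hjk : j ≠ k) :
      DKRel ι ⁅FreeLieAlgebra.of ℂ (i, j) + FreeLieAlgebra.of ℂ (i, k),
        FreeLieAlgebra.of ℂ (j, k)⁆

/-- The Drinfeld--Kohno Lie algebra over `ℂ` with strands labelled by `ι`. -/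
abbrev DrinfeldKohno (ι : Type*) : Type _ :=
  FreeLieAlgebra ℂ (ι × ι) ⧸
    (LieSubmodule.lieSpan ℂ (FreeLieAlgebra ℂ (ι × ι)) {x | DKRel ι x} :
      LieIdeal ℂ (FreeLieAlgebra ℂ (ι × ι)))

/-- The generator `t_{ij}`. -/
def gen {ι : Type*} (i j : ι) : DrinfeldKohno ι :=
  LieSubmodule.Quotient.mk (FreeLieAlgebra.of ℂ (i, j))

/-- The `n + 2` strands: the `n` marked points and the two moving points `z` and `w`. -/
inductive Strand (n : ℕ) : Type
  | pt (k : Fin n) : Strand n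
  | z : Strand n
  | w : Strand n

/-- The Lie algebra `t_{n+2}`. -/
abbrev TLie (n : ℕ) : Type := DrinfeldKohno (Strand n)

/-- `t_{k,z}` -/
def tz {n : ℕ} (k : Fin n) : TLie n := gen (Strand.pt k) Strand.z

/-- `t_{k,w}` -/
def tw {n : ℕ} (k : Fin n) : TLie n := gen (Strand.pt k) Strand.w

/-- `t_{z,w}` -/
def tzw {n : ℕ} : TLie n := gen Strand.z Strand.w

/-- The quotient of `t_{n+2}` by the Lie ideal generated by `t_{zw}`. -/
abbrev TauLie (n : ℕ) : Type :=
  TLie n ⧸ (LieSubmodule.lieSpan ℂ (TLie n) {tzw} : LieIdeal ℂ (TLie n))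

/-- The canonical projection `π`. -/
def proj (n : ℕ) : TLie n →ₗ⁅ℂ⁆ TauLie n where
  toFun x := LieSubmodule.Quotient.mk x
  map_add' _ _ := rfl
  map_smul' _ _ := rfl
  map_lie' := by intro x y; rfl

/-! ### Holomorphic functions and flat sections with values in the completed algebra -/

section Calculus

variable {L : Type*} [LieRing L] [LieAlgebra ℂ L]

/-- Holomorphy on a set: all linear coordinates of all truncations are complex differentiable. -/
def IsHolomorphicOn {E : Type*} [NormedAddCommGroup E] [NormedSpace ℂ E]
    (f : E → CompletedU L) (D : Set E) : Prop :=
  ∀ (N : ℕ) (c : Module.Dual ℂ (Trunc L N)), DifferentiableOn ℂ (fun q => c ((f q).1 N)) D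

/-- `F` satisfies `dF = A F` at each point of `D`, where `A p h : L` is the value at the
tangent vector `h` at `p` of an `L`-valued one-form. The derivative is taken
in all linear coordinates of all truncations. -/
def IsFlatOn (𝕜 : Type*) [NontriviallyNormedField 𝕜] [NormedAlgebra 𝕜 ℂ]
    {E : Type*} [NormedAddCommGroup E] [NormedSpace 𝕜 E]
    (A : E → E → L) (F : E → CompletedU L) (D : Set E) : Prop :=
  ∀ p ∈ D, ∀ (N : ℕ) (c : Module.Dual ℂ (Trunc L N)), ∃ F' : E →L[𝕜] ℂ,
    HasFDerivAt (fun q => c ((F q).1 N)) F' p ∧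
      ∀ h : E, F' h = c ((ofLie (A p h) * F p).1 N)

variable {n : ℕ}

/-- The connection `(2πi)⁻¹ ∑ T_k dlog(x - z_k)` of one moving point `x`. -/
def conn1 (z : Fin n → ℂ) (T : Fin n → L) (x h : ℂ) : L :=
  (2 * Real.pi * I : ℂ)⁻¹ • ∑ k, (h / (x - z k)) • T k

/-- The Knizhnik--Zamolodchikov connection `A_{z,w}` of two moving points. -/
def conn2 (z : Fin n → ℂ) (p h : ℂ × ℂ) : TLie n :=
  (2 * Real.pi * I : ℂ)⁻¹ •
    ((∑ k, ((h.1 / (p.1 - z k)) • tz k + (h.2 / (p.2 - z k)) • tw k)) +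
      ((h.1 - h.2) / (p.1 - p.2)) • tzw)

/-! ### Local solutions and regularized holonomy -/

/-- A base point: a point of the plane, or a vector `v` at the marked point with index `i`. -/
inductive BasePoint (n : ℕ) : Type
  | regular (p : ℂ) : BasePoint n
  | tangential (i : Fin n) (v : ℂ) : BasePoint n

/-- The disc of radius `ε` around `c` without the closed ray from `c` in direction `-v`. -/
def slitDisc (c v : ℂ) (ε : ℝ) : Set ℂ :=
  {x | x ∈ Metric.ball c ε ∧ (x - c) / v ∈ slitPlane}

/-- `Ψ` is the local solution of `dΨ = A Ψ`, `A = (2πi)⁻¹ ∑ T_k dlog(x - z_k)`, normalized at the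
base point, on the (slit) disc of radius `ε`: at a regular point `p` by `Ψ(p) = 1`, at a tangential
base point `(z_i, v)` by `Ψ(x) = f((x - z_i) / v) exp (log ((x - z_i) / v) T_i / 2πi)` with `f`
analytic and `f(0) = 1`. -/
def IsLocalSolution (z : Fin n → ℂ) (T : Fin n → L) (ε : ℝ) (Ψ : ℂ → CompletedU L) :
    BasePoint n → Prop
  | BasePoint.regular p => IsFlatOn ℂ (conn1 z T) Ψ (Metric.ball p ε) ∧ Ψ p = 1
  | BasePoint.tangential i v =>
      IsFlatOn ℂ (conn1 z T) Ψ (slitDisc (z i) v ε) ∧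
      ∃ f : ℂ → CompletedU L, IsHolomorphicOn f (Metric.ball 0 (ε / ‖v‖)) ∧ f 0 = 1 ∧
        ∀ x ∈ slitDisc (z i) v ε,
          Ψ x = f ((x - z i) / v) * expLie ((log ((x - z i) / v) / (2 * Real.pi * I)) • T i)

/-- `H` is the regularized holonomy `Ψ_Q⁻¹ Ψ_P` of `A = (2πi)⁻¹ ∑ T_k dlog(x - z_k)` along the path
`δ : [0, c] → ℂ` with starting base point `P` and end base point `Q`. Here `FP` and `FQ` are the
analytic continuations along `δ` of the local solutions `ΨP` and `ΨQ`. -/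
def IsRegHol (z : Fin n → ℂ) (T : Fin n → L) (δ : ℝ → ℂ) (c : ℝ) (P Q : BasePoint n)
    (H : CompletedU L) : Prop :=
  ∃ ε > 0, ∃ (ΨP ΨQ : ℂ → CompletedU L) (FP FQ : ℝ → CompletedU L),
    IsLocalSolution z T ε ΨP P ∧ IsLocalSolution z T ε ΨQ Q ∧
    IsFlatOn ℝ (fun t h => conn1 z T (δ t) (h * deriv δ t)) FP (Ioo 0 c) ∧
    IsFlatOn ℝ (fun t h => conn1 z T (δ t) (h * deriv δ t)) FQ (Ioo 0 c) ∧
    (∀ᶠ t in 𝓝[>] (0 : ℝ), FP t = ΨP (δ t)) ∧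
    (∀ᶠ t in 𝓝[<] c, FQ t = ΨQ (δ t)) ∧
    ∀ t ∈ Ioo 0 c, FP t = FQ t * H

end Calculus

/-! ### Paths and their self-intersections -/

/-- The pairs `(t, s)` with `0 < t < s < 1` and `γ t = γ s`. -/
def selfIntersections (γ : ℝ → ℂ) : Set (ℝ × ℝ) :=
  {p | 0 < p.1 ∧ p.1 < p.2 ∧ p.2 < 1 ∧ γ p.1 = γ p.2}

/-- The number `(1 - s) / t`, which determines the ray from `(0, 1)` through `(t, s)`. It decreases
when the ray turns counterclockwise (in the triangle `0 < t < s < 1`). -/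
def raySlope (p : ℝ × ℝ) : ℝ := (1 - p.2) / p.1

/-- A smooth immersed path `γ : [0,1] → ℂ` from the tangential base point `(z_i, v_i)` to the
tangential base point `(z_j, v_j)`, avoiding the marked points in between and linear near its ends,
with finitely many self-intersections, all transverse, near which the path is linear, no two of
them on the same ray from `(0, 1)` in the `(t, s)`-plane. -/
structure IsAdmissiblePath {n : ℕ} (z : Fin n → ℂ) (i j : Fin n) (vi vj : ℂ) (γ : ℝ → ℂ) :
    Prop where
  vi_ne : vi ≠ 0
  vj_ne : vj ≠ 0
  smooth : ContDiffOn ℝ (⊤ : ℕ∞) γ (Icc 0 1)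
  immersed : ∀ t ∈ Ioo (0 : ℝ) 1, deriv γ t ≠ 0
  avoids : ∀ t ∈ Ioo (0 : ℝ) 1, ∀ k, γ t ≠ z k
  start_linear : ∃ ε > 0, ∀ t ∈ Ico (0 : ℝ) ε, γ t = z i + vi * t
  end_linear : ∃ ε > 0, ∀ t ∈ Ioc (1 - ε : ℝ) 1, γ t = z j + vj * (1 - t)
  finite : (selfIntersections γ).Finite
  transverse : ∀ p ∈ selfIntersections γ, (deriv γ p.2 / deriv γ p.1).im ≠ 0
  linear : ∀ p ∈ selfIntersections γ, ∃ ε > 0,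
    (∀ x : ℝ, |x - p.1| < ε → γ x = γ p.1 + (x - p.1) * deriv γ p.1) ∧
    (∀ x : ℝ, |x - p.2| < ε → γ x = γ p.2 + (x - p.2) * deriv γ p.2)
  rays : InjOn raySlope (selfIntersections γ)

/-- The open sector (in the triangle `0 < t < s < 1`, with vertex `(0, 1)`) between the ray
through the self-intersection `l` and the next such ray in the counterclockwise direction. -/
def sectorAbove (γ : ℝ → ℂ) (l : ℝ × ℝ) : Set (ℝ × ℝ) :=
  {q | 0 < q.1 ∧ q.1 < q.2 ∧ q.2 < 1 ∧ raySlope q < raySlope l ∧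
    ∀ r ∈ selfIntersections γ, raySlope r < raySlope l → raySlope r < raySlope q}

/-- The sign `ε_l` of the self-intersection `l = (t_l, s_l)`. -/
def intersectionSign (γ : ℝ → ℂ) (l : ℝ × ℝ) : ℝ :=
  Real.sign (deriv γ l.2 / deriv γ l.1).im

/-- The velocity `u_l` at `t = t_l` of `w - z` along the line `s = (s_l - 1) / t_l * t + 1`. -/
def lineVelocity (γ : ℝ → ℂ) (l : ℝ × ℝ) : ℂ :=
  deriv (fun t : ℝ => γ ((l.2 - 1) / l.1 * t + 1) - γ t) l.1

/-! ### The self-intersection factor -/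

variable {n : ℕ}

/-- The domain of the solution `Ψ_5`: `z` close to `z_i`, `w` close to `z_j`, with slits. -/
def domain5 (z : Fin n → ℂ) (i j : Fin n) (vi vj : ℂ) (ε : ℝ) : Set (ℂ × ℂ) :=
  slitDisc (z i) vi ε ×ˢ slitDisc (z j) vj ε

/-- `Ψ_5`: the solution of the two-point equation in the region `(z_i z)(w z_j)`, of the form
`f(x, y) x^{t_{iz} / 2πi} y^{t_{jw} / 2πi}` for `x = (z - z_i) / v_i`, `y = (w - z_j) / v_j`,
with `f` analytic near `(0, 0)` and `f(0, 0) = 1`. -/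
def IsPsi5 (z : Fin n → ℂ) (i j : Fin n) (vi vj : ℂ) (ε : ℝ)
    (Ψ : ℂ × ℂ → CompletedU (TLie n)) : Prop :=
  IsFlatOn ℂ (conn2 z) Ψ (domain5 z i j vi vj ε) ∧
  ∃ f : ℂ × ℂ → CompletedU (TLie n),
    IsHolomorphicOn f (Metric.ball 0 (ε / ‖vi‖) ×ˢ Metric.ball 0 (ε / ‖vj‖)) ∧ f (0, 0) = 1 ∧
    ∀ p ∈ domain5 z i j vi vj ε,
      Ψ p = f ((p.1 - z i) / vi, (p.2 - z j) / vj) *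
        expLie ((log ((p.1 - z i) / vi) / (2 * Real.pi * I)) • tz i) *
        expLie ((log ((p.2 - z j) / vj) / (2 * Real.pi * I)) • tw j)

/-- The domain of the solution `Ψ_{a,u}`: the polydisc of radius `ε` in the coordinates
`(z - a, w - z)` without the branch cut, along which `w - z` is a nonpositive multiple of `u`. -/
def domainA (a u : ℂ) (ε : ℝ) : Set (ℂ × ℂ) :=
  {p | p.1 - a ∈ Metric.ball 0 ε ∧ p.2 - p.1 ∈ Metric.ball 0 ε ∧ (p.2 - p.1) / u ∈ slitPlane}

/-- `Ψ_{a,u}` for the self-intersection `l` with position `a = γ(t_l)`: the solution of the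
two-point equation near `(a, a)` of the form
`f(z - a, w - z) exp (log ((w - z) / u_l) t_{zw} / 2πi + ε_l t_{zw} / 2)`, with `f` analytic near
`(0, 0)` and `f(0, 0) = 1`. The branch cut of the logarithm contains the image of the line `L_l`,
on which `w - z = u_l (t - t_l)` with `t < t_l`; with this branch, the exponential tends to
`(t_l - t) ^ (t_{zw} / 2πi)` when one approaches a point of `L_l` near `(t_l, s_l)` from above. -/
def IsPsiA (z : Fin n → ℂ) (γ : ℝ → ℂ) (l : ℝ × ℝ) (ε : ℝ)
    (Ψ : ℂ × ℂ → CompletedU (TLie n)) : Prop :=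
  IsFlatOn ℂ (conn2 z) Ψ (domainA (γ l.1) (lineVelocity γ l) ε) ∧
  ∃ f : ℂ × ℂ → CompletedU (TLie n),
    IsHolomorphicOn f (Metric.ball 0 ε ×ˢ Metric.ball 0 ε) ∧ f (0, 0) = 1 ∧
    ∀ p ∈ domainA (γ l.1) (lineVelocity γ l) ε,
      Ψ p = f (p.1 - γ l.1, p.2 - p.1) *
        expLie ((log ((p.2 - p.1) / lineVelocity γ l) / (2 * Real.pi * I) +
          (intersectionSign γ l : ℂ) / 2) • tzw)

/-- `C` is the factor `C_l = Ψ_{a_l,u}⁻¹ Ψ_{5,l+1}` of the self-intersection `l`. Here `G` is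
`Ψ_{5,l+1}`: the flat section on the sector above the ray of `l` (for the pullback of `A_{z,w}` along
`(t, s) ↦ (γ t, γ s)`) which coincides with `Ψ_5` near `(0, 1)`; it is compared with `Ψ_{a_l,u}` at
the points of this sector near `(t_l, s_l)`. -/
def IsSelfIntersectionFactor (z : Fin n → ℂ) (i j : Fin n) (vi vj : ℂ) (γ : ℝ → ℂ) (l : ℝ × ℝ)
    (C : CompletedU (TLie n)) : Prop :=
  ∃ ε > 0, ∃ (Ψ5 ΨA : ℂ × ℂ → CompletedU (TLie n)) (G : ℝ × ℝ → CompletedU (TLie n)),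
    IsPsi5 z i j vi vj ε Ψ5 ∧ IsPsiA z γ l ε ΨA ∧
    IsFlatOn ℝ (fun q h => conn2 z (γ q.1, γ q.2) (h.1 * deriv γ q.1, h.2 * deriv γ q.2)) G
      (sectorAbove γ l) ∧
    (∀ᶠ q in 𝓝[sectorAbove γ l] ((0 : ℝ), (1 : ℝ)), G q = Ψ5 (γ q.1, γ q.2)) ∧
    (∀ᶠ q in 𝓝[sectorAbove γ l] l, G q = ΨA (γ q.1, γ q.2) * C)

/-- `H = Hol^reg(A_z, γ|_{[0,t_l]})`, for a connection with coefficients `T_k` in `L`. -/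
def IsHolStart {L : Type*} [LieRing L] [LieAlgebra ℂ L] (z : Fin n → ℂ) (T : Fin n → L)
    (i : Fin n) (vi : ℂ) (γ : ℝ → ℂ) (tl : ℝ) (H : CompletedU L) : Prop :=
  IsRegHol z T γ tl (BasePoint.tangential i vi) (BasePoint.regular (γ tl)) H

/-- `H = Hol^reg(A_w, γ|_{[1,s_l]})`, for a connection with coefficients `T_k` in `L`; the path `γ`
is traversed backwards from `γ(1)` to `γ(s_l)`. -/
def IsHolEnd {L : Type*} [LieRing L] [LieAlgebra ℂ L] (z : Fin n → ℂ) (T : Fin n → L)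
    (j : Fin n) (vj : ℂ) (γ : ℝ → ℂ) (sl : ℝ) (H : CompletedU L) : Prop :=
  IsRegHol z T (fun t => γ (1 - t)) (1 - sl) (BasePoint.tangential j vj)
    (BasePoint.regular (γ sl)) H

end KZ

end

/-!
The connection `A_{z,w}` is flat, and modulo `t_{zw}` it becomes `A_z + A_w`, where the coefficients
`t_{kz}` of `A_z` commute with the coefficients `t_{kw}` of `A_w`: for `k ≠ l` by a defining
relation, and for `k = l` because `⁅t_{kz}, t_{kw}⁆ = ⁅t_{kw}, t_{zw}⁆` (`proj_tz_lie_tw`). Let `P` be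
the flat section of `π(A_z)` along `γ|_{[0,t_l]}` normalized at the tangential base point
`(z_i, v_i)`, and let `P'` be the flat section of `π(A_w)` along the reversed `γ|_{[1,s_l]}`
normalized at `(z_j, v_j)`. Then `(t, s) ↦ P(t) P'(1 - s)` is flat for the pullback of `π(A_{z,w})`
(`isFlatOn_mul_of_commute`) and has the asymptotics of `π(Ψ_5)` near `(0, 1)`; hence it equals
`π(Ψ_{5,l+1})` (`flat_eq_of_ray`). At `(t_l, s_l)` the factor `π(Ψ_{a_l,u})` tends to `1`, because its
singular part is an exponential of a multiple of `π(t_{zw}) = 0`, while `P` and `P'` tend to the two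
regularized holonomies. This is `proj_factor`. The version modulo `O(t_{zw})` follows since, in
every truncation `U / I ^ N`, the kernel of `π` is the two-sided ideal generated by `t_{zw}`
(`mem_span_of_mapTrunc_eq_zero`).

All analysis takes place in the finite-dimensional truncations. There, the augmentation ideal defines
a finite filtration which is raised by multiplication with elements of the Lie algebra. This makes
singular equations harmless in two ways. For uniqueness, no bound on the connection is needed: a
solution that tends to zero somewhere, after multiplication with the inverse of its singular factor,
lies successively in all steps of the filtration, hence vanishes (`eq_zero_of_raises`,
`curve_eq_zero`). For existence, regular and logarithmic connections are treated alike: the sum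
of the equations in the coordinate directions is an equation `E f = M f`, where `E` is the Euler
operator and `M` raises the filtration. As `E` is invertible on smooth functions vanishing at the
origin (`exists_euler_primitive`), Picard iteration stops after finitely many steps
(`exists_euler_solution`), and flatness makes the solution satisfy each equation separately
(`exists_logConnection_solution`). This yields `Ψ_5`, `Ψ_{a,u}`, the flat sections on the sectors
of the triangle, and the regularized holonomies.

For the structure of `τ`, the two free Lie algebras map to commuting subalgebras of `τ`. The sum
of these maps is injective because `τ` acts through braids with a single moving strand: the
relations of `t_{n+1}` hold in `f ⋊ Der f`, with `f` free on the `t_{kz}`, when `t_{kl}` acts by the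
derivation that sends `t_{lz}` to `⁅t_{lz}, t_{kz}⁆`, sends `t_{kz}` to `⁅t_{kz}, t_{lz}⁆`, and
annihilates the other generators (`exists_tauHom`). Forgetting `w` this detects the first component,
forgetting `z` the second one (`freeProd_injective`).
-/

noncomputable section

namespace KZ

attribute [local instance 100] LieRing.ofAssociativeRing

/-! ### Solutions of equations that raise a filtration -/

section Propagation

variable {A : Type*} [NormedAddCommGroup A] [NormedSpace ℂ A] [FiniteDimensional ℂ A]

/-- A curve whose velocity lies in a subspace `S` and which tends to zero somewhere lies in `S`. -/
theorem mem_submodule_of_deriv_mem {a b : ℝ} {u u' : ℝ → A} (S : Submodule ℂ A)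
    (hu : ∀ r ∈ Ioo a b, HasDerivAt u (u' r) r) (hS : ∀ r ∈ Ioo a b, u' r ∈ S)
    {l : Filter ℝ} [l.NeBot] (hl : l ≤ 𝓟 (Ioo a b)) (h0 : Tendsto u l (𝓝 0)) :
    ∀ r ∈ Ioo a b, u r ∈ S := by
  intro r hr
  by_contra hcon
  obtain ⟨c, hc, hcS⟩ := Submodule.exists_dual_map_eq_bot_of_notMem hcon inferInstance
  have hcS' : ∀ v ∈ S, c v = 0 := fun v hv => by
    have := Submodule.mem_map_of_mem (f := c) hv
    rwa [hcS, Submodule.mem_bot] at this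
  let C : A →L[ℝ] ℂ := (LinearMap.toContinuousLinearMap c).restrictScalars ℝ
  have hd : ∀ q ∈ Ioo a b, HasDerivAt (fun r => c (u r)) 0 q := fun q hq => by
    have h := C.hasFDerivAt.comp_hasDerivAt q (hu q hq)
    have h2 : C (u' q) = 0 := hcS' _ (hS q hq)
    rw [h2] at h
    exact h
  have hconst : ∀ q ∈ Ioo a b, c (u q) = c (u r) := by
    intro q hq
    refine (convex_Ioo a b).is_const_of_fderivWithin_eq_zero (𝕜 := ℝ)
      (f := fun r => c (u r)) (fun x hx => (hd x hx).differentiableAt.differentiableWithinAt)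
      (fun x hx => ?_) hq hr
    rw [fderivWithin_of_isOpen isOpen_Ioo hx]
    have := (hd x hx).hasFDerivAt.fderiv
    rw [this]; ext; simp
  have hlim : Tendsto (fun q => c (u q)) l (𝓝 0) := by
    have := (C.continuous.tendsto 0).comp h0
    rw [map_zero] at this
    exact this
  have h2 : Tendsto (fun q => c (u q)) l (𝓝 (c (u r))) :=
    tendsto_const_nhds.congr' (by
      filter_upwards [hl (mem_principal_self _)] with q hq
      exact (hconst q hq).symm)
  exact hc (tendsto_nhds_unique h2 hlim)

/-- The uniqueness principle for equations which raise a finite filtration: a solution which tends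
to zero somewhere vanishes. No bound on the coefficients is required, so that the equation may be
singular at the ends of the interval. -/
theorem eq_zero_of_raises {F : ℕ → Submodule ℂ A} {N : ℕ} (hF0 : F 0 = ⊤) (hFN : F N = ⊥)
    {a b : ℝ} {u u' : ℝ → A} (hu : ∀ r ∈ Ioo a b, HasDerivAt u (u' r) r)
    (hS : ∀ k, ∀ r ∈ Ioo a b, u r ∈ F k → u' r ∈ F (k + 1))
    {l : Filter ℝ} [l.NeBot] (hl : l ≤ 𝓟 (Ioo a b)) (h0 : Tendsto u l (𝓝 0)) :
    ∀ r ∈ Ioo a b, u r = 0 := by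
  have key : ∀ k, ∀ r ∈ Ioo a b, u r ∈ F k := by
    intro k
    induction k with
    | zero => intro r _; rw [hF0]; trivial
    | succ k ih =>
      exact mem_submodule_of_deriv_mem (F (k + 1)) hu (fun r hr => hS k r hr (ih r hr)) hl h0
  intro r hr
  have := key N r hr
  rwa [hFN, Submodule.mem_bot] at this

end Propagation

/-! ### The Euler operator on a star-shaped domain -/

section Euler

set_option linter.unusedSectionVars false

variable {𝕜 : Type*} [RCLike 𝕜] {E : Type*} [NormedAddCommGroup E] [NormedSpace 𝕜 E]
  [NormedSpace ℝ E] [IsScalarTower ℝ 𝕜 E] [FiniteDimensional 𝕜 E]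
  {W : Type*} [NormedAddCommGroup W] [NormedSpace 𝕜 W] [NormedSpace ℝ W] [IsScalarTower ℝ 𝕜 W]
  [CompleteSpace W]

theorem hasDerivAt_ray {f : E → W} {p : E} {r : ℝ} {f' : E →L[𝕜] W}
    (hf : HasFDerivAt f f' (r • p)) : HasDerivAt (fun q : ℝ => f (q • p)) (f' p) r := by
  have h1 : HasDerivAt (fun q : ℝ => q • p) p r := by
    simpa using (hasDerivAt_id r).smul_const p
  exact (hf.restrictScalars ℝ).comp_hasDerivAt r h1

theorem ray_integrand_continuousOn {D : Set E} (hstar : ∀ p ∈ D, ∀ r ∈ Icc (0 : ℝ) 1, r • p ∈ D)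
    {G : E → W} (hG : ContinuousOn G D) (k : ℕ) {p : E} (hp : p ∈ D) :
    ContinuousOn (fun r : ℝ => r ^ k • G (r • p)) (Icc 0 1) := by
  refine ContinuousOn.smul (by fun_prop) (hG.comp (by fun_prop) fun r hr => hstar p hp r hr)

theorem aestronglyMeasurable_of_continuousOn_Icc {W' : Type*} [NormedAddCommGroup W'] {g : ℝ → W'}
    (hg : ContinuousOn g (Icc 0 1)) : MeasureTheory.AEStronglyMeasurable g
      (MeasureTheory.volume.restrict (Set.uIoc (0 : ℝ) 1)) := by
  rw [uIoc_of_le zero_le_one]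
  exact (hg.mono Ioc_subset_Icc_self).aestronglyMeasurable measurableSet_Ioc

theorem hasFDerivAt_ray_integral {D : Set E} (hD : IsOpen D)
    (hstar : ∀ p ∈ D, ∀ r ∈ Icc (0 : ℝ) 1, r • p ∈ D) {G : E → W} (hG : ContDiffOn 𝕜 1 G D)
    (k : ℕ) {p : E} (hp : p ∈ D) :
    HasFDerivAt (fun q => ∫ r in (0 : ℝ)..1, r ^ k • G (r • q))
      (∫ r in (0 : ℝ)..1, r ^ (k + 1) • fderiv 𝕜 G (r • p)) p := by
  have hG' : ContinuousOn (fderiv 𝕜 G) D := hG.continuousOn_fderiv_of_isOpen hD le_rfl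
  have : ProperSpace E := FiniteDimensional.proper 𝕜 E
  obtain ⟨δ, hδ, hball⟩ := Metric.nhds_basis_closedBall.mem_iff.1 (hD.mem_nhds hp)
  have hcpt : IsCompact ((fun x : ℝ × E => x.1 • x.2) '' (Icc (0 : ℝ) 1 ×ˢ Metric.closedBall p δ)) :=
    (isCompact_Icc.prod (isCompact_closedBall p δ)).image (by fun_prop)
  have hsub : ((fun x : ℝ × E => x.1 • x.2) '' (Icc (0 : ℝ) 1 ×ˢ Metric.closedBall p δ)) ⊆ D := by
    rintro _ ⟨⟨r, q⟩, ⟨hr, hq⟩, rfl⟩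
    exact hstar q (hball hq) r hr
  obtain ⟨B, hB⟩ := hcpt.exists_bound_of_continuousOn (hG'.mono hsub)
  have hIoc : ∀ r ∈ Set.uIoc (0 : ℝ) 1, r ∈ Icc (0 : ℝ) 1 := fun r hr => by
    rw [uIoc_of_le zero_le_one] at hr; exact Ioc_subset_Icc_self hr
  refine intervalIntegral.hasFDerivAt_integral_of_dominated_of_fderiv_le (𝕜 := 𝕜)
    (F := fun q r => r ^ k • G (r • q))
    (F' := fun q r => r ^ (k + 1) • fderiv 𝕜 G (r • q)) (bound := fun _ => B)
    (s := Metric.closedBall p δ) (Metric.closedBall_mem_nhds p hδ) ?_ ?_ ?_ ?_ ?_ ?_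
  · filter_upwards [hD.mem_nhds hp] with q hq
    exact aestronglyMeasurable_of_continuousOn_Icc (ray_integrand_continuousOn hstar hG.continuousOn k hq)
  · apply ContinuousOn.intervalIntegrable
    rw [uIcc_of_le zero_le_one]
    exact ray_integrand_continuousOn hstar hG.continuousOn k hp
  · exact aestronglyMeasurable_of_continuousOn_Icc (ray_integrand_continuousOn hstar hG' (k + 1) hp)
  · refine Eventually.of_forall fun r hr q hq => ?_
    have hr := hIoc r hr
    rw [norm_smul, Real.norm_of_nonneg (pow_nonneg hr.1 _)]
    have h1 := hB (r • q) ⟨(r, q), ⟨hr, hq⟩, rfl⟩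
    calc r ^ (k + 1) * ‖fderiv 𝕜 G (r • q)‖ ≤ 1 * ‖fderiv 𝕜 G (r • q)‖ := by
          gcongr; exact pow_le_one₀ hr.1 hr.2
      _ ≤ B := by rw [one_mul]; exact h1
  · exact intervalIntegrable_const
  · refine Eventually.of_forall fun r hr q hq => ?_
    have hr := hIoc r hr
    have hd : HasFDerivAt G (fderiv 𝕜 G (r • q)) (r • q) :=
      ((hG.differentiableOn one_ne_zero).differentiableAt
        (hD.mem_nhds (hstar q (hball hq) r hr))).hasFDerivAt
    have h1 : HasFDerivAt (fun q : E => r • q) (r • ContinuousLinearMap.id 𝕜 E) q :=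
      (hasFDerivAt_id q).const_smul r
    have h2 := (hd.comp q h1).const_smul (r ^ k)
    refine h2.congr_fderiv ?_
    ext v
    simp [pow_succ, mul_smul]

/-- The integral means `∫ r ^ k G(r q) dr` along rays inherit the smoothness of `G`. Differentiating
raises `k` and lowers the order, whence the induction for all `k` at once. -/
theorem contDiffOn_ray_integral_nat {D : Set E} (hD : IsOpen D)
    (hstar : ∀ p ∈ D, ∀ r ∈ Icc (0 : ℝ) 1, r • p ∈ D) (n : ℕ) :
    ∀ {G : E → W}, ContDiffOn 𝕜 (n + 1 : ℕ) G D → ∀ k : ℕ,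
      ContDiffOn 𝕜 n (fun q => ∫ r in (0 : ℝ)..1, r ^ k • G (r • q)) D := by
  induction n with
  | zero =>
    intro G hG k
    have h1 : ContDiffOn 𝕜 1 G D := by simpa using hG
    rw [Nat.cast_zero, contDiffOn_zero]
    exact fun p hp =>
      (hasFDerivAt_ray_integral hD hstar h1 k hp).continuousAt.continuousWithinAt
  | succ n ih =>
    intro G hG k
    have h1 : ContDiffOn 𝕜 1 G D := hG.of_le (by exact_mod_cast Nat.le_add_left 1 (n + 1))
    have hG2 : ContDiffOn 𝕜 ((n + 1 : ℕ) + 1) G D := by exact_mod_cast hG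
    have hG' := ((contDiffOn_succ_iff_fderiv_of_isOpen hD).1 hG2).2.2
    rw [Nat.cast_add, Nat.cast_one, contDiffOn_succ_iff_fderiv_of_isOpen hD]
    refine ⟨fun p hp =>
      (hasFDerivAt_ray_integral hD hstar h1 k hp).differentiableAt.differentiableWithinAt,
      by simp, ?_⟩
    rw [contDiffOn_clm_apply]
    intro y
    refine (ih (G := fun p => fderiv 𝕜 G p y) (hG'.clm_apply contDiffOn_const) (k + 1)).congr ?_
    intro p hp
    rw [(hasFDerivAt_ray_integral hD hstar h1 k hp).fderiv]
    rw [ContinuousLinearMap.intervalIntegral_apply]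
    · simp
    · apply ContinuousOn.intervalIntegrable
      rw [uIcc_of_le zero_le_one]
      exact ray_integrand_continuousOn hstar hG'.continuousOn (k + 1) hp

theorem contDiffOn_ray_integral {D : Set E} (hD : IsOpen D)
    (hstar : ∀ p ∈ D, ∀ r ∈ Icc (0 : ℝ) 1, r • p ∈ D) {G : E → W} (hG : ContDiffOn 𝕜 (⊤ : ℕ∞) G D)
    (k : ℕ) : ContDiffOn 𝕜 (⊤ : ℕ∞) (fun q => ∫ r in (0 : ℝ)..1, r ^ k • G (r • q)) D := by
  rw [contDiffOn_infty]
  intro n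
  exact contDiffOn_ray_integral_nat hD hstar n (contDiffOn_infty.1 hG (n + 1)) k

/-- The mean `h` of `G` along rays satisfies `(E + 1) h = G`, where `E` is the Euler operator. -/
theorem fderiv_ray_integral_self {D : Set E} (hD : IsOpen D)
    (hstar : ∀ p ∈ D, ∀ r ∈ Icc (0 : ℝ) 1, r • p ∈ D) {G : E → W} (hG : ContDiffOn 𝕜 1 G D)
    {p : E} (hp : p ∈ D) :
    fderiv 𝕜 (fun q => ∫ r in (0 : ℝ)..1, G (r • q)) p p + ∫ r in (0 : ℝ)..1, G (r • p) = G p := by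
  have hG' : ContinuousOn (fderiv 𝕜 G) D := hG.continuousOn_fderiv_of_isOpen hD le_rfl
  have h0 := (hasFDerivAt_ray_integral hD hstar hG 0 hp).fderiv
  simp only [pow_zero, one_smul, zero_add, pow_one] at h0
  have hi1 : IntervalIntegrable (fun r : ℝ => r • fderiv 𝕜 G (r • p)) MeasureTheory.volume 0 1 := by
    apply ContinuousOn.intervalIntegrable
    rw [uIcc_of_le zero_le_one]
    simpa using ray_integrand_continuousOn hstar hG' 1 hp
  have hi2 : IntervalIntegrable (fun r : ℝ => G (r • p)) MeasureTheory.volume 0 1 := by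
    apply ContinuousOn.intervalIntegrable
    rw [uIcc_of_le zero_le_one]
    simpa using ray_integrand_continuousOn hstar hG.continuousOn 0 hp
  have hi3 : IntervalIntegrable (fun r : ℝ => (r • fderiv 𝕜 G (r • p)) p) MeasureTheory.volume 0 1 := by
    apply ContinuousOn.intervalIntegrable
    rw [uIcc_of_le zero_le_one]
    refine ContinuousOn.clm_apply ?_ continuousOn_const
    simpa using ray_integrand_continuousOn hstar hG' 1 hp
  rw [h0, ContinuousLinearMap.intervalIntegral_apply hi1, ← intervalIntegral.integral_add hi3 hi2]
  have hd : ∀ r ∈ uIcc (0 : ℝ) 1, HasDerivAt (fun r : ℝ => r • G (r • p))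
      ((r • fderiv 𝕜 G (r • p)) p + G (r • p)) r := by
    intro r hr
    rw [uIcc_of_le zero_le_one] at hr
    have hd : HasFDerivAt G (fderiv 𝕜 G (r • p)) (r • p) :=
      ((hG.differentiableOn one_ne_zero).differentiableAt
        (hD.mem_nhds (hstar p hp r hr))).hasFDerivAt
    have h := (hasDerivAt_id r).smul (hasDerivAt_ray hd)
    rw [one_smul] at h
    exact h
  rw [intervalIntegral.integral_eq_sub_of_hasDerivAt hd (hi3.add hi2)]
  simp

/-- The Euler operator is invertible on smooth functions vanishing at the origin. -/
theorem exists_euler_primitive {D : Set E} (hD : IsOpen D)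
    (hstar : ∀ p ∈ D, ∀ r ∈ Icc (0 : ℝ) 1, r • p ∈ D) {g : E → W}
    (hg : ContDiffOn 𝕜 (⊤ : ℕ∞) g D) (hg0 : g 0 = 0) :
    ∃ f : E → W, ContDiffOn 𝕜 (⊤ : ℕ∞) f D ∧ f 0 = 0 ∧ ∀ p ∈ D, fderiv 𝕜 f p p = g p := by
  have hg1 : ContDiffOn 𝕜 1 g D := hg.of_le (by exact_mod_cast le_top)
  have hg' : ContDiffOn 𝕜 (⊤ : ℕ∞) (fderiv 𝕜 g) D :=
    ((contDiffOn_infty_iff_fderiv_of_isOpen hD).1 hg).2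
  have hg'c := hg'.continuousOn
  set H : E → E →L[𝕜] W := fun q => ∫ r in (0 : ℝ)..1, fderiv 𝕜 g (r • q) with hH
  have hHs : ContDiffOn 𝕜 (⊤ : ℕ∞) H D := by
    simpa using contDiffOn_ray_integral hD hstar hg' 0
  set K : E → E →L[𝕜] W := fun q => ∫ r in (0 : ℝ)..1, H (r • q) with hK
  have hKs : ContDiffOn 𝕜 (⊤ : ℕ∞) K D := by
    simpa using contDiffOn_ray_integral hD hstar hHs 0
  -- with `g(p) = H(p) p`, a primitive is `K(p) p`, because `(E + 1) K = H`
  refine ⟨fun p => K p p, hKs.clm_apply contDiffOn_id, by simp, fun p hp => ?_⟩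
  have hKd : HasFDerivAt K (fderiv 𝕜 K p) p :=
    ((hKs.differentiableOn (by simp)).differentiableAt (hD.mem_nhds hp)).hasFDerivAt
  have h1 : fderiv 𝕜 (fun p => K p p) p p = (fderiv 𝕜 K p p + K p) p := by
    have h := hKd.clm_apply (hasFDerivAt_id p)
    simp only [id] at h
    rw [h.fderiv]
    simp [add_comm]
  have h2 := fderiv_ray_integral_self hD hstar (hHs.of_le (by exact_mod_cast le_top)) hp
  rw [h1]
  change (fderiv 𝕜 (fun q => ∫ r in (0 : ℝ)..1, H (r • q)) p p + ∫ r in (0 : ℝ)..1, H (r • p)) p = g p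
  rw [h2, hH]
  have hi1 : IntervalIntegrable (fun r : ℝ => fderiv 𝕜 g (r • p)) MeasureTheory.volume 0 1 := by
    apply ContinuousOn.intervalIntegrable
    rw [uIcc_of_le zero_le_one]
    simpa using ray_integrand_continuousOn hstar hg'c 0 hp
  have hi2 : IntervalIntegrable (fun r : ℝ => fderiv 𝕜 g (r • p) p) MeasureTheory.volume 0 1 := by
    apply ContinuousOn.intervalIntegrable
    rw [uIcc_of_le zero_le_one]
    refine ContinuousOn.clm_apply ?_ continuousOn_const
    simpa using ray_integrand_continuousOn hstar hg'c 0 hp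
  rw [ContinuousLinearMap.intervalIntegral_apply hi1]
  have hd : ∀ r ∈ uIcc (0 : ℝ) 1, HasDerivAt (fun r : ℝ => g (r • p)) (fderiv 𝕜 g (r • p) p) r := by
    intro r hr
    rw [uIcc_of_le zero_le_one] at hr
    have hd : HasFDerivAt g (fderiv 𝕜 g (r • p)) (r • p) :=
      ((hg1.differentiableOn one_ne_zero).differentiableAt
        (hD.mem_nhds (hstar p hp r hr))).hasFDerivAt
    exact hasDerivAt_ray hd
  rw [intervalIntegral.integral_eq_sub_of_hasDerivAt hd hi2]
  simp [hg0]

end Euler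

/-! ### The Euler equation with a filtration-raising right-hand side -/

section Picard

set_option linter.unusedSectionVars false

variable {𝕜 : Type*} [RCLike 𝕜] {E : Type*} [NormedAddCommGroup E] [NormedSpace 𝕜 E]
  [NormedSpace ℝ E] [IsScalarTower ℝ 𝕜 E] [FiniteDimensional 𝕜 E]
  {A : Type*} [NormedAddCommGroup A] [NormedSpace ℂ A] [FiniteDimensional ℂ A] [NormedSpace 𝕜 A]
  [IsScalarTower ℝ 𝕜 A]

theorem exists_ray_extension {D : Set E} (hD : IsOpen D)
    (hstar : ∀ p ∈ D, ∀ r ∈ Icc (0 : ℝ) 1, r • p ∈ D) {p : E} (hp : p ∈ D) :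
    ∃ b > (1 : ℝ), ∀ r ∈ Ioo (0 : ℝ) b, r • p ∈ D := by
  have hc : ContinuousAt (fun r : ℝ => r • p) 1 := by fun_prop
  have hmem : ∀ᶠ r in 𝓝 (1 : ℝ), r • p ∈ D :=
    hc.eventually_mem (hD.mem_nhds (by simpa using hp))
  obtain ⟨δ, hδ, h⟩ := Metric.eventually_nhds_iff.1 hmem
  refine ⟨1 + δ, by linarith, fun r hr => ?_⟩
  rcases le_or_gt r 1 with h1 | h1
  · exact hstar p hp r ⟨hr.1.le, h1⟩
  · exact h (by rw [Real.dist_eq, abs_lt]; constructor <;> linarith [hr.2])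

/-- A function which vanishes at the origin and whose image under the Euler operator lies in a
subspace `S` takes values in `S`. -/
theorem mem_submodule_of_euler_mem {D : Set E} (hD : IsOpen D) (h0D : (0 : E) ∈ D)
    (hstar : ∀ p ∈ D, ∀ r ∈ Icc (0 : ℝ) 1, r • p ∈ D) (S : Submodule ℂ A)
    {u : E → A} (hu : DifferentiableOn 𝕜 u D)
    (hu0 : u 0 = 0) (hE : ∀ p ∈ D, fderiv 𝕜 u p p ∈ S) : ∀ p ∈ D, u p ∈ S := by
  intro p hp
  obtain ⟨b, hb, hbD⟩ := exists_ray_extension hD hstar hp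
  have hd : ∀ q ∈ D, HasFDerivAt u (fderiv 𝕜 u q) q := fun q hq =>
    (hu.differentiableAt (hD.mem_nhds hq)).hasFDerivAt
  have key := mem_submodule_of_deriv_mem (a := 0) (b := b) S (u := fun r : ℝ => u (r • p))
    (u' := fun r => fderiv 𝕜 u (r • p) p) (fun r hr => hasDerivAt_ray (hd _ (hbD r hr))) ?_
    (l := 𝓝[>] 0) ?_ ?_
  · simpa using key 1 ⟨one_pos, hb⟩
  · intro r hr
    have h1 : fderiv 𝕜 u (r • p) p = (r⁻¹ : ℂ) • fderiv 𝕜 u (r • p) (r • p) := by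
      have : fderiv 𝕜 u (r • p) (r • p) = r • fderiv 𝕜 u (r • p) p :=
        map_smul ((fderiv 𝕜 u (r • p)).restrictScalars ℝ) r p
      rw [this, ← Complex.ofReal_inv, Complex.coe_smul, smul_smul, inv_mul_cancel₀ hr.1.ne',
        one_smul]
    rw [h1]
    exact Submodule.smul_mem _ _ (hE _ (hbD r hr))
  · rw [le_principal_iff]
    exact Ioo_mem_nhdsGT (by linarith)
  · have hc : ContinuousAt (fun r : ℝ => u (r • p)) 0 := by
      apply ContinuousAt.comp (g := u)
      · rw [zero_smul]; exact (hd 0 h0D).continuousAt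
      · fun_prop
    have := hc.tendsto
    simp only [zero_smul, hu0] at this
    exact this.mono_left nhdsWithin_le_nhds

/-- Uniqueness for the Euler equation `E u = M u` with a filtration-raising right-hand side. -/
theorem euler_unique {F : ℕ → Submodule ℂ A} {N : ℕ} (hF0 : F 0 = ⊤) (hFN : F N = ⊥)
    {D : Set E} (hD : IsOpen D) (h0D : (0 : E) ∈ D)
    (hstar : ∀ p ∈ D, ∀ r ∈ Icc (0 : ℝ) 1, r • p ∈ D) {M : E → A → A}
    (hM : ∀ p ∈ D, ∀ k, ∀ v ∈ F k, M p v ∈ F (k + 1)) {u : E → A} (hu : DifferentiableOn 𝕜 u D)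
    (hu0 : u 0 = 0) (hE : ∀ p ∈ D, fderiv 𝕜 u p p = M p (u p)) : ∀ p ∈ D, u p = 0 := by
  have key : ∀ k, ∀ p ∈ D, u p ∈ F k := by
    intro k
    induction k with
    | zero => intro p _; rw [hF0]; trivial
    | succ k ih =>
      refine mem_submodule_of_euler_mem hD h0D hstar (F (k + 1)) hu hu0 fun p hp => ?_
      rw [hE p hp]
      exact hM p hp k _ (ih p hp)
  intro p hp
  have := key N p hp
  rwa [hFN, Submodule.mem_bot] at this

/-- Existence for the Euler equation `E f = M f` with prescribed value `v` at the origin, where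
`M 0 v = 0` and `M` raises a finite filtration: the iteration `f ↦ f + E⁻¹ (M f - E f)` stops. -/
theorem exists_euler_solution {F : ℕ → Submodule ℂ A} {N : ℕ} (hF0 : F 0 = ⊤) (hFN : F N = ⊥)
    {D : Set E} (hD : IsOpen D) (h0D : (0 : E) ∈ D)
    (hstar : ∀ p ∈ D, ∀ r ∈ Icc (0 : ℝ) 1, r • p ∈ D) {M : E → A →L[𝕜] A}
    (hMs : ContDiffOn 𝕜 (⊤ : ℕ∞) M D)
    (hM : ∀ p ∈ D, ∀ k, ∀ v ∈ F k, M p v ∈ F (k + 1)) {v : A} (hv : M 0 v = 0) :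
    ∃ f : E → A, ContDiffOn 𝕜 (⊤ : ℕ∞) f D ∧ f 0 = v ∧
      ∀ p ∈ D, fderiv 𝕜 f p p = M p (f p) := by
  have : CompleteSpace A := FiniteDimensional.complete ℂ A
  have key : ∀ k, ∃ f : E → A, ContDiffOn 𝕜 (⊤ : ℕ∞) f D ∧ f 0 = v ∧
      ∀ p ∈ D, M p (f p) - fderiv 𝕜 f p p ∈ F k := by
    intro k
    induction k with
    | zero => exact ⟨fun _ => v, contDiffOn_const, rfl, fun p _ => by rw [hF0]; trivial⟩
    | succ k ih =>
      obtain ⟨f, hf, hf0, hfk⟩ := ih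
      have hf' : ContDiffOn 𝕜 (⊤ : ℕ∞) (fderiv 𝕜 f) D :=
        ((contDiffOn_infty_iff_fderiv_of_isOpen hD).1 hf).2
      -- the correction solves `E g = M f - E f`, so it lies in `F k` and the new error `M g` in `F (k + 1)`
      obtain ⟨g, hg, hg0, hgE⟩ := exists_euler_primitive hD hstar
        (g := fun p => M p (f p) - fderiv 𝕜 f p p)
        ((hMs.clm_apply hf).sub (hf'.clm_apply contDiffOn_id)) (by simp [hf0, hv])
      have hgk := mem_submodule_of_euler_mem hD h0D hstar (F k) (hg.differentiableOn (by simp)) hg0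
        (fun p hp => by rw [hgE p hp]; exact hfk p hp)
      refine ⟨fun p => f p + g p, hf.add hg, by simp [hf0, hg0], fun p hp => ?_⟩
      have hfd := ((hf.differentiableOn (by simp)).differentiableAt (hD.mem_nhds hp)).hasFDerivAt
      have hgd := ((hg.differentiableOn (by simp)).differentiableAt (hD.mem_nhds hp)).hasFDerivAt
      rw [(hfd.fun_add hgd).fderiv, add_apply, hgE p hp, map_add]
      have : M p (f p) + M p (g p) - (fderiv 𝕜 f p p + (M p (f p) - fderiv 𝕜 f p p)) = M p (g p) := by
        abel
      rw [this]
      exact hM p hp k _ (hgk p hp)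
  obtain ⟨f, hf, hf0, hfN⟩ := key N
  refine ⟨f, hf, hf0, fun p hp => ?_⟩
  have := hfN p hp
  rw [hFN, Submodule.mem_bot, sub_eq_zero] at this
  exact this.symm

end Picard

/-! ### Flat logarithmic connections in two variables -/

section LogConnection

set_option linter.unusedSectionVars false

/-- A finite filtration of an algebra which is raised by multiplication with elements of `F 1`. -/
structure IsNilFiltration {A : Type*} [Ring A] [Algebra ℂ A] (F : ℕ → Submodule ℂ A) (N : ℕ) :
    Prop where
  zero : F 0 = ⊤
  last : F N = ⊥
  mul_left : ∀ k, ∀ a ∈ F 1, ∀ v ∈ F k, a * v ∈ F (k + 1)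
  mul_right : ∀ k, ∀ a ∈ F 1, ∀ v ∈ F k, v * a ∈ F (k + 1)

variable {𝕜 : Type*} [RCLike 𝕜] {A : Type*} [NormedRing A] [NormedAlgebra ℂ A]
  [FiniteDimensional ℂ A] [NormedAlgebra 𝕜 A] [IsScalarTower ℝ 𝕜 A]

theorem logConnection_raises {F : ℕ → Submodule ℂ A} {N : ℕ} (hF : IsNilFiltration F N)
    {a s : A} (ha : a ∈ F 1) (hs : s ∈ F 1) (k : ℕ) {v : A} (hv : v ∈ F k) :
    a * v - v * s ∈ F (k + 1) :=
  Submodule.sub_mem _ (hF.mul_left k a ha v hv) (hF.mul_right k s hs v hv)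

/-- The algebra behind flatness: if `heuler` is the Euler equation, `heuler'` its derivative in the
first variable, and `hclosed` says that the connection form is closed, then the defect
`x • fx - (P * f - f * S₁)` in the first equation satisfies the Euler equation as well. -/
theorem defect_identity {x y : 𝕜} {P Q f S₁ S₂ fx fy fxx fxy Px Py Qx : A}
    (hPQ : P * Q = Q * P) (hS : S₁ * S₂ = S₂ * S₁)
    (heuler' : x • fxx + fx + y • fxy = (P + Q) * fx + (Px + Qx) * f - fx * (S₁ + S₂))
    (heuler : x • fx + y • fy = (P + Q) * f - f * (S₁ + S₂)) (hclosed : y • Py = x • Qx) :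
    x • (x • fxx + fx - (P * fx + Px * f - fx * S₁)) + y • (x • fxy - (P * fy + Py * f - fy * S₁)) =
      (P + Q) * (x • fx - (P * f - f * S₁)) - (x • fx - (P * f - f * S₁)) * (S₁ + S₂) := by
  have h1 : x • (x • fxx + fx - (P * fx + Px * f - fx * S₁)) +
      y • (x • fxy - (P * fy + Py * f - fy * S₁)) =
      x • (x • fxx + fx + y • fxy) - P * (x • fx + y • fy) + (x • fx + y • fy) * S₁ -
        x • (Px * f) - (y • Py) * f := by
    simp only [smul_sub, smul_add, mul_add, add_mul, mul_smul_comm, smul_mul_assoc, smul_comm y x]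
    abel
  have hPQ' : ∀ v, P * (Q * v) = Q * (P * v) := fun v => by rw [← mul_assoc, hPQ, mul_assoc]
  rw [h1, heuler', heuler, hclosed]
  simp only [smul_sub, smul_add, mul_add, add_mul, mul_sub, sub_mul, mul_smul_comm, smul_mul_assoc,
    mul_assoc, hPQ', hS]
  abel

/-- Existence of the normalized regular factor `f` of a flat logarithmic connection in two
variables with poles along the axes and residues `S₁`, `S₂` at the origin. The solution of the
Euler equation, which is the sum of the two equations, satisfies both of them: by flatness the
defect in the first equation is again a solution of the Euler equation, and it vanishes at the
origin. -/
theorem exists_logConnection_solution {F : ℕ → Submodule ℂ A} {N : ℕ} (hF : IsNilFiltration F N)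
    {D : Set (𝕜 × 𝕜)} (hD : IsOpen D) (h0D : (0 : 𝕜 × 𝕜) ∈ D)
    (hstar : ∀ p ∈ D, ∀ r ∈ Icc (0 : ℝ) 1, r • p ∈ D) {P Q : 𝕜 × 𝕜 → A} {S₁ S₂ : A}
    (hP : ContDiffOn 𝕜 (⊤ : ℕ∞) P D) (hQ : ContDiffOn 𝕜 (⊤ : ℕ∞) Q D)
    (hP1 : ∀ p ∈ D, P p ∈ F 1) (hQ1 : ∀ p ∈ D, Q p ∈ F 1)
    (hP0 : P 0 = S₁) (hQ0 : Q 0 = S₂)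
    (hcomm : ∀ p ∈ D, Commute (P p) (Q p))
    (hclosed : ∀ p ∈ D, p.2 • fderiv 𝕜 P p (0, 1) = p.1 • fderiv 𝕜 Q p (1, 0)) :
    ∃ f : 𝕜 × 𝕜 → A, ContDiffOn 𝕜 (⊤ : ℕ∞) f D ∧ f 0 = 1 ∧ (∀ p ∈ D, f p - 1 ∈ F 1) ∧
      ∀ p ∈ D, p.1 • fderiv 𝕜 f p (1, 0) = P p * f p - f p * S₁ ∧
        p.2 • fderiv 𝕜 f p (0, 1) = Q p * f p - f p * S₂ := by
  have hS1 : S₁ ∈ F 1 := hP0 ▸ hP1 0 h0D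
  have hS2 : S₂ ∈ F 1 := hQ0 ▸ hQ1 0 h0D
  have hS : Commute S₁ S₂ := hP0 ▸ hQ0 ▸ hcomm 0 h0D
  have hraise : ∀ p ∈ D, ∀ k, ∀ v ∈ F k, (P p + Q p) * v - v * (S₁ + S₂) ∈ F (k + 1) :=
    fun p hp k v hv => logConnection_raises hF (Submodule.add_mem _ (hP1 p hp) (hQ1 p hp))
      (Submodule.add_mem _ hS1 hS2) k hv
  obtain ⟨f, hf, hf0, hfE⟩ := exists_euler_solution (𝕜 := 𝕜) hF.zero hF.last hD h0D hstar
    (M := fun p => ContinuousLinearMap.mul 𝕜 A (P p + Q p) -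
      (ContinuousLinearMap.mul 𝕜 A).flip (S₁ + S₂)) (v := 1)
    (((ContinuousLinearMap.mul 𝕜 A).contDiff.comp_contDiffOn (hP.add hQ)).sub contDiffOn_const)
    (fun p hp k v hv => hraise p hp k v hv) (by simp [hP0, hQ0])
  simp only [sub_apply, ContinuousLinearMap.mul_apply',
    ContinuousLinearMap.flip_apply] at hfE
  have hd : ∀ {g : 𝕜 × 𝕜 → A}, ContDiffOn 𝕜 (⊤ : ℕ∞) g D → ∀ p ∈ D,
      HasFDerivAt g (fderiv 𝕜 g p) p := fun hg p hp =>
    ((hg.differentiableOn (by simp)).differentiableAt (hD.mem_nhds hp)).hasFDerivAt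
  have hf' : ContDiffOn 𝕜 (⊤ : ℕ∞) (fderiv 𝕜 f) D :=
    ((contDiffOn_infty_iff_fderiv_of_isOpen hD).1 hf).2
  have hfx : ContDiffOn 𝕜 (⊤ : ℕ∞) (fun p => fderiv 𝕜 f p (1, 0)) D :=
    hf'.clm_apply contDiffOn_const
  have hfy : ContDiffOn 𝕜 (⊤ : ℕ∞) (fun p => fderiv 𝕜 f p (0, 1)) D :=
    hf'.clm_apply contDiffOn_const
  have hsplit : ∀ (T : 𝕜 × 𝕜 →L[𝕜] A) (p : 𝕜 × 𝕜), T p = p.1 • T (1, 0) + p.2 • T (0, 1) := by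
    intro T p
    rw [← map_smul, ← map_smul, ← map_add]
    simp
  have hsum : ∀ p ∈ D, p.1 • fderiv 𝕜 f p (1, 0) + p.2 • fderiv 𝕜 f p (0, 1) =
      (P p + Q p) * f p - f p * (S₁ + S₂) := fun p hp => by
    rw [← hsplit, hfE p hp]
  -- the defect in the first equation
  set δ : 𝕜 × 𝕜 → A := fun p => p.1 • fderiv 𝕜 f p (1, 0) - (P p * f p - f p * S₁) with hδ
  have hδs : ContDiffOn 𝕜 (⊤ : ℕ∞) δ D :=
    (contDiffOn_fst.smul hfx).sub ((hP.mul hf).sub (hf.mul contDiffOn_const))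
  have hδ0 : ∀ p ∈ D, δ p = 0 := by
    refine euler_unique (𝕜 := 𝕜) hF.zero hF.last hD h0D hstar hraise
      (hδs.differentiableOn (by simp)) (by simp [hδ, hf0, hP0]) fun p hp => ?_
    have hG := hd hfx p hp
    have hPd := hd hP p hp
    have hQd := hd hQ p hp
    have hfd := hd hf p hp
    have hsymm : fderiv 𝕜 (fun p => fderiv 𝕜 f p (0, 1)) p (1, 0) =
        fderiv 𝕜 (fun p => fderiv 𝕜 f p (1, 0)) p (0, 1) := by
      have h2 : HasFDerivAt (fderiv 𝕜 f) (fderiv 𝕜 (fderiv 𝕜 f) p) p :=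
        ((hf'.differentiableOn (by simp)).differentiableAt (hD.mem_nhds hp)).hasFDerivAt
      have h3 : IsSymmSndFDerivAt 𝕜 f p := by
        refine (hf.contDiffAt (hD.mem_nhds hp)).isSymmSndFDerivAt ?_
        rw [minSmoothness_of_isRCLikeNormedField]
        exact WithTop.coe_le_coe.2 le_top
      have h4 := (h2.clm_apply (hasFDerivAt_const ((0 : 𝕜), (1 : 𝕜)) p)).fderiv
      have h5 := (h2.clm_apply (hasFDerivAt_const ((1 : 𝕜), (0 : 𝕜)) p)).fderiv
      rw [h4, h5]
      simpa using h3 (1, 0) (0, 1)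
    have hδd := (hasFDerivAt_fst.smul hG).sub
      ((hPd.mul' hfd).sub (hfd.mul' (hasFDerivAt_const S₁ p)))
    have hδd' : fderiv 𝕜 δ p = _ := HasFDerivAt.fderiv hδd
    have hLd := (hasFDerivAt_fst.smul hG).add (hasFDerivAt_snd.smul (hd hfy p hp))
    have hRd := ((hPd.add hQd).mul' hfd).sub (hfd.mul' (hasFDerivAt_const (S₁ + S₂) p))
    -- the Euler equation, differentiated in the first variable
    have heq := (hLd.congr_of_eventuallyEq (by
      filter_upwards [hD.mem_nhds hp] with q hq
      exact (hsum q hq).symm)).unique hRd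
    have heq1 := DFunLike.congr_fun heq (1, 0)
    rw [hsplit (fderiv 𝕜 δ p) p, hδd']
    have hsum' := hsum p hp
    have hcl := hclosed p hp
    have hPQ := (hcomm p hp).eq
    have hSS := hS.eq
    simp only [add_apply, sub_apply, smul_apply, ContinuousLinearMap.smulRight_apply,
      ContinuousLinearMap.coe_fst', ContinuousLinearMap.coe_snd', op_smul_eq_mul, zero_apply,
      smul_eq_mul, one_smul, zero_smul, add_zero, mul_zero, zero_add, hsymm] at heq1 ⊢
    exact defect_identity hPQ hSS heq1 hsum' hcl
  refine ⟨f, hf, hf0, ?_, fun p hp => ?_⟩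
  · refine mem_submodule_of_euler_mem (𝕜 := 𝕜) hD h0D hstar (F 1)
      ((hf.sub contDiffOn_const).differentiableOn (by simp)) (by simp [hf0]) fun p hp => ?_
    have : fderiv 𝕜 (fun p => f p - 1) p = fderiv 𝕜 f p := fderiv_sub_const 1
    rw [this, hfE p hp]
    exact hraise p hp 0 _ (by rw [hF.zero]; trivial)
  · have h1 := hδ0 p hp
    simp only [hδ, sub_eq_zero] at h1
    refine ⟨h1, ?_⟩
    have h2 := hsum p hp
    rw [h1] at h2
    have h3 := eq_sub_of_add_eq' h2
    rw [h3]
    noncomm_ring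

end LogConnection

/-! ### Finiteness of the truncated enveloping algebras -/

section FiniteTrunc

/-- Every element of an algebra generated by the `x k` is a scalar plus a combination of the
`x k` with coefficients on the left. -/
theorem exists_eq_smul_one_add_sum {U : Type*} [Ring U] [Algebra ℂ U] {K : Type*} [Fintype K]
    [DecidableEq K] {x : K → U} (hx : Algebra.adjoin ℂ (range x) = ⊤) (u : U) :
    ∃ (c : ℂ) (g : K → U), u = c • (1 : U) + ∑ k, g k * x k := by
  have hu : u ∈ Algebra.adjoin ℂ (range x) := by rw [hx]; trivial
  induction hu using Algebra.adjoin_induction with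
  | mem y hy =>
    obtain ⟨k, rfl⟩ := hy
    exact ⟨0, Pi.single k 1, by simp [Pi.single_apply, ite_mul]⟩
  | algebraMap r => exact ⟨r, 0, by simp [Algebra.algebraMap_eq_smul_one]⟩
  | add u v _ _ hu hv =>
    obtain ⟨c, g, h1⟩ := hu
    obtain ⟨c', g', h2⟩ := hv
    refine ⟨c + c', g + g', ?_⟩
    rw [h1, h2]
    simp only [Pi.add_apply, add_mul, Finset.sum_add_distrib, add_smul]
    abel
  | mul u v _ _ hu hv =>
    obtain ⟨c, g, h1⟩ := hu
    obtain ⟨c', g', h2⟩ := hv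
    refine ⟨c' * c, fun k => c' • g k + u * g' k, ?_⟩
    have : u * v = c' • u + ∑ k, u * g' k * x k := by
      rw [h2, mul_add, Finset.mul_sum, mul_smul_comm, mul_one]
      simp only [mul_assoc]
    have h3 : c' • u = (c' * c) • (1 : U) + ∑ k, c' • g k * x k := by
      conv_lhs => rw [h1]
      simp only [smul_add, smul_smul, Finset.smul_sum, smul_mul_assoc]
    rw [this, h3]
    simp only [add_mul, Finset.sum_add_distrib]
    abel

/-- Modulo `I ^ (N + 1)`, every element is a combination of `1` and of products `w x_k` with `w` in a
finite-dimensional space of representatives modulo `I ^ N`. -/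
theorem finiteDimensional_quotient_pow {U : Type*} [Ring U] [Algebra ℂ U] {K : Type*} [Fintype K]
    {x : K → U} (hx : Algebra.adjoin ℂ (range x) = ⊤) (I : Ideal U) [I.IsTwoSided]
    (hI : ∀ k, x k ∈ I) (N : ℕ) : FiniteDimensional ℂ (U ⧸ I ^ N) := by
  classical
  have key : ∀ N : ℕ, ∃ W : Submodule ℂ U, W.FG ∧ ∀ u, ∃ w ∈ W, u - w ∈ I ^ N := by
    intro N
    induction N with
    | zero => exact ⟨⊥, Submodule.fg_bot, fun u => ⟨0, zero_mem _, by
        rw [Submodule.pow_zero, Ideal.one_eq_top]; trivial⟩⟩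
    | succ N ih =>
      obtain ⟨W, hW, hWu⟩ := ih
      choose w hw hwu using hWu
      refine ⟨Submodule.span ℂ {1} ⊔ ⨆ k, W.map (LinearMap.mulRight ℂ (x k)),
        (Submodule.fg_span_singleton 1).sup (Submodule.fg_iSup _ fun k => hW.map _), fun u => ?_⟩
      obtain ⟨c, g, hu⟩ := exists_eq_smul_one_add_sum hx u
      refine ⟨c • 1 + ∑ k, w (g k) * x k, Submodule.add_mem _ ?_ ?_, ?_⟩
      · exact Submodule.mem_sup_left (Submodule.smul_mem _ _ (Submodule.mem_span_singleton_self 1))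
      · refine Submodule.mem_sup_right (Submodule.sum_mem _ fun k _ => ?_)
        exact Submodule.mem_iSup_of_mem k ⟨w (g k), hw _, rfl⟩
      · have : u - (c • 1 + ∑ k, w (g k) * x k) = ∑ k, (g k - w (g k)) * x k := by
          conv_lhs => rw [hu]
          simp only [sub_mul, Finset.sum_sub_distrib]
          abel
        rw [this, Submodule.pow_succ]
        exact Ideal.sum_mem _ fun k _ => Ideal.mul_mem_mul (hwu _) (hI k)
  obtain ⟨W, hW, hWu⟩ := key N
  have : Module.Finite ℂ W := Module.Finite.iff_fg.2 hW
  refine Module.Finite.of_surjective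
    ((Ideal.Quotient.mkₐ ℂ (I ^ N)).toLinearMap.comp W.subtype) fun y => ?_
  obtain ⟨u, rfl⟩ := Ideal.Quotient.mk_surjective y
  obtain ⟨w, hw, hwu⟩ := hWu u
  refine ⟨⟨w, hw⟩, ?_⟩
  exact (Ideal.Quotient.eq.2 hwu).symm

variable (L : Type*) [LieRing L] [LieAlgebra ℂ L]

/-- The truncations of the universal enveloping algebra of `L` are finite-dimensional. -/
class FiniteTrunc : Prop where
  finite : ∀ N, FiniteDimensional ℂ (Trunc L N)

instance [FiniteTrunc L] (N : ℕ) : FiniteDimensional ℂ (Trunc L N) := FiniteTrunc.finite N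

variable {L}

theorem adjoin_range_ι_eq_top {K : Type*} {g : K → L}
    (hg : LieSubalgebra.lieSpan ℂ L (range g) = ⊤) :
    Algebra.adjoin ℂ (range fun k => UniversalEnvelopingAlgebra.ι ℂ (g k)) = ⊤ := by
  set S := Algebra.adjoin ℂ (range fun k => UniversalEnvelopingAlgebra.ι ℂ (g k)) with hS
  have h1 : ∀ y : L, UniversalEnvelopingAlgebra.ι ℂ y ∈ S := by
    intro y
    have hle : LieSubalgebra.lieSpan ℂ L (range g) ≤
        (lieSubalgebraOfSubalgebra ℂ _ S).comap (UniversalEnvelopingAlgebra.ι ℂ) := by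
      rw [LieSubalgebra.lieSpan_le]
      rintro _ ⟨k, rfl⟩
      exact Algebra.subset_adjoin ⟨k, rfl⟩
    exact hle (by rw [hg]; trivial)
  let f : L →ₗ⁅ℂ⁆ S :=
    { toFun := fun y => ⟨UniversalEnvelopingAlgebra.ι ℂ y, h1 y⟩
      map_add' := fun a b => by ext; simp
      map_smul' := fun c a => by ext; simp
      map_lie' := by intro a b; ext; simp [LieRing.of_associative_ring_bracket] }
  have h2 : S.val.comp (UniversalEnvelopingAlgebra.lift ℂ f) = AlgHom.id ℂ _ := by
    apply UniversalEnvelopingAlgebra.hom_ext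
    ext y
    simp [f]
  rw [eq_top_iff]
  intro u _
  have := DFunLike.congr_fun h2 u
  simp only [AlgHom.comp_apply, AlgHom.id_apply] at this
  rw [← this]
  exact (UniversalEnvelopingAlgebra.lift ℂ f u).2

theorem FiniteTrunc.of_lieSpan {K : Type*} [Finite K] {g : K → L}
    (hg : LieSubalgebra.lieSpan ℂ L (range g) = ⊤) : FiniteTrunc L where
  finite N := by
    have := Fintype.ofFinite K
    exact finiteDimensional_quotient_pow (adjoin_range_ι_eq_top hg) (augIdeal L)
      (fun k => iota_mem_augIdeal (g k)) N

theorem freeLie_lieSpan_eq_top (X : Type*) :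
    LieSubalgebra.lieSpan ℂ (FreeLieAlgebra ℂ X) (range (FreeLieAlgebra.of ℂ)) = ⊤ := by
  set S := LieSubalgebra.lieSpan ℂ (FreeLieAlgebra ℂ X) (range (FreeLieAlgebra.of ℂ))
  let f : FreeLieAlgebra ℂ X →ₗ⁅ℂ⁆ S :=
    FreeLieAlgebra.lift ℂ fun x => ⟨FreeLieAlgebra.of ℂ x, LieSubalgebra.subset_lieSpan ⟨x, rfl⟩⟩
  have h : S.incl.comp f = LieHom.id := by
    ext x
    simp [f]
  rw [eq_top_iff]
  intro u _
  have := DFunLike.congr_fun h u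
  simp only [LieHom.comp_apply, LieHom.id_apply] at this
  rw [← this]
  exact (f u).2

theorem lieSpan_eq_top_of_surjective {L' : Type*} [LieRing L'] [LieAlgebra ℂ L'] (φ : L →ₗ⁅ℂ⁆ L')
    (hφ : Function.Surjective φ) {K : Type*} {g : K → L}
    (hg : LieSubalgebra.lieSpan ℂ L (range g) = ⊤) :
    LieSubalgebra.lieSpan ℂ L' (range fun k => φ (g k)) = ⊤ := by
  rw [eq_top_iff]
  intro y _
  obtain ⟨x, rfl⟩ := hφ y
  have hle : LieSubalgebra.lieSpan ℂ L (range g) ≤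
      (LieSubalgebra.lieSpan ℂ L' (range fun k => φ (g k))).comap φ := by
    rw [LieSubalgebra.lieSpan_le]
    rintro _ ⟨k, rfl⟩
    exact LieSubalgebra.subset_lieSpan ⟨k, rfl⟩
  exact hle (by rw [hg]; trivial)

/-- The projection from the free Lie algebra to the Drinfeld--Kohno Lie algebra. -/
def toDK (ι : Type*) : FreeLieAlgebra ℂ (ι × ι) →ₗ⁅ℂ⁆ DrinfeldKohno ι where
  toFun x := LieSubmodule.Quotient.mk x
  map_add' _ _ := rfl
  map_smul' _ _ := rfl
  map_lie' := by intro x y; rfl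

theorem toDK_surjective (ι : Type*) : Function.Surjective (toDK ι) := Quotient.mk_surjective

theorem proj_surjective (n : ℕ) : Function.Surjective (proj n) := Quotient.mk_surjective

theorem gen_lieSpan_eq_top (ι : Type*) :
    LieSubalgebra.lieSpan ℂ (DrinfeldKohno ι) (range fun p : ι × ι => gen p.1 p.2) = ⊤ :=
  lieSpan_eq_top_of_surjective (toDK ι) (toDK_surjective ι) (freeLie_lieSpan_eq_top (ι × ι))

instance (n : ℕ) : Finite (Strand n) :=
  Finite.of_surjective (fun x : Fin n ⊕ Bool =>
    Sum.elim Strand.pt (fun b => if b then Strand.z else Strand.w) x) fun s => by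
    cases s with
    | pt k => exact ⟨Sum.inl k, rfl⟩
    | z => exact ⟨Sum.inr true, rfl⟩
    | w => exact ⟨Sum.inr false, rfl⟩

instance (n : ℕ) : FiniteTrunc (TLie n) := FiniteTrunc.of_lieSpan (gen_lieSpan_eq_top (Strand n))

instance (n : ℕ) : FiniteTrunc (TauLie n) :=
  FiniteTrunc.of_lieSpan
    (lieSpan_eq_top_of_surjective (proj n) (proj_surjective n) (gen_lieSpan_eq_top (Strand n)))

end FiniteTrunc

/-! ### Norms on the truncations -/

section Norm

/-- A submultiplicative norm on a finite-dimensional algebra, from its left regular representation. -/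
abbrev normedRingOfFinite (A : Type*) [Ring A] [Algebra ℂ A] [FiniteDimensional ℂ A] :
    NormedRing A :=
  letI : NormedRing (Matrix (Fin (Module.finrank ℂ A)) (Fin (Module.finrank ℂ A)) ℂ) :=
    Matrix.linftyOpNormedRing
  NormedRing.induced A (Matrix (Fin (Module.finrank ℂ A)) (Fin (Module.finrank ℂ A)) ℂ)
    (Algebra.leftMulMatrix (Module.finBasis ℂ A)) (Algebra.leftMulMatrix_injective _)

variable {L : Type*} [LieRing L] [LieAlgebra ℂ L] [FiniteTrunc L]

instance truncNormedRing (N : ℕ) : NormedRing (Trunc L N) := normedRingOfFinite _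

instance truncNormedAlgebra (N : ℕ) : NormedAlgebra ℂ (Trunc L N) :=
  letI : NormedRing (Matrix (Fin (Module.finrank ℂ (Trunc L N)))
    (Fin (Module.finrank ℂ (Trunc L N))) ℂ) := Matrix.linftyOpNormedRing
  letI : NormedAlgebra ℂ (Matrix (Fin (Module.finrank ℂ (Trunc L N)))
    (Fin (Module.finrank ℂ (Trunc L N))) ℂ) := Matrix.linftyOpNormedAlgebra
  NormedAlgebra.induced ℂ (Trunc L N) (Matrix (Fin (Module.finrank ℂ (Trunc L N)))
    (Fin (Module.finrank ℂ (Trunc L N))) ℂ) (Algebra.leftMulMatrix (Module.finBasis ℂ (Trunc L N)))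

end Norm

/-! ### The filtration by powers of the augmentation ideal -/

section Filtration

theorem IsNilFiltration.pow_mem {A : Type*} [Ring A] [Algebra ℂ A] {F : ℕ → Submodule ℂ A} {N : ℕ}
    (hF : IsNilFiltration F N) {a : A} (ha : a ∈ F 1) (k : ℕ) : a ^ k ∈ F k := by
  induction k with
  | zero => rw [hF.zero]; trivial
  | succ k ih => rw [pow_succ]; exact hF.mul_right k a ha _ ih

theorem IsNilFiltration.pow_eq_zero {A : Type*} [Ring A] [Algebra ℂ A] {F : ℕ → Submodule ℂ A}
    {N : ℕ} (hF : IsNilFiltration F N) {a : A} (ha : a ∈ F 1) : a ^ N = 0 := by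
  have := hF.pow_mem ha N
  rwa [hF.last, Submodule.mem_bot] at this

theorem IsNilFiltration.isUnit {A : Type*} [Ring A] [Algebra ℂ A] {F : ℕ → Submodule ℂ A}
    {N : ℕ} (hF : IsNilFiltration F N) {a : A} (ha : a - 1 ∈ F 1) : IsUnit a := by
  have h : IsNilpotent (a - 1) := ⟨N, hF.pow_eq_zero ha⟩
  simpa using h.isUnit_one_add

theorem _root_.Ideal.mul_pow_mem {U : Type*} [Ring U] (I : Ideal U) [I.IsTwoSided] {a v : U} {k : ℕ}
    (ha : a ∈ I) (hv : v ∈ I ^ k) : a * v ∈ I ^ (k + 1) := by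
  rcases Nat.eq_zero_or_pos k with rfl | hk
  · rw [Submodule.pow_succ, Submodule.pow_zero, Ideal.one_eq_top, ← one_mul (a * v)]
    exact Ideal.mul_mem_mul trivial (I.mul_mem_right v ha)
  · rw [Submodule.pow_succ' I hk.ne']
    exact Ideal.mul_mem_mul ha hv

variable (L : Type*) [LieRing L] [LieAlgebra ℂ L]

/-- The filtration of `U(L) / I ^ N` by the images of the powers of the augmentation ideal. -/
def augFiltration (N k : ℕ) : Submodule ℂ (Trunc L N) :=
  ((augIdeal L ^ k).restrictScalars ℂ).map (Ideal.Quotient.mkₐ ℂ (augIdeal L ^ N)).toLinearMap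

theorem isNilFiltration_aug (N : ℕ) : IsNilFiltration (augFiltration L N) N where
  zero := by
    rw [eq_top_iff]
    intro x _
    obtain ⟨u, rfl⟩ := Ideal.Quotient.mk_surjective x
    exact ⟨u, by simp [Submodule.pow_zero], rfl⟩
  last := by
    rw [eq_bot_iff]
    rintro _ ⟨u, hu, rfl⟩
    exact Ideal.Quotient.eq_zero_iff_mem.2 hu
  mul_left := by
    rintro k _ ⟨a, ha, rfl⟩ _ ⟨v, hv, rfl⟩
    refine ⟨a * v, ?_, by simp⟩
    have ha : a ∈ augIdeal L ^ 1 := ha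
    rw [Submodule.pow_one] at ha
    exact Ideal.mul_pow_mem _ ha hv
  mul_right := by
    rintro k _ ⟨a, ha, rfl⟩ _ ⟨v, hv, rfl⟩
    refine ⟨v * a, ?_, by simp⟩
    have ha : a ∈ augIdeal L ^ 1 := ha
    rw [Submodule.pow_one] at ha
    have := Ideal.mul_mem_mul hv ha
    rwa [← Submodule.pow_succ] at this

theorem augFiltration_mul_mem {N k : ℕ} {v : Trunc L N} (hv : v ∈ augFiltration L N k)
    (x : Trunc L N) : v * x ∈ augFiltration L N k := by
  obtain ⟨u, hu, rfl⟩ := hv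
  obtain ⟨w, rfl⟩ := Ideal.Quotient.mk_surjective x
  exact ⟨u * w, Ideal.mul_mem_right w _ hu, by simp⟩

/-- The map from `L` to `U(L) / I ^ N`. -/
def toTrunc (N : ℕ) : L →ₗ[ℂ] Trunc L N :=
  (Ideal.Quotient.mkₐ ℂ (augIdeal L ^ N)).toLinearMap.comp
    (UniversalEnvelopingAlgebra.ι ℂ : L →ₗ⁅ℂ⁆ _).toLinearMap

variable {L}

theorem mul_val (N : ℕ) (x y : CompletedU L) : (x * y).1 N = x.1 N * y.1 N := rfl

theorem sub_val (N : ℕ) (x y : CompletedU L) : (x - y).1 N = x.1 N - y.1 N := rfl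

theorem one_val (N : ℕ) : (1 : CompletedU L).1 N = 1 := rfl

theorem completedU_ext {x y : CompletedU L} (h : ∀ N, x.1 N = y.1 N) : x = y :=
  Subtype.ext (funext h)

theorem toTrunc_mem (N : ℕ) (y : L) : toTrunc L N y ∈ augFiltration L N 1 :=
  ⟨_, by
    change _ ∈ augIdeal L ^ 1
    rw [Submodule.pow_one]
    exact iota_mem_augIdeal y, rfl⟩

theorem toTrunc_lie (N : ℕ) (x y : L) :
    toTrunc L N ⁅x, y⁆ = toTrunc L N x * toTrunc L N y - toTrunc L N y * toTrunc L N x := by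
  simp [toTrunc, LieRing.of_associative_ring_bracket]

theorem toTrunc_commute (N : ℕ) {x y : L} (h : ⁅x, y⁆ = 0) :
    Commute (toTrunc L N x) (toTrunc L N y) := by
  have := toTrunc_lie N x y
  rw [h, map_zero] at this
  exact (sub_eq_zero.1 this.symm)

theorem truncMap_toTrunc {M N : ℕ} (h : M ≤ N) (y : L) :
    truncMap L h (toTrunc L N y) = toTrunc L M y := rfl

/-- An element with constant term `1` is invertible: it is so in every truncation, where the
augmentation ideal is nilpotent, and inverses are unique, hence compatible. -/
theorem isUnit_completedU {x : CompletedU L} (hx : ∀ N, x.1 N - 1 ∈ augFiltration L N 1) :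
    IsUnit x := by
  choose u hu using fun N => (isNilFiltration_aug L N).isUnit (hx N)
  have hcompat : ∀ (M N : ℕ) (h : M ≤ N), truncMap L h (↑(u N)⁻¹ : Trunc L N) = ↑(u M)⁻¹ := by
    intro M N h
    have h1 : truncMap L h (↑(u N)⁻¹ : Trunc L N) * (u M : Trunc L M) = 1 := by
      rw [hu M, ← x.2 M N h, ← map_mul, ← hu N, Units.inv_mul, map_one]
    exact (Units.inv_eq_of_mul_eq_one_left h1).symm
  refine ⟨⟨x, ⟨fun N => ↑(u N)⁻¹, hcompat⟩, ?_, ?_⟩, rfl⟩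
  · refine completedU_ext fun N => ?_
    rw [mul_val, ← hu N]
    exact Units.mul_inv _
  · refine completedU_ext fun N => ?_
    rw [mul_val, ← hu N]
    exact Units.inv_mul _

end Filtration

/-! ### Exponentials in the completed enveloping algebra -/

section Exponential

variable {L : Type*} [LieRing L] [LieAlgebra ℂ L]

theorem expLie_val' (N : ℕ) (y : L) :
    (expLie y).1 N = ∑ k ∈ Finset.range N, ((k.factorial : ℂ)⁻¹) • (toTrunc L N y) ^ k := by
  simp [expLie, toTrunc]

variable [FiniteTrunc L]

theorem expLie_val (N : ℕ) (y : L) : (expLie y).1 N = NormedSpace.exp (toTrunc L N y) := by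
  rw [expLie_val', NormedSpace.exp_eq_tsum ℂ]
  symm
  refine tsum_eq_sum fun k hk => ?_
  rw [Finset.mem_range, not_lt] at hk
  rw [pow_eq_zero_of_le hk ((isNilFiltration_aug L N).pow_eq_zero (toTrunc_mem N y)), smul_zero]

theorem expLie_zero : expLie (0 : L) = 1 := by
  refine completedU_ext fun N => ?_
  rw [expLie_val, map_zero, NormedSpace.exp_zero]
  rfl

theorem expLie_mul_neg (y : L) : expLie y * expLie (-y) = 1 := by
  refine completedU_ext fun N => ?_
  have : CompleteSpace (Trunc L N) := FiniteDimensional.complete ℂ _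
  let _ : NormedAlgebra ℚ (Trunc L N) := NormedAlgebra.restrictScalars ℚ ℂ _
  rw [mul_val, expLie_val, expLie_val, map_neg,
    ← NormedSpace.exp_add_of_commute (Commute.neg_right (Commute.refl _)), add_neg_cancel,
    NormedSpace.exp_zero]
  rfl

theorem isUnit_expLie (y : L) : IsUnit (expLie y) := by
  refine ⟨⟨expLie y, expLie (-y), expLie_mul_neg y, ?_⟩, rfl⟩
  simpa using expLie_mul_neg (-y)

theorem expLie_commute {N : ℕ} {y : L} {b : Trunc L N} (h : Commute (toTrunc L N y) b) :
    Commute ((expLie y).1 N) b := by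
  rw [expLie_val']
  refine Commute.sum_left _ _ _ fun k _ => ?_
  exact Commute.smul_left (h.pow_left k) _

theorem hasDerivAt_expLie (N : ℕ) (y : L) (c : ℂ) :
    HasDerivAt (fun c : ℂ => (expLie (c • y)).1 N) ((expLie (c • y)).1 N * toTrunc L N y) c := by
  have : CompleteSpace (Trunc L N) := FiniteDimensional.complete ℂ _
  simp only [expLie_val, map_smul]
  exact hasDerivAt_exp_smul_const (toTrunc L N y) c

end Exponential

/-! ### Existence of solutions in the completed enveloping algebra -/

section Existence

variable {𝕜 : Type*} [RCLike 𝕜] [NormedAlgebra 𝕜 ℂ] [IsScalarTower ℝ 𝕜 ℂ]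
  {L : Type*} [LieRing L] [LieAlgebra ℂ L] [FiniteTrunc L]
  [∀ N, NormedAlgebra 𝕜 (Trunc L N)] [∀ N, IsScalarTower ℝ 𝕜 (Trunc L N)]
  [∀ N, IsScalarTower 𝕜 ℂ (Trunc L N)]

theorem _root_.ContDiffOn.smul_vec {E A : Type*} [NormedAddCommGroup E] [NormedSpace 𝕜 E]
    [NormedAddCommGroup A] [NormedSpace ℂ A] [NormedSpace 𝕜 A] [IsScalarTower 𝕜 ℂ A] {φ : E → ℂ}
    {D : Set E} {m : ℕ∞} (hφ : ContDiffOn 𝕜 m φ D) (v : A) :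
    ContDiffOn 𝕜 m (fun p => φ p • v) D :=
  (((ContinuousLinearMap.id ℂ ℂ).smulRight v).restrictScalars 𝕜).contDiff.comp_contDiffOn hφ

theorem _root_.HasFDerivAt.smul_vec {E A : Type*} [NormedAddCommGroup E] [NormedSpace 𝕜 E]
    [NormedAddCommGroup A] [NormedSpace ℂ A] [NormedSpace 𝕜 A] [IsScalarTower 𝕜 ℂ A] {φ : E → ℂ}
    {φ' : E →L[𝕜] ℂ} {p : E} (hφ : HasFDerivAt φ φ' p) (v : A) :
    HasFDerivAt (fun p => φ p • v)
      ((((ContinuousLinearMap.id ℂ ℂ).smulRight v).restrictScalars 𝕜).comp φ') p :=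
  (((ContinuousLinearMap.id ℂ ℂ).smulRight v).restrictScalars 𝕜).hasFDerivAt.comp p hφ

/-- Existence of the normalized regular factor of a flat logarithmic connection in two variables,
with values in the completed enveloping algebra. The connection is given by scalar functions `φ`,
`ψ` and Lie algebra elements `T`; `x · A_x = ∑ φ_k T_k` and `y · A_y = ∑ ψ_k T_k`. -/
theorem exists_completed_solution {K : Type*} [Fintype K] (T : K → L) {φ ψ : K → 𝕜 × 𝕜 → ℂ}
    {D : Set (𝕜 × 𝕜)} (hD : IsOpen D) (h0D : (0 : 𝕜 × 𝕜) ∈ D)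
    (hstar : ∀ p ∈ D, ∀ r ∈ Icc (0 : ℝ) 1, r • p ∈ D) {S₁ S₂ : L}
    (hφ : ∀ k, ContDiffOn 𝕜 (⊤ : ℕ∞) (φ k) D) (hψ : ∀ k, ContDiffOn 𝕜 (⊤ : ℕ∞) (ψ k) D)
    (hφ0 : ∑ k, φ k 0 • T k = S₁) (hψ0 : ∑ k, ψ k 0 • T k = S₂)
    (hcomm : ∀ p ∈ D, ⁅∑ k, φ k p • T k, ∑ k, ψ k p • T k⁆ = 0)
    (hclosed : ∀ p ∈ D, ∀ k, p.2 • fderiv 𝕜 (φ k) p (0, 1) = p.1 • fderiv 𝕜 (ψ k) p (1, 0)) :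
    ∃ f : 𝕜 × 𝕜 → CompletedU L, f 0 = 1 ∧ (∀ p, IsUnit (f p)) ∧
      (∀ N, ContDiffOn 𝕜 (⊤ : ℕ∞) (fun p => (f p).1 N) D) ∧
      ∀ N, ∀ p ∈ D,
        p.1 • fderiv 𝕜 (fun p => (f p).1 N) p (1, 0) =
            toTrunc L N (∑ k, φ k p • T k) * (f p).1 N - (f p).1 N * toTrunc L N S₁ ∧
        p.2 • fderiv 𝕜 (fun p => (f p).1 N) p (0, 1) =
            toTrunc L N (∑ k, ψ k p • T k) * (f p).1 N - (f p).1 N * toTrunc L N S₂ := by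
  classical
  have hsm : ∀ N {χ : K → 𝕜 × 𝕜 → ℂ}, (∀ k, ContDiffOn 𝕜 (⊤ : ℕ∞) (χ k) D) →
      ContDiffOn 𝕜 (⊤ : ℕ∞) (fun p => toTrunc L N (∑ k, χ k p • T k)) D := by
    intro N χ hχ
    simp only [map_sum, map_smul]
    exact ContDiffOn.sum fun k _ => (hχ k).smul_vec _
  have hfd : ∀ N {χ : K → 𝕜 × 𝕜 → ℂ}, (∀ k, ContDiffOn 𝕜 (⊤ : ℕ∞) (χ k) D) → ∀ p ∈ D, ∀ h,
      fderiv 𝕜 (fun p => toTrunc L N (∑ k, χ k p • T k)) p h =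
        ∑ k, (fderiv 𝕜 (χ k) p h) • toTrunc L N (T k) := by
    intro N χ hχ p hp h
    simp only [map_sum, map_smul]
    have : HasFDerivAt (fun p => ∑ k, χ k p • toTrunc L N (T k)) _ p :=
      HasFDerivAt.fun_sum fun k _ =>
        (((hχ k).differentiableOn (by simp)).differentiableAt
          (hD.mem_nhds hp)).hasFDerivAt.smul_vec (toTrunc L N (T k))
    rw [this.fderiv]
    simp
  have hex := fun N => exists_logConnection_solution (𝕜 := 𝕜) (isNilFiltration_aug L N) hD h0D hstar
    (hsm N hφ) (hsm N hψ) (fun p _ => toTrunc_mem N _) (fun p _ => toTrunc_mem N _)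
    (congrArg (toTrunc L N) hφ0) (congrArg (toTrunc L N) hψ0)
    (fun p hp => toTrunc_commute N (hcomm p hp)) (fun p hp => by
      rw [hfd N hφ p hp, hfd N hψ p hp, Finset.smul_sum, Finset.smul_sum]
      refine Finset.sum_congr rfl fun k _ => ?_
      rw [← smul_assoc, ← smul_assoc, hclosed p hp k])
  choose f hfs hf0 hf1 hfx using hex
  have hsplit : ∀ N (U : 𝕜 × 𝕜 →L[𝕜] Trunc L N) (p : 𝕜 × 𝕜),
      U p = p.1 • U (1, 0) + p.2 • U (0, 1) := by
    intro N U p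
    rw [← map_smul, ← map_smul, ← map_add]
    simp
  -- solutions in different truncations are compatible by uniqueness
  have hcompat : ∀ (M N : ℕ) (h : M ≤ N), ∀ p ∈ D, truncMap L h (f N p) = f M p := by
    intro M N h p hp
    let τ : Trunc L N →L[𝕜] Trunc L M :=
      (LinearMap.toContinuousLinearMap (truncMap L h).toLinearMap).restrictScalars 𝕜
    have hτ : ∀ x, τ x = truncMap L h x := fun _ => rfl
    have key := euler_unique (𝕜 := 𝕜) (isNilFiltration_aug L M).zero (isNilFiltration_aug L M).last
      hD h0D hstar (M := fun p v =>
        (toTrunc L M (∑ k, φ k p • T k) + toTrunc L M (∑ k, ψ k p • T k)) * v -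
          v * (toTrunc L M S₁ + toTrunc L M S₂))
      (fun p _ k v hv => logConnection_raises (isNilFiltration_aug L M)
        (Submodule.add_mem _ (toTrunc_mem M _) (toTrunc_mem M _))
        (Submodule.add_mem _ (toTrunc_mem M _) (toTrunc_mem M _)) k hv)
      (u := fun p => τ (f N p) - f M p)
      ((τ.differentiable.comp_differentiableOn ((hfs N).differentiableOn (by simp))).sub
        ((hfs M).differentiableOn (by simp)))
      (by simp only [hf0, hτ, map_one, sub_self]) ?_ p hp
    · exact sub_eq_zero.1 key
    · intro p hp
      have h1 : HasFDerivAt (f N) (fderiv 𝕜 (f N) p) p :=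
        (((hfs N).differentiableOn (by simp)).differentiableAt (hD.mem_nhds hp)).hasFDerivAt
      have h2 : HasFDerivAt (f M) (fderiv 𝕜 (f M) p) p :=
        (((hfs M).differentiableOn (by simp)).differentiableAt (hD.mem_nhds hp)).hasFDerivAt
      have h3 := (τ.hasFDerivAt.comp p h1).sub h2
      have h4 : fderiv 𝕜 (fun p => τ (f N p) - f M p) p = _ := HasFDerivAt.fderiv h3
      rw [h4, sub_apply, ContinuousLinearMap.comp_apply, hsplit N, hsplit M, (hfx N p hp).1,
        (hfx N p hp).2, (hfx M p hp).1, (hfx M p hp).2]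
      simp only [hτ, map_add, map_sub, map_mul, truncMap_toTrunc]
      noncomm_ring
  let g : 𝕜 × 𝕜 → CompletedU L := fun p =>
    if hp : p ∈ D then ⟨fun N => f N p, fun M N h => hcompat M N h p hp⟩ else 1
  have hg : ∀ N, ∀ p ∈ D, (g p).1 N = f N p := by
    intro N p hp
    simp only [g, dif_pos hp]
  refine ⟨g, completedU_ext fun N => by rw [hg N 0 h0D, hf0]; rfl, fun p => ?_,
    fun N => (hfs N).congr fun p hp => hg N p hp, fun N p hp => ?_⟩
  · refine isUnit_completedU fun N => ?_
    by_cases hp : p ∈ D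
    · rw [hg N p hp]; exact hf1 N p hp
    · simp only [g, dif_neg hp, one_val, sub_self]; exact Submodule.zero_mem _
  · have he : (fun p => (g p).1 N) =ᶠ[𝓝 p] f N := by
      filter_upwards [hD.mem_nhds hp] with q hq using hg N q hq
    rw [he.fderiv_eq, hg N p hp]
    exact hfx N p hp

end Existence

/-! ### Flat sections and their uniqueness -/

section Flat

variable {L : Type*} [LieRing L] [LieAlgebra ℂ L]

section Weak

variable {𝕜 : Type*} [NontriviallyNormedField 𝕜] [NormedAlgebra 𝕜 ℂ]
  {E : Type*} [NormedAddCommGroup E] [NormedSpace 𝕜 E] {A : E → E → L} {F : E → CompletedU L}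
  {D : Set E}

theorem IsFlatOn.mono {D' : Set E} (h : IsFlatOn 𝕜 A F D) (hD : D' ⊆ D) : IsFlatOn 𝕜 A F D' :=
  fun p hp => h p (hD hp)

theorem IsFlatOn.mul_const (h : IsFlatOn 𝕜 A F D) (H : CompletedU L) :
    IsFlatOn 𝕜 A (fun p => F p * H) D := by
  intro p hp N c
  obtain ⟨F', hF', hF'h⟩ := h p hp N (c.comp (LinearMap.mulRight ℂ (H.1 N)))
  refine ⟨F', hF', fun k => ?_⟩
  rw [hF'h, ← mul_assoc]
  rfl

/-- Flat sections pull back to flat sections. -/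
theorem IsFlatOn.pullback [NormedSpace ℝ E] [NormedAlgebra ℝ 𝕜] [IsScalarTower ℝ 𝕜 E]
    [IsScalarTower ℝ 𝕜 ℂ] {E' : Type*} [NormedAddCommGroup E'] [NormedSpace ℝ E']
    (h : IsFlatOn 𝕜 A F D) {g : E' → E} {g' : E' → E' →L[ℝ] E} {S : Set E'}
    (hg : ∀ p ∈ S, HasFDerivAt g (g' p) p) (hS : ∀ p ∈ S, g p ∈ D) :
    IsFlatOn ℝ (fun p v => A (g p) (g' p v)) (fun p => F (g p)) S := by
  intro p hp N c
  obtain ⟨F', hF', hF'h⟩ := h (g p) (hS p hp) N c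
  exact ⟨(F'.restrictScalars ℝ).comp (g' p), (hF'.restrictScalars ℝ).comp p (hg p hp),
    fun v => hF'h _⟩

end Weak

section Strong

variable [FiniteTrunc L]
  {𝕜 : Type*} [NontriviallyNormedField 𝕜] [NormedAlgebra 𝕜 ℂ]
  {E : Type*} [NormedAddCommGroup E] [NormedSpace 𝕜 E] {A : E → E → L} {F : E → CompletedU L}
  {D : Set E} [∀ N, NormedAlgebra 𝕜 (Trunc L N)] [∀ N, IsScalarTower 𝕜 ℂ (Trunc L N)]

/-- In finite-dimensional truncations, flatness in all linear coordinates is flatness with respect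
to the norm. -/
theorem isFlatOn_iff : IsFlatOn 𝕜 A F D ↔ ∀ p ∈ D, ∀ N, ∃ F' : E →L[𝕜] Trunc L N,
    HasFDerivAt (fun q => (F q).1 N) F' p ∧ ∀ h, F' h = toTrunc L N (A p h) * (F p).1 N := by
  constructor
  · intro hF p hp N
    let b := Module.finBasis ℂ (Trunc L N)
    choose F' hF' hF'h using fun i => hF p hp N (b.coord i)
    refine ⟨∑ i, (((ContinuousLinearMap.id ℂ ℂ).smulRight (b i)).restrictScalars 𝕜).comp (F' i),
      ?_, fun h => ?_⟩
    · have h1 : HasFDerivAt (fun q => ∑ i, b.coord i ((F q).1 N) • b i) _ p :=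
        HasFDerivAt.fun_sum fun i _ =>
          (((ContinuousLinearMap.id ℂ ℂ).smulRight (b i)).restrictScalars 𝕜).hasFDerivAt.comp p
            (hF' i)
      refine h1.congr_of_eventuallyEq (Eventually.of_forall fun q => ?_)
      simp only [Module.Basis.coord_apply]
      exact (b.sum_repr _).symm
    · have h1 : ∀ i, F' i h = b.coord i (toTrunc L N (A p h) * (F p).1 N) := fun i => hF'h i h
      simp only [sum_apply, ContinuousLinearMap.comp_apply,
        ContinuousLinearMap.coe_restrictScalars', ContinuousLinearMap.smulRight_apply,
        ContinuousLinearMap.id_apply, h1, Module.Basis.coord_apply]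
      exact b.sum_repr _
  · intro hF p hp N c
    obtain ⟨F', hF', hF'h⟩ := hF p hp N
    let C : Trunc L N →L[𝕜] ℂ := (LinearMap.toContinuousLinearMap c).restrictScalars 𝕜
    refine ⟨C.comp F', C.hasFDerivAt.comp p hF', fun h => ?_⟩
    change c (F' h) = _
    rw [hF'h]
    rfl

theorem isFlatOn_of_hasDerivAt {a : 𝕜 → L} {A : 𝕜 → 𝕜 → L} {F : 𝕜 → CompletedU L} {D : Set 𝕜}
    (hA : ∀ p ∈ D, ∀ h, A p h = (algebraMap 𝕜 ℂ h) • a p)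
    (hF : ∀ p ∈ D, ∀ N, HasDerivAt (fun q => (F q).1 N) (toTrunc L N (a p) * (F p).1 N) p) :
    IsFlatOn 𝕜 A F D := by
  refine isFlatOn_iff.2 fun p hp N => ⟨_, (hF p hp N).hasFDerivAt, fun h => ?_⟩
  rw [hA p hp, map_smul, smul_mul_assoc, algebraMap_smul]
  simp

theorem IsFlatOn.continuousAt (h : IsFlatOn 𝕜 A F D) {p : E} (hp : p ∈ D) (N : ℕ) :
    ContinuousAt (fun q => (F q).1 N) p := by
  obtain ⟨F', hF', -⟩ := isFlatOn_iff.1 h p hp N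
  exact hF'.continuousAt

/-- The differential equation for a flat section along a curve. -/
theorem IsFlatOn.hasDerivAt_curve [NormedSpace ℝ E] [NormedAlgebra ℝ 𝕜] [IsScalarTower ℝ 𝕜 E]
    [∀ N, IsScalarTower ℝ 𝕜 (Trunc L N)]
    (h : IsFlatOn 𝕜 A F D) {q : ℝ → E} {v : E} {r : ℝ} (hq : HasDerivAt q v r) (hr : q r ∈ D)
    (N : ℕ) :
    HasDerivAt (fun r => (F (q r)).1 N) (toTrunc L N (A (q r) v) * (F (q r)).1 N) r := by
  obtain ⟨F', hF', hF'h⟩ := isFlatOn_iff.1 h (q r) hr N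
  rw [← hF'h]
  exact (hF'.restrictScalars ℝ).comp_hasDerivAt r hq

theorem IsHolomorphicOn.continuousAt {E : Type*} [NormedAddCommGroup E] [NormedSpace ℂ E]
    {f : E → CompletedU L} {D : Set E} (hf : IsHolomorphicOn f D) {p : E} (hp : D ∈ 𝓝 p) (N : ℕ) :
    ContinuousAt (fun q => (f q).1 N) p := by
  let b := Module.finBasis ℂ (Trunc L N)
  have h1 : ContinuousAt (fun q => ∑ i, b.coord i ((f q).1 N) • b i) p :=
    tendsto_finsetSum _ fun i _ =>
      (((hf N (b.coord i)).differentiableAt hp).continuousAt).smul continuousAt_const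
  refine h1.congr (Eventually.of_forall fun q => ?_)
  simp only [Module.Basis.coord_apply]
  exact b.sum_repr _

theorem isHolomorphicOn_of_contDiffOn {E : Type*} [NormedAddCommGroup E] [NormedSpace ℂ E]
    {f : E → CompletedU L} {D : Set E}
    (hf : ∀ N, ContDiffOn ℂ (⊤ : ℕ∞) (fun q => (f q).1 N) D) : IsHolomorphicOn f D := by
  intro N c
  exact (LinearMap.toContinuousLinearMap c).differentiable.comp_differentiableOn
    ((hf N).differentiableOn (by simp))

end Strong

section Uniqueness

variable [FiniteTrunc L]

/-- Uniqueness of flat sections along an interval, from their asymptotics: if `F * X` tends to zero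
for an invertible `X` whose velocity lies in the augmentation ideal, then `F = 0`. Here `X` is the
inverse of the singular factor of a solution. -/
theorem curve_eq_zero {N : ℕ} {α β : ℝ} {F : ℝ → Trunc L N} {a : ℝ → L}
    (hF : ∀ r ∈ Ioo α β, HasDerivAt F (toTrunc L N (a r) * F r) r) {X X' Y : ℝ → Trunc L N}
    (hX : ∀ r ∈ Ioo α β, HasDerivAt X (X' r) r)
    (hX' : ∀ r ∈ Ioo α β, X' r ∈ augFiltration L N 1) (hXY : ∀ r ∈ Ioo α β, X r * Y r = 1)
    {l : Filter ℝ} [l.NeBot] (hl : l ≤ 𝓟 (Ioo α β))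
    (h0 : Tendsto (fun r => F r * X r) l (𝓝 0)) : ∀ r ∈ Ioo α β, F r = 0 := by
  have hFil := isNilFiltration_aug L N
  have key := eq_zero_of_raises hFil.zero hFil.last (fun r hr => (hF r hr).mul (hX r hr)) ?_ hl h0
  · intro r hr
    have h1 : F r * X r = 0 := key r hr
    rw [← mul_one (F r), ← hXY r hr, ← mul_assoc, h1, zero_mul]
  · intro k r hr hk
    have hk : F r * X r ∈ augFiltration L N k := hk
    have h1 : F r ∈ augFiltration L N k := by
      have := augFiltration_mul_mem L hk (Y r)
      rwa [mul_assoc, hXY r hr, mul_one] at this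
    exact Submodule.add_mem _
      (augFiltration_mul_mem L (hFil.mul_left k _ (toTrunc_mem N _) _ h1) _)
      (hFil.mul_right k _ (hX' r hr) _ h1)

theorem curve_eq_zero_of_tendsto {N : ℕ} {α β : ℝ} {F : ℝ → Trunc L N} {a : ℝ → L}
    (hF : ∀ r ∈ Ioo α β, HasDerivAt F (toTrunc L N (a r) * F r) r)
    {l : Filter ℝ} [l.NeBot] (hl : l ≤ 𝓟 (Ioo α β))
    (h0 : Tendsto F l (𝓝 0)) : ∀ r ∈ Ioo α β, F r = 0 :=
  curve_eq_zero hF (X := fun _ => 1) (X' := fun _ => 0) (Y := fun _ => 1)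
    (fun r _ => hasDerivAt_const r _) (fun _ _ => Submodule.zero_mem _) (fun _ _ => mul_one 1) hl
    (by simpa using h0)

/-- Flat sections on a convex open set which agree at a point agree everywhere. -/
theorem flat_unique {E : Type*} [NormedAddCommGroup E] [NormedSpace ℝ E] {A : E → E → L}
    {F G : E → CompletedU L} {D : Set E} (hD : IsOpen D) (hconv : Convex ℝ D)
    (hF : IsFlatOn ℝ A F D) (hG : IsFlatOn ℝ A G D) {p₀ : E} (hp₀ : p₀ ∈ D) (h0 : F p₀ = G p₀) :
    ∀ p ∈ D, F p = G p := by
  intro p hp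
  refine completedU_ext fun N => ?_
  -- compare along a segment, extended slightly beyond its ends
  let q : ℝ → E := fun r => p₀ + r • (p - p₀)
  have hq : ∀ r, HasDerivAt q (p - p₀) r := fun r => by
    have h : HasDerivAt (fun r : ℝ => p₀ + r • (p - p₀)) ((1 : ℝ) • (p - p₀)) r :=
      ((hasDerivAt_id r).smul_const (p - p₀)).const_add p₀
    rwa [one_smul] at h
  have hqc : Continuous q := by fun_prop
  have hIcc : ∀ r ∈ Icc (0 : ℝ) 1, q r ∈ D := fun r hr => by
    have := hconv hp₀ hp (sub_nonneg.2 hr.2) hr.1 (by ring)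
    convert this using 1
    simp only [q, smul_sub, sub_smul, one_smul]
    abel
  obtain ⟨δ₀, hδ₀, h0D⟩ := Metric.eventually_nhds_iff.1
    (hqc.continuousAt.eventually_mem (hD.mem_nhds (hIcc 0 (by simp))))
  obtain ⟨δ₁, hδ₁, h1D⟩ := Metric.eventually_nhds_iff.1
    (hqc.continuousAt.eventually_mem (hD.mem_nhds (hIcc 1 (by simp))))
  have hmem : ∀ r ∈ Ioo (-δ₀) (1 + δ₁), q r ∈ D := by
    intro r hr
    rcases lt_or_ge r 0 with h | h
    · exact h0D (by rw [Real.dist_eq, abs_lt]; constructor <;> linarith [hr.1])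
    rcases le_or_gt r 1 with h' | h'
    · exact hIcc r ⟨h, h'⟩
    · exact h1D (by rw [Real.dist_eq, abs_lt]; constructor <;> linarith [hr.2])
  have key := curve_eq_zero_of_tendsto (N := N) (α := -δ₀) (β := 1 + δ₁)
    (F := fun r => (F (q r)).1 N - (G (q r)).1 N) (a := fun r => A (q r) (p - p₀))
    (fun r hr => by
      rw [mul_sub]
      exact (hF.hasDerivAt_curve (hq r) (hmem r hr) N).sub
        (hG.hasDerivAt_curve (hq r) (hmem r hr) N))
    (l := pure 0) (by
      rw [pure_le_principal]
      constructor <;> linarith)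
    (by
      rw [tendsto_pure_left]
      intro s hs
      have : (F (q 0)).1 N - (G (q 0)).1 N = 0 := by simp [q, h0]
      rw [this]
      exact mem_of_mem_nhds hs)
    1 (by constructor <;> linarith)
  have h1 : q 1 = p := by simp [q]
  simp only [h1] at key
  exact sub_eq_zero.1 key

end Uniqueness

end Flat

/-! ### Existence in one variable -/

section OneVariableExistence

set_option linter.unusedSectionVars false

variable {𝕜 : Type*} [RCLike 𝕜] [NormedAlgebra 𝕜 ℂ] [IsScalarTower ℝ 𝕜 ℂ]
  {L : Type*} [LieRing L] [LieAlgebra ℂ L] [FiniteTrunc L]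
  [∀ N, NormedAlgebra 𝕜 (Trunc L N)] [∀ N, IsScalarTower ℝ 𝕜 (Trunc L N)]
  [∀ N, IsScalarTower 𝕜 ℂ (Trunc L N)]

/-- The one-variable case: the equation `x f' = (∑ φ_k T_k) f - f S` with `f(0) = 1`, viewed as an
equation in two variables that does not involve the second one. -/
theorem exists_completed_solution_one {K : Type*} [Fintype K] (T : K → L) {φ : K → 𝕜 → ℂ}
    {D : Set 𝕜} (hD : IsOpen D) (h0D : (0 : 𝕜) ∈ D)
    (hstar : ∀ p ∈ D, ∀ r ∈ Icc (0 : ℝ) 1, r • p ∈ D) {S : L}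
    (hφ : ∀ k, ContDiffOn 𝕜 (⊤ : ℕ∞) (φ k) D) (hφ0 : ∑ k, φ k 0 • T k = S) :
    ∃ f : 𝕜 → CompletedU L, f 0 = 1 ∧ (∀ p, IsUnit (f p)) ∧
      (∀ N, ContDiffOn 𝕜 (⊤ : ℕ∞) (fun p => (f p).1 N) D) ∧
      ∀ N, ∀ x ∈ D, x • deriv (fun p => (f p).1 N) x =
        toTrunc L N (∑ k, φ k x • T k) * (f x).1 N - (f x).1 N * toTrunc L N S := by
  have hDu : IsOpen (D ×ˢ (univ : Set 𝕜)) := hD.prod isOpen_univ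
  obtain ⟨f, hf0, hfu, hfs, hfx⟩ := exists_completed_solution (𝕜 := 𝕜) T
    (φ := fun k p => φ k p.1) (ψ := fun _ _ => 0) (S₁ := S) (S₂ := 0) hDu (by simp [h0D])
    (fun p hp r hr => ⟨hstar p.1 hp.1 r hr, trivial⟩)
    (fun k => (hφ k).comp contDiffOn_fst fun p hp => hp.1) (fun k => contDiffOn_const)
    (by simpa using hφ0) (by simp) (by simp) (by
      intro p hp k
      have h1 : HasFDerivAt (φ k) (fderiv 𝕜 (φ k) p.1) p.1 :=
        (((hφ k).differentiableOn (by simp)).differentiableAt (hD.mem_nhds hp.1)).hasFDerivAt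
      have h2 : HasFDerivAt (fun p : 𝕜 × 𝕜 => φ k p.1) _ p := h1.comp p hasFDerivAt_fst
      rw [h2.fderiv]
      simp)
  have hmap : MapsTo (fun x : 𝕜 => (x, (0 : 𝕜))) D (D ×ˢ univ) := fun x hx => ⟨hx, trivial⟩
  refine ⟨fun x => f (x, 0), hf0, fun x => hfu _,
    fun N => (hfs N).comp (contDiffOn_id.prodMk contDiffOn_const) hmap, fun N x hx => ?_⟩
  have h1 : HasFDerivAt (fun p => (f p).1 N) (fderiv 𝕜 (fun p => (f p).1 N) (x, 0)) (x, 0) :=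
    (((hfs N).differentiableOn (by simp)).differentiableAt
      (hDu.mem_nhds (hmap hx))).hasFDerivAt
  have h2 : HasDerivAt (fun x => (f (x, 0)).1 N) (fderiv 𝕜 (fun p => (f p).1 N) (x, 0) (1, 0)) x :=
    HasFDerivAt.comp_hasDerivAt (f := fun x : 𝕜 => (x, (0 : 𝕜))) x h1
      ((hasDerivAt_id' x).prodMk (hasDerivAt_const x (0 : 𝕜)))
  rw [h2.deriv]
  exact (hfx N (x, 0) (hmap hx)).1

theorem eq_zero_of_smul_eq_zero {W : Type*} [NormedAddCommGroup W] [NormedSpace 𝕜 W] {D : Set 𝕜}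
    (hD : IsOpen D) {g : 𝕜 → W} (hg : ContinuousOn g D) (h0 : ∀ x ∈ D, x • g x = 0) :
    ∀ x ∈ D, g x = 0 := by
  intro x hx
  rcases eq_or_ne x 0 with rfl | hx0
  · have h1 : Tendsto g (𝓝[≠] 0) (𝓝 (g 0)) :=
      (hg.continuousAt (hD.mem_nhds hx)).tendsto.mono_left nhdsWithin_le_nhds
    have h2 : Tendsto g (𝓝[≠] 0) (𝓝 0) := by
      refine tendsto_const_nhds.congr' ?_
      filter_upwards [nhdsWithin_le_nhds (hD.mem_nhds hx), self_mem_nhdsWithin] with y hy hy0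
      exact ((smul_eq_zero.1 (h0 y hy)).resolve_left hy0).symm
    exact tendsto_nhds_unique h1 h2
  · exact (smul_eq_zero.1 (h0 x hx)).resolve_left hx0

/-- The regular equation `f' = (∑ φ_k T_k) f` with `f(0) = 1`, multiplied by `x`, is a logarithmic one
with residue `0`; the factor `x` is divided out by continuity. -/
theorem exists_regular_solution {K : Type*} [Fintype K] (T : K → L) {φ : K → 𝕜 → ℂ}
    {D : Set 𝕜} (hD : IsOpen D) (h0D : (0 : 𝕜) ∈ D)
    (hstar : ∀ p ∈ D, ∀ r ∈ Icc (0 : ℝ) 1, r • p ∈ D)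
    (hφ : ∀ k, ContDiffOn 𝕜 (⊤ : ℕ∞) (φ k) D) :
    ∃ f : 𝕜 → CompletedU L, f 0 = 1 ∧ (∀ p, IsUnit (f p)) ∧
      ∀ N, ∀ x ∈ D, HasDerivAt (fun p => (f p).1 N)
        (toTrunc L N (∑ k, φ k x • T k) * (f x).1 N) x := by
  obtain ⟨f, hf0, hfu, hfs, hfx⟩ := exists_completed_solution_one (𝕜 := 𝕜) T
    (φ := fun k x => x • φ k x) (S := 0) hD h0D hstar (fun k => contDiffOn_id.smul (hφ k))
    (by simp)
  refine ⟨f, hf0, hfu, fun N => ?_⟩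
  have hc : ContinuousOn (deriv fun p => (f p).1 N) D :=
    (hfs N).continuousOn_deriv_of_isOpen hD (by simp)
  have hA : ContinuousOn (fun x => toTrunc L N (∑ k, φ k x • T k)) D := by
    simp only [map_sum, map_smul]
    exact continuousOn_finsetSum _ fun k _ => (hφ k).continuousOn.fun_smul continuousOn_const
  have key := eq_zero_of_smul_eq_zero hD (hc.sub (hA.mul (hfs N).continuousOn)) fun x hx => by
    simp only [Pi.sub_apply, Pi.mul_apply, smul_sub, hfx N x hx, map_zero, mul_zero, sub_zero]
    simp only [map_sum, map_smul, Finset.sum_mul, Finset.smul_sum, smul_mul_assoc, smul_assoc,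
      sub_self]
  intro x hx
  have h2 : deriv (fun p => (f p).1 N) x = toTrunc L N (∑ k, φ k x • T k) * (f x).1 N :=
    sub_eq_zero.1 (key x hx)
  rw [← h2]
  exact (((hfs N).differentiableOn (by simp)).differentiableAt (hD.mem_nhds hx)).hasDerivAt

end OneVariableExistence

/-! ### Regularized holonomy -/

section OneVariable

set_option linter.unusedSectionVars false

theorem IsFlatOn.congr_form {L : Type*} [LieRing L] [LieAlgebra ℂ L] {𝕜 : Type*}
    [NontriviallyNormedField 𝕜] [NormedAlgebra 𝕜 ℂ]
    {E : Type*} [NormedAddCommGroup E] [NormedSpace 𝕜 E] {A A' : E → E → L} {F : E → CompletedU L}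
    {D : Set E} (h : IsFlatOn 𝕜 A F D) (hA : ∀ p ∈ D, ∀ v, A p v = A' p v) : IsFlatOn 𝕜 A' F D := by
  intro p hp N c
  obtain ⟨F', hF', hF'h⟩ := h p hp N c
  exact ⟨F', hF', fun v => by rw [hF'h, hA p hp]⟩

variable {n : ℕ} {L : Type*} [LieRing L] [LieAlgebra ℂ L]

theorem conn1_mul (z : Fin n → ℂ) (T : Fin n → L) (x c h : ℂ) :
    conn1 z T x (c * h) = c • conn1 z T x h := by
  simp only [conn1, Finset.smul_sum, smul_smul]
  refine Finset.sum_congr rfl fun k _ => ?_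
  congr 1
  ring

theorem conn1_eq_sum (z : Fin n → ℂ) (T : Fin n → L) (x h : ℂ) :
    conn1 z T x h = ∑ k, ((2 * Real.pi * I : ℂ)⁻¹ * (h / (x - z k))) • T k := by
  simp only [conn1, Finset.smul_sum, smul_smul]

theorem slitDisc_mono {c v : ℂ} {ε ε' : ℝ} (h : ε' ≤ ε) : slitDisc c v ε' ⊆ slitDisc c v ε :=
  fun _ hx => ⟨Metric.ball_subset_ball h hx.1, hx.2⟩

theorem IsLocalSolution.mono {z : Fin n → ℂ} {T : Fin n → L} {ε ε' : ℝ} {Ψ : ℂ → CompletedU L}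
    {P : BasePoint n} (h : IsLocalSolution z T ε Ψ P) (hε : ε' ≤ ε) :
    IsLocalSolution z T ε' Ψ P := by
  cases P with
  | regular p => exact ⟨h.1.mono (Metric.ball_subset_ball hε), h.2⟩
  | tangential i v =>
    obtain ⟨h1, f, hf, hf0, hΨ⟩ := h
    exact ⟨h1.mono (slitDisc_mono hε), f,
      fun N c => (hf N c).mono (Metric.ball_subset_ball (by gcongr)), hf0,
      fun x hx => hΨ x (slitDisc_mono hε hx)⟩

theorem exists_pos_le_dist {ι : Type*} [Finite ι] {P : ι → Prop} {d : ι → ℝ}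
    (hd : ∀ k, P k → 0 < d k) : ∃ ε > 0, ∀ k, P k → ε ≤ d k := by
  have h : ∀ᶠ ε in 𝓝[>] (0 : ℝ), ∀ k, P k → ε ≤ d k := by
    rw [eventually_all]
    intro k
    by_cases hk : P k
    · filter_upwards [Ioo_mem_nhdsGT (hd k hk)] with ε hε _ using hε.2.le
    · exact Eventually.of_forall fun _ h => absurd h hk
  obtain ⟨ε, h1, h2⟩ := (h.and self_mem_nhdsWithin).exists
  exact ⟨ε, h2, h1⟩

variable [FiniteTrunc L]

theorem star_ball {ρ : ℝ} : ∀ p ∈ Metric.ball (0 : ℂ) ρ, ∀ r ∈ Icc (0 : ℝ) 1,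
    r • p ∈ Metric.ball (0 : ℂ) ρ := by
  intro p hp r hr
  rw [mem_ball_zero_iff] at hp ⊢
  rw [norm_smul, Real.norm_of_nonneg hr.1]
  exact lt_of_le_of_lt (mul_le_of_le_one_left (norm_nonneg _) hr.2) hp

/-- In the coordinate `y = (x - z_i) / v` the connection is logarithmic at `y = 0` with residue
`T_i / 2πi`, so that the regular factor `f` exists; multiplication with the exponential removes the
term `f S` from its equation. -/
theorem exists_local_solution_tangential {z : Fin n → ℂ} (hz : Function.Injective z)
    (T : Fin n → L) (i : Fin n) {v : ℂ} (hv : v ≠ 0) :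
    ∃ ε > 0, ∃ Ψ, IsLocalSolution z T ε Ψ (BasePoint.tangential i v) := by
  classical
  obtain ⟨ε, hε, hεk⟩ := exists_pos_le_dist (P := fun k => k ≠ i) (d := fun k => ‖z k - z i‖)
    (fun k hk => norm_pos_iff.2 (sub_ne_zero.2 fun h => hk (hz h)))
  have hv' : 0 < ‖v‖ := norm_pos_iff.2 hv
  have hne : ∀ y ∈ Metric.ball (0 : ℂ) (ε / ‖v‖), ∀ k, k ≠ i → z i + y * v - z k ≠ 0 := by
    intro y hy k hk h
    rw [mem_ball_zero_iff, lt_div_iff₀ hv', ← norm_mul] at hy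
    have h1 : y * v = z k - z i := by linear_combination h
    rw [h1] at hy
    exact absurd hy (not_lt.2 (hεk k hk))
  obtain ⟨f, hf0, -, hfs, hfx⟩ := exists_completed_solution_one (𝕜 := ℂ) T
    (φ := fun k y => if k = i then (2 * Real.pi * I : ℂ)⁻¹ else
      (2 * Real.pi * I : ℂ)⁻¹ * (y * v / (z i + y * v - z k)))
    (D := Metric.ball 0 (ε / ‖v‖)) (S := (2 * Real.pi * I : ℂ)⁻¹ • T i) Metric.isOpen_ball
    (by simp; positivity) star_ball
    (fun k => by
      by_cases hk : k = i
      · simp only [hk, if_true]; exact contDiffOn_const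
      · simp only [hk, if_false]
        refine contDiffOn_const.mul (ContDiffOn.div (by fun_prop) (by fun_prop) ?_)
        exact fun y hy => hne y hy k hk)
    (by simp [ite_smul])
  refine ⟨ε, hε, fun x => f ((x - z i) / v) *
    expLie ((log ((x - z i) / v) / (2 * Real.pi * I)) • T i), ?_, f,
    isHolomorphicOn_of_contDiffOn hfs, hf0, fun x _ => rfl⟩
  refine isFlatOn_of_hasDerivAt (a := fun x => conn1 z T x 1)
    (fun x _ h => by simpa using conn1_mul z T x h 1) fun x hx N => ?_
  set y := (x - z i) / v with hy
  have hyD : y ∈ Metric.ball (0 : ℂ) (ε / ‖v‖) := by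
    rw [mem_ball_zero_iff, hy, norm_div]
    have := hx.1
    rw [mem_ball_iff_norm] at this
    gcongr
  have hy0 : y ≠ 0 := slitPlane_ne_zero hx.2
  have hyv : y * v = x - z i := by rw [hy]; field_simp
  have hyd : HasDerivAt (fun x => (x - z i) / v) v⁻¹ x := by
    simpa using ((hasDerivAt_id x).sub_const (z i)).div_const v
  have hfd : HasDerivAt (fun p => (f p).1 N) (deriv (fun p => (f p).1 N) y) y :=
    (((hfs N).differentiableOn (by simp)).differentiableAt
      (Metric.isOpen_ball.mem_nhds hyD)).hasDerivAt
  have h1 : HasDerivAt (fun x => (f ((x - z i) / v)).1 N) (v⁻¹ • deriv (fun p => (f p).1 N) y) x :=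
    HasDerivAt.scomp (g₁ := fun p => (f p).1 N) (h := fun x => (x - z i) / v) x hfd hyd
  have hlog : HasDerivAt (fun x => log ((x - z i) / v) / (2 * Real.pi * I))
      (y⁻¹ * v⁻¹ / (2 * Real.pi * I)) x := by
    have := ((hasDerivAt_log hx.2).comp x hyd).div_const (2 * Real.pi * I)
    exact this
  have h2 := (hasDerivAt_expLie N (T i) (log y / (2 * Real.pi * I))).scomp x hlog
  have h3 := h1.mul h2
  have hf' : deriv (fun p => (f p).1 N) y = y⁻¹ • (y • deriv (fun p => (f p).1 N) y) := by
    rw [smul_smul, inv_mul_cancel₀ hy0, one_smul]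
  have hconn : conn1 z T x 1 = (y⁻¹ * v⁻¹) • ∑ k, (if k = i then (2 * Real.pi * I : ℂ)⁻¹ else
      (2 * Real.pi * I : ℂ)⁻¹ * (y * v / (z i + y * v - z k))) • T k := by
    rw [conn1_eq_sum, Finset.smul_sum]
    refine Finset.sum_congr rfl fun k _ => ?_
    rw [smul_smul]
    congr 1
    by_cases hk : k = i
    · rw [if_pos hk, hk, ← hyv]
      field_simp
    · rw [if_neg hk]
      have h4 : x - z k = z i + y * v - z k := by rw [hyv]; ring
      rw [h4]
      have := hne y hyD k hk
      field_simp
  refine h3.congr_deriv ?_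
  rw [hf', hfx N y hyD, hconn]
  have hcomm : (expLie ((log y / (2 * Real.pi * I)) • T i)).1 N * toTrunc L N (T i) =
      toTrunc L N (T i) * (expLie ((log y / (2 * Real.pi * I)) • T i)).1 N := by
    refine expLie_commute ?_
    rw [map_smul]
    exact (Commute.refl _).smul_left _
  simp only [Function.comp_apply, mul_val, ← hy, hcomm, map_smul]
  -- the remaining identity is purely algebraic
  generalize toTrunc L N (∑ k, (if k = i then (2 * Real.pi * I : ℂ)⁻¹ else
      (2 * Real.pi * I : ℂ)⁻¹ * (y * v / (z i + y * v - z k))) • T k) = P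
  generalize (2 * Real.pi * I : ℂ) = κ
  have hs : y⁻¹ * v⁻¹ / κ = v⁻¹ * (y⁻¹ * κ⁻¹) := by rw [div_eq_mul_inv]; ring
  rw [hs]
  simp only [smul_mul_assoc, mul_smul_comm, smul_smul, sub_mul, smul_sub, mul_assoc,
    mul_comm v⁻¹ y⁻¹]
  abel

theorem exists_local_solution_regular {z : Fin n → ℂ} (T : Fin n → L) {p : ℂ} (hp : ∀ k, p ≠ z k) :
    ∃ ε > 0, ∃ Ψ, IsLocalSolution z T ε Ψ (BasePoint.regular p) := by
  obtain ⟨ε, hε, hεk⟩ := exists_pos_le_dist (P := fun _ => True) (d := fun k => ‖z k - p‖)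
    (fun k _ => norm_pos_iff.2 (sub_ne_zero.2 (hp k).symm))
  have hne : ∀ y ∈ Metric.ball (0 : ℂ) ε, ∀ k, p + y - z k ≠ 0 := by
    intro y hy k h
    rw [mem_ball_zero_iff] at hy
    have h1 : y = z k - p := by linear_combination h
    rw [h1] at hy
    exact absurd hy (not_lt.2 (hεk k trivial))
  obtain ⟨f, hf0, -, hfx⟩ := exists_regular_solution (𝕜 := ℂ) T
    (φ := fun k y => (2 * Real.pi * I : ℂ)⁻¹ * (1 / (p + y - z k)))
    (D := Metric.ball 0 ε) Metric.isOpen_ball (by simpa) star_ball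
    (fun k => contDiffOn_const.mul (ContDiffOn.div (by fun_prop) (by fun_prop)
      fun y hy => hne y hy k))
  refine ⟨ε, hε, fun x => f (x - p), ?_, by simp [hf0]⟩
  refine isFlatOn_of_hasDerivAt (a := fun x => conn1 z T x 1)
    (fun x _ h => by simpa using conn1_mul z T x h 1) fun x hx N => ?_
  have hxD : x - p ∈ Metric.ball (0 : ℂ) ε := by
    rw [mem_ball_zero_iff]
    exact mem_ball_iff_norm.1 hx
  have h := (hfx N (x - p) hxD).comp_sub_const x p
  rw [conn1_eq_sum]
  simpa using h

/-- The parallel transport along a smooth path, normalized at the parameter `t₀`. -/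
theorem exists_path_solution {z : Fin n → ℂ} (T : Fin n → L) {δ : ℝ → ℂ} {c t₀ : ℝ}
    (hδ : ContDiffOn ℝ (⊤ : ℕ∞) δ (Ioo 0 c)) (hav : ∀ t ∈ Ioo 0 c, ∀ k, δ t ≠ z k)
    (ht₀ : t₀ ∈ Ioo 0 c) :
    ∃ U : ℝ → CompletedU L, U t₀ = 1 ∧ (∀ t, IsUnit (U t)) ∧
      IsFlatOn ℝ (fun t h => conn1 z T (δ t) (h * deriv δ t)) U (Ioo 0 c) := by
  have hmap : MapsTo (fun x : ℝ => t₀ + x) {x | t₀ + x ∈ Ioo 0 c} (Ioo 0 c) := fun x hx => hx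
  have hsh : ContDiff ℝ (⊤ : ℕ∞) (fun x : ℝ => t₀ + x) := by fun_prop
  have hδ' : ContDiffOn ℝ (⊤ : ℕ∞) (deriv δ) (Ioo 0 c) :=
    hδ.deriv_of_isOpen isOpen_Ioo (by simp)
  obtain ⟨f, hf0, hfu, hfx⟩ := exists_regular_solution (𝕜 := ℝ) T
    (φ := fun k x => (2 * Real.pi * I : ℂ)⁻¹ * (deriv δ (t₀ + x) / (δ (t₀ + x) - z k)))
    (D := {x | t₀ + x ∈ Ioo 0 c}) (isOpen_Ioo.preimage (by fun_prop)) (by simpa using ht₀)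
    (fun x hx r hr => by
      have := (convex_Ioo (0 : ℝ) c) ht₀ hx (sub_nonneg.2 hr.2) hr.1 (by ring)
      simp only [smul_eq_mul] at this
      simp only [mem_ofPred_eq, smul_eq_mul]
      convert this using 1
      ring)
    (fun k => by
      simp only [div_eq_mul_inv]
      exact contDiffOn_const.mul ((hδ'.comp hsh.contDiffOn hmap).mul
        (((hδ.comp hsh.contDiffOn hmap).sub contDiffOn_const).inv
          fun x hx => sub_ne_zero.2 (hav _ hx k))))
  refine ⟨fun t => f (t - t₀), by simp [hf0], fun t => hfu _, ?_⟩
  refine isFlatOn_of_hasDerivAt (a := fun t => conn1 z T (δ t) (deriv δ t))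
    (fun t _ h => conn1_mul z T (δ t) h (deriv δ t)) fun t ht N => ?_
  have h := (hfx N (t - t₀) (by simpa using ht)).comp_sub_const t t₀
  rw [conn1_eq_sum]
  simpa using h

/-- The path `δ` on `(0, c')` avoids the marked points, starts linearly at the tangential base point
`(z_i, v)`, and passes smoothly through `c`. -/
structure IsTangentialPath (z : Fin n → ℂ) (i : Fin n) (v : ℂ) (δ : ℝ → ℂ) (c c' : ℝ) : Prop where
  ne : v ≠ 0
  pos : 0 < c
  lt : c < c'
  smooth : ContDiffOn ℝ (⊤ : ℕ∞) δ (Ioo 0 c')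
  avoids : ∀ t ∈ Ioo 0 c', ∀ k, δ t ≠ z k
  start : ∀ᶠ t in 𝓝[>] (0 : ℝ), δ t = z i + v * t

namespace IsTangentialPath

variable {z : Fin n → ℂ} {T : Fin n → L} {i : Fin n} {v : ℂ} {δ : ℝ → ℂ} {c c' : ℝ}

theorem hasDerivAt (hδ : IsTangentialPath z i v δ c c') {t : ℝ} (ht : t ∈ Ioo 0 c') :
    HasDerivAt δ (deriv δ t) t :=
  ((hδ.smooth.differentiableOn (by simp)).differentiableAt (isOpen_Ioo.mem_nhds ht)).hasDerivAt

/-- A solution near a point of the path gives a flat section along the path. -/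
theorem flat_comp (hδ : IsTangentialPath z i v δ c c') {D : Set ℂ} {Ψ : ℂ → CompletedU L}
    (hΨ : IsFlatOn ℂ (conn1 z T) Ψ D) {S : Set ℝ} (hS : S ⊆ Ioo 0 c') (hSD : ∀ t ∈ S, δ t ∈ D) :
    IsFlatOn ℝ (fun t h => conn1 z T (δ t) (h * deriv δ t)) (fun t => Ψ (δ t)) S :=
  (hΨ.pullback (fun t ht => (hδ.hasDerivAt (hS ht)).hasFDerivAt) hSD).congr_form
    fun t _ h => by simp

theorem eventually_slit (hδ : IsTangentialPath z i v δ c c') {ε : ℝ} (hε : 0 < ε) :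
    ∀ᶠ t in 𝓝[>] (0 : ℝ), δ t ∈ slitDisc (z i) v ε ∧ (δ t - z i) / v = t := by
  have hv : 0 < ‖v‖ := norm_pos_iff.2 hδ.ne
  filter_upwards [hδ.start, Ioo_mem_nhdsGT (div_pos hε hv)] with t ht htε
  have h1 : (δ t - z i) / v = t := by
    rw [ht, add_sub_cancel_left, mul_div_cancel_left₀ _ hδ.ne]
  refine ⟨⟨?_, ?_⟩, h1⟩
  · rw [mem_ball_iff_norm, ht, add_sub_cancel_left, norm_mul, Complex.norm_of_nonneg htε.1.le,
      mul_comm]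
    exact (lt_div_iff₀ hv).1 htε.2
  · rw [h1]
    exact ofReal_mem_slitPlane.2 htε.1

end IsTangentialPath

/-- The inverse `exp (-log t · T / 2πi)` of the singular factor at a tangential base point. -/
def tangFactor (T : L) (t : ℝ) : CompletedU L :=
  expLie (-((log (t : ℂ) / (2 * Real.pi * I)) • T))

theorem hasDerivAt_tangFactor (T : L) (N : ℕ) {t : ℝ} (ht : 0 < t) :
    HasDerivAt (fun t => (tangFactor T t).1 N)
      ((-(t : ℂ)⁻¹ / (2 * Real.pi * I)) • ((tangFactor T t).1 N * toTrunc L N T)) t := by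
  have h1 : HasDerivAt (fun t : ℝ => -(log (t : ℂ) / (2 * Real.pi * I)))
      (-(t : ℂ)⁻¹ / (2 * Real.pi * I)) t := by
    have h2 := ((hasDerivAt_log (ofReal_mem_slitPlane.2 ht)).comp_ofReal.div_const
      (2 * Real.pi * I : ℂ)).fun_neg
    simpa [neg_div] using h2
  simp only [tangFactor, ← neg_smul]
  exact (hasDerivAt_expLie N T _).scomp t h1

theorem tangFactor_deriv_mem (T : L) (N : ℕ) (s : ℂ) (t : ℝ) :
    s • ((tangFactor T t).1 N * toTrunc L N T) ∈ augFiltration L N 1 :=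
  Submodule.smul_mem _ _ ((isNilFiltration_aug L N).mul_left 0 _ (toTrunc_mem N T) _
    (by rw [(isNilFiltration_aug L N).zero]; trivial) |> fun h => by
      have hc : (tangFactor T t).1 N * toTrunc L N T = toTrunc L N T * (tangFactor T t).1 N := by
        refine expLie_commute ?_
        rw [← neg_smul, map_smul]
        exact (Commute.refl _).smul_left _
      rw [hc]
      exact h)

theorem tangFactor_mul (T : L) (t : ℝ) :
    tangFactor T t * expLie ((log (t : ℂ) / (2 * Real.pi * I)) • T) = 1 := by
  have := expLie_mul_neg (-((log (t : ℂ) / (2 * Real.pi * I)) • T))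
  rwa [neg_neg] at this

theorem mul_tangFactor (T : L) (t : ℝ) :
    expLie ((log (t : ℂ) / (2 * Real.pi * I)) • T) * tangFactor T t = 1 :=
  expLie_mul_neg _

/-- Linear uniqueness at a tangential base point. -/
theorem tangential_eq_zero {N : ℕ} {c : ℝ} (hc : 0 < c) {F : ℝ → Trunc L N} {a : ℝ → L}
    (hF : ∀ t ∈ Ioo 0 c, HasDerivAt F (toTrunc L N (a t) * F t) t) {T : L}
    (h0 : Tendsto (fun t => F t * (tangFactor T t).1 N) (𝓝[>] 0) (𝓝 0)) :
    ∀ t ∈ Ioo 0 c, F t = 0 :=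
  curve_eq_zero hF (X := fun t => (tangFactor T t).1 N)
    (Y := fun t => (expLie ((log (t : ℂ) / (2 * Real.pi * I)) • T)).1 N)
    (fun t ht => hasDerivAt_tangFactor T N ht.1) (fun t _ => tangFactor_deriv_mem T N _ t)
    (fun t _ => by rw [← mul_val, tangFactor_mul, one_val])
    (le_principal_iff.2 (Ioo_mem_nhdsGT hc)) h0

section RegHol

variable {z : Fin n → ℂ} {T : Fin n → L} {i : Fin n} {v : ℂ} {δ : ℝ → ℂ} {c c' : ℝ}

theorem tendsto_tangential (hδ : IsTangentialPath z i v δ c c') {ε : ℝ} (hε : 0 < ε)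
    {Ψ : ℂ → CompletedU L} (hΨ : IsLocalSolution z T ε Ψ (BasePoint.tangential i v))
    {F : ℝ → CompletedU L} (hF : ∀ᶠ t in 𝓝[>] (0 : ℝ), F t = Ψ (δ t)) (N : ℕ) :
    Tendsto (fun t => (F t * tangFactor (T i) t).1 N) (𝓝[>] 0) (𝓝 1) := by
  obtain ⟨-, f, hf, hf0, hfΨ⟩ := hΨ
  have hv : 0 < ‖v‖ := norm_pos_iff.2 hδ.ne
  have h1 : ContinuousAt (fun q => (f q).1 N) 0 :=
    hf.continuousAt (Metric.ball_mem_nhds _ (div_pos hε hv)) N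
  have h2 : Tendsto (fun t : ℝ => (f (t : ℂ)).1 N) (𝓝[>] 0) (𝓝 1) := by
    have h3 : Tendsto (fun t : ℝ => (t : ℂ)) (𝓝[>] 0) (𝓝 0) := by
      have : ContinuousAt (fun t : ℝ => (t : ℂ)) 0 := by fun_prop
      simpa using this.tendsto.mono_left nhdsWithin_le_nhds
    have h4 := h1.tendsto.comp h3
    rw [hf0] at h4
    exact h4
  refine h2.congr' ?_
  filter_upwards [hF, hδ.eventually_slit hε] with t ht1 ht2
  rw [ht1, hfΨ _ ht2.1, ht2.2, mul_assoc, mul_tangFactor, mul_one]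

theorem tendsto_regular (hδ : IsTangentialPath z i v δ c c') {ε : ℝ} (hε : 0 < ε)
    {Ψ : ℂ → CompletedU L} (hΨ : IsLocalSolution z T ε Ψ (BasePoint.regular (δ c)))
    {F : ℝ → CompletedU L} (hF : ∀ᶠ t in 𝓝[<] c, F t = Ψ (δ t)) (N : ℕ) :
    Tendsto (fun t => (F t).1 N) (𝓝[<] c) (𝓝 1) := by
  have h1 : ContinuousAt (fun q => (Ψ q).1 N) (δ c) :=
    hΨ.1.continuousAt (Metric.mem_ball_self hε) N
  have h2 : ContinuousAt δ c := (hδ.hasDerivAt ⟨hδ.pos, hδ.lt⟩).continuousAt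
  have h3 : Tendsto (fun t => (Ψ (δ t)).1 N) (𝓝[<] c) (𝓝 1) := by
    have := (h1.tendsto.comp h2.tendsto).mono_left (nhdsWithin_le_nhds (s := Iio c))
    rw [hΨ.2] at this
    exact this
  refine h3.congr' ?_
  filter_upwards [hF] with t ht
  rw [ht]

theorem IsFlatOn.hasDerivAt_path {N : ℕ} {F : ℝ → CompletedU L} {S : Set ℝ}
    (hF : IsFlatOn ℝ (fun t h => conn1 z T (δ t) (h * deriv δ t)) F S) {t : ℝ} (ht : t ∈ S) :
    HasDerivAt (fun t => (F t).1 N) (toTrunc L N (conn1 z T (δ t) (deriv δ t)) * (F t).1 N) t := by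
  have := hF.hasDerivAt_curve (q := fun t => t) (hasDerivAt_id' t) ht N
  simpa using this

/-- Both regularized holonomies are the limit at `c` of the flat section normalized at the tangential
base point, which is unique. -/
theorem regHol_unique (hδ : IsTangentialPath z i v δ c c') {H H' : CompletedU L}
    (hH : IsRegHol z T δ c (BasePoint.tangential i v) (BasePoint.regular (δ c)) H)
    (hH' : IsRegHol z T δ c (BasePoint.tangential i v) (BasePoint.regular (δ c)) H') : H = H' := by
  obtain ⟨ε, hε, ΨP, ΨQ, FP, FQ, hΨP, hΨQ, hFP, hFQ, hP, hQ, hPQ⟩ := hH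
  obtain ⟨ε', hε', ΨP', ΨQ', FP', FQ', hΨP', hΨQ', hFP', hFQ', hP', hQ', hPQ'⟩ := hH'
  refine completedU_ext fun N => ?_
  have h1 : ∀ t ∈ Ioo 0 c, (FP t).1 N - (FP' t).1 N = 0 :=
    tangential_eq_zero (T := T i) hδ.pos (a := fun t => conn1 z T (δ t) (deriv δ t))
      (fun t ht => by
        rw [mul_sub]
        exact (hFP.hasDerivAt_path ht).sub (hFP'.hasDerivAt_path ht)) (by
        have := (tendsto_tangential hδ hε hΨP hP N).sub (tendsto_tangential hδ hε' hΨP' hP' N)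
        rw [sub_self] at this
        simpa only [mul_val, sub_mul] using this)
  have hH : Tendsto (fun t => (FP t).1 N) (𝓝[<] c) (𝓝 (H.1 N)) := by
    have := (tendsto_regular hδ hε hΨQ hQ N).mul_const (H.1 N)
    rw [one_mul] at this
    refine this.congr' ?_
    filter_upwards [Ioo_mem_nhdsLT hδ.pos] with t ht
    rw [hPQ t ht, mul_val]
  have hH' : Tendsto (fun t => (FP' t).1 N) (𝓝[<] c) (𝓝 (H'.1 N)) := by
    have := (tendsto_regular hδ hε' hΨQ' hQ' N).mul_const (H'.1 N)
    rw [one_mul] at this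
    refine this.congr' ?_
    filter_upwards [Ioo_mem_nhdsLT hδ.pos] with t ht
    rw [hPQ' t ht, mul_val]
  refine tendsto_nhds_unique hH (hH'.congr' ?_)
  filter_upwards [Ioo_mem_nhdsLT hδ.pos] with t ht
  exact (sub_eq_zero.1 (h1 t ht)).symm

/-- The flat section `FP` continues the solution at the tangential base point, `V` the one at the end
point; both exist on the whole path by parallel transport, and are compared at the parameter `t₀`. -/
theorem exists_regHol (hz : Function.Injective z) (T : Fin n → L)
    (hδ : IsTangentialPath z i v δ c c') :
    ∃ H, IsRegHol z T δ c (BasePoint.tangential i v) (BasePoint.regular (δ c)) H := by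
  have hc : c ∈ Ioo 0 c' := ⟨hδ.pos, hδ.lt⟩
  obtain ⟨ε₁, hε₁, ΨP, hΨP⟩ := exists_local_solution_tangential hz T i hδ.ne
  obtain ⟨ε₂, hε₂, ΨQ, hΨQ⟩ := exists_local_solution_regular T (hδ.avoids c hc)
  -- the interval on which the path stays in the slit disc
  obtain ⟨η, hη, hηs⟩ : ∃ η > 0, ∀ t ∈ Ioo 0 η, δ t ∈ slitDisc (z i) v ε₁ := by
    have := (hδ.eventually_slit hε₁).mono fun t ht => ht.1
    obtain ⟨η, hη, h⟩ := (mem_nhdsGT_iff_exists_Ioo_subset).1 this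
    exact ⟨η, hη, h⟩
  obtain ⟨t₀, ht₀⟩ : (Ioo 0 (min η c)).Nonempty := nonempty_Ioo.2 (lt_min hη hδ.pos)
  have ht₀η : t₀ ∈ Ioo 0 (min η c) := ht₀
  have ht₀c : t₀ ∈ Ioo 0 c := ⟨ht₀.1, ht₀.2.trans_le (min_le_right _ _)⟩
  have ht₀c' : t₀ ∈ Ioo 0 c' := ⟨ht₀.1, ht₀c.2.trans hδ.lt⟩
  have hsub : Ioo 0 c ⊆ Ioo 0 c' := Ioo_subset_Ioo_right hδ.lt.le
  obtain ⟨U, hU0, hUu, hU⟩ := exists_path_solution T hδ.smooth hδ.avoids ht₀c'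
  obtain ⟨V, hV0, hVu, hV⟩ := exists_path_solution T hδ.smooth hδ.avoids hc
  set FP : ℝ → CompletedU L := fun t => U t * ΨP (δ t₀) with hFP
  have hFPflat := hU.mul_const (ΨP (δ t₀))
  obtain ⟨u, hu⟩ := hVu t₀
  refine ⟨↑u⁻¹ * FP t₀, min ε₁ ε₂, lt_min hε₁ hε₂, ΨP, ΨQ, FP, V, hΨP.mono (min_le_left _ _),
    hΨQ.mono (min_le_right _ _), hFPflat.mono hsub, hV.mono hsub, ?_, ?_, ?_⟩
  · have key := flat_unique (isOpen_Ioo (a := (0 : ℝ)) (b := min η c)) (convex_Ioo _ _)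
      (hFPflat.mono fun t ht => hsub ⟨ht.1, ht.2.trans_le (min_le_right _ _)⟩)
      (hδ.flat_comp hΨP.1 (S := Ioo 0 (min η c))
        (fun t ht => hsub ⟨ht.1, ht.2.trans_le (min_le_right _ _)⟩)
        fun t ht => hηs t ⟨ht.1, ht.2.trans_le (min_le_left _ _)⟩) ht₀η
      (by rw [hU0, one_mul])
    filter_upwards [Ioo_mem_nhdsGT (lt_min hη hδ.pos)] with t ht using key t ht
  · have hcont : ContinuousAt δ c := (hδ.hasDerivAt hc).continuousAt
    have hmem : ∀ᶠ t in 𝓝 c, δ t ∈ Metric.ball (δ c) ε₂ ∧ t ∈ Ioo 0 c' :=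
      (hcont.eventually_mem (Metric.ball_mem_nhds _ hε₂)).and (isOpen_Ioo.mem_nhds hc)
    obtain ⟨ρ, hρ, h⟩ := Metric.eventually_nhds_iff.1 hmem
    have hball : ∀ t ∈ Metric.ball c ρ, δ t ∈ Metric.ball (δ c) ε₂ ∧ t ∈ Ioo 0 c' := fun t ht => h ht
    have key := flat_unique (Metric.isOpen_ball (x := c) (ε := ρ)) (convex_ball _ _)
      (hV.mono fun t ht => (hball t ht).2)
      (hδ.flat_comp hΨQ.1 (fun t ht => (hball t ht).2) fun t ht => (hball t ht).1)
      (Metric.mem_ball_self hρ) (by rw [hV0, hΨQ.2])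
    filter_upwards [nhdsWithin_le_nhds (Metric.ball_mem_nhds c hρ)] with t ht using key t ht
  · refine flat_unique isOpen_Ioo (convex_Ioo _ _) (hFPflat.mono hsub)
      ((hV.mul_const _).mono hsub) ht₀c ?_
    rw [← hu, Units.mul_inv_cancel_left]

end RegHol

end OneVariable

/-! ### Regularized holonomies of an admissible path -/

section AdmissiblePath

variable {n : ℕ} {z : Fin n → ℂ} {i j : Fin n} {vi vj : ℂ} {γ : ℝ → ℂ}

namespace IsAdmissiblePath

theorem smoothOn_Ioo (hγ : IsAdmissiblePath z i j vi vj γ) :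
    ContDiffOn ℝ (⊤ : ℕ∞) γ (Ioo 0 1) :=
  hγ.smooth.mono Ioo_subset_Icc_self

theorem hasDerivAt (hγ : IsAdmissiblePath z i j vi vj γ) {t : ℝ} (ht : t ∈ Ioo (0 : ℝ) 1) :
    HasDerivAt γ (deriv γ t) t :=
  ((hγ.smoothOn_Ioo.differentiableOn (by simp)).differentiableAt
    (isOpen_Ioo.mem_nhds ht)).hasDerivAt

theorem smoothOn_deriv (hγ : IsAdmissiblePath z i j vi vj γ) :
    ContDiffOn ℝ (⊤ : ℕ∞) (deriv γ) (Ioo 0 1) :=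
  hγ.smoothOn_Ioo.deriv_of_isOpen isOpen_Ioo (by simp)

theorem tangentialPath_start (hγ : IsAdmissiblePath z i j vi vj γ) {c : ℝ}
    (hc : c ∈ Ioo (0 : ℝ) 1) : IsTangentialPath z i vi γ c 1 where
  ne := hγ.vi_ne
  pos := hc.1
  lt := hc.2
  smooth := hγ.smoothOn_Ioo
  avoids := hγ.avoids
  start := by
    obtain ⟨ε, hε, h⟩ := hγ.start_linear
    filter_upwards [Ioo_mem_nhdsGT hε] with t ht using h t ⟨ht.1.le, ht.2⟩

theorem tangentialPath_end (hγ : IsAdmissiblePath z i j vi vj γ) {c : ℝ}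
    (hc : c ∈ Ioo (0 : ℝ) 1) : IsTangentialPath z j vj (fun t => γ (1 - t)) (1 - c) 1 where
  ne := hγ.vj_ne
  pos := by linarith [hc.2]
  lt := by linarith [hc.1]
  smooth := hγ.smoothOn_Ioo.comp (by fun_prop) fun t ht =>
    ⟨by linarith [ht.2], by linarith [ht.1]⟩
  avoids t ht k := hγ.avoids (1 - t) ⟨by linarith [ht.2], by linarith [ht.1]⟩ k
  start := by
    obtain ⟨ε, hε, h⟩ := hγ.end_linear
    filter_upwards [Ioo_mem_nhdsGT hε] with t ht
    rw [h (1 - t) ⟨by linarith [ht.2], by linarith [ht.1]⟩]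
    push_cast
    ring

end IsAdmissiblePath

theorem existsUnique_holStart {L : Type*} [LieRing L] [LieAlgebra ℂ L] [FiniteTrunc L]
    (hz : Function.Injective z) (hγ : IsAdmissiblePath z i j vi vj γ) (T : Fin n → L) {c : ℝ}
    (hc : c ∈ Ioo (0 : ℝ) 1) : ∃! H, IsHolStart z T i vi γ c H := by
  obtain ⟨H, hH⟩ := exists_regHol hz T (hγ.tangentialPath_start hc)
  exact ⟨H, hH, fun H' hH' => regHol_unique (hγ.tangentialPath_start hc) hH' hH⟩

theorem existsUnique_holEnd {L : Type*} [LieRing L] [LieAlgebra ℂ L] [FiniteTrunc L]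
    (hz : Function.Injective z) (hγ : IsAdmissiblePath z i j vi vj γ) (T : Fin n → L) {c : ℝ}
    (hc : c ∈ Ioo (0 : ℝ) 1) : ∃! H, IsHolEnd z T j vj γ c H := by
  have key : ∀ H, IsHolEnd z T j vj γ c H ↔ IsRegHol z T (fun t => γ (1 - t)) (1 - c)
      (BasePoint.tangential j vj) (BasePoint.regular ((fun t => γ (1 - t)) (1 - c))) H := by
    intro H
    rw [IsHolEnd, show (fun t => γ (1 - t)) (1 - c) = γ c by simp]
  simp only [key]
  obtain ⟨H, hH⟩ := exists_regHol hz T (hγ.tangentialPath_end hc)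
  exact ⟨H, hH, fun H' hH' => regHol_unique (hγ.tangentialPath_end hc) hH' hH⟩

end AdmissiblePath

/-! ### The Drinfeld–Kohno relations -/

section Relations

variable {ι : Type*}

theorem gen_symm (a b : ι) : gen a b = gen b a :=
  sub_eq_zero.1 ((LieSubmodule.Quotient.mk_eq_zero _).2
    (LieSubmodule.subset_lieSpan (DKRel.symm a b)))

theorem gen_lie_gen {a b c d : ι} (hab : a ≠ b) (hac : a ≠ c) (had : a ≠ d) (hbc : b ≠ c)
    (hbd : b ≠ d) (hcd : c ≠ d) : ⁅gen a b, gen c d⁆ = 0 :=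
  (LieSubmodule.Quotient.mk_eq_zero _).2
    (LieSubmodule.subset_lieSpan (DKRel.comm a b c d hab hac had hbc hbd hcd))

theorem gen_add_lie_gen {a b c : ι} (hab : a ≠ b) (hac : a ≠ c) (hbc : b ≠ c) :
    ⁅gen a b + gen a c, gen b c⁆ = 0 :=
  (LieSubmodule.Quotient.mk_eq_zero _).2
    (LieSubmodule.subset_lieSpan (DKRel.triple a b c hab hac hbc))

variable {n : ℕ}

theorem tz_lie_tw {k l : Fin n} (h : k ≠ l) : ⁅tz k, tw l⁆ = 0 :=
  gen_lie_gen (by simp) (by simpa using h) (by simp) (by simp) (by simp) (by simp)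

theorem tz_lie_tzw (k : Fin n) : ⁅tz k, tzw⁆ = -⁅tz k, tw k⁆ := by
  have h : ⁅gen Strand.w (Strand.pt k) + gen Strand.w Strand.z, gen (Strand.pt k) Strand.z⁆ = 0 :=
    gen_add_lie_gen (by simp) (by simp) (by simp)
  rw [gen_symm Strand.w, gen_symm Strand.w, add_lie] at h
  change ⁅tw k, tz k⁆ + ⁅tzw, tz k⁆ = 0 at h
  rw [← lie_skew, ← lie_skew tzw, neg_add_eq_zero] at h
  rw [h, neg_neg]

theorem tw_lie_tzw (k : Fin n) : ⁅tw k, tzw⁆ = ⁅tz k, tw k⁆ := by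
  have h : ⁅gen (Strand.pt k) Strand.z + gen (Strand.pt k) Strand.w, gen Strand.z Strand.w⁆ = 0 :=
    gen_add_lie_gen (by simp) (by simp) (by simp)
  rw [add_lie] at h
  change ⁅tz k, tzw⁆ + ⁅tw k, tzw⁆ = 0 at h
  rw [tz_lie_tzw, neg_add_eq_zero] at h
  exact h.symm

theorem tz_sum_lie_tw_sum (α β : Fin n → ℂ) :
    ⁅∑ k, α k • tz k, ∑ k, β k • tw k⁆ = ∑ k, (α k * β k) • ⁅tz k, tw k⁆ := by
  rw [sum_lie]
  refine Finset.sum_congr rfl fun k _ => ?_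
  rw [lie_sum, Finset.sum_eq_single k]
  · rw [smul_lie, lie_smul, smul_smul]
  · intro l _ hl
    rw [smul_lie, lie_smul, tz_lie_tw hl.symm, smul_zero, smul_zero]
  · simp

theorem tz_sum_lie_tzw (α : Fin n → ℂ) (b : ℂ) :
    ⁅∑ k, α k • tz k, b • tzw⁆ = -∑ k, (α k * b) • ⁅tz k, tw k⁆ := by
  rw [sum_lie, ← Finset.sum_neg_distrib]
  refine Finset.sum_congr rfl fun k _ => ?_
  rw [smul_lie, lie_smul, tz_lie_tzw, smul_smul, smul_neg]

theorem tw_sum_lie_tzw (β : Fin n → ℂ) (b : ℂ) :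
    ⁅∑ k, β k • tw k, b • tzw⁆ = ∑ k, (β k * b) • ⁅tz k, tw k⁆ := by
  rw [sum_lie]
  refine Finset.sum_congr rfl fun k _ => ?_
  rw [smul_lie, lie_smul, tw_lie_tzw, smul_smul]

/-- The bracket of the two components of the connection: each of the three relations on the strands
`k`, `z`, `w` contributes a multiple of `⁅t_{kz}, t_{kw}⁆`. -/
theorem kz_lie_kz (α β : Fin n → ℂ) (a b : ℂ) :
    ⁅(∑ k, α k • tz k) + a • tzw, (∑ k, β k • tw k) + b • tzw⁆ =
      ∑ k, (α k * β k - α k * b - a * β k) • ⁅tz k, tw k⁆ := by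
  rw [add_lie, lie_add, lie_add, tz_sum_lie_tw_sum, tz_sum_lie_tzw, ← lie_skew (a • tzw),
    tw_sum_lie_tzw, smul_lie, lie_smul, lie_self, smul_zero, smul_zero, add_zero,
    ← Finset.sum_neg_distrib, ← Finset.sum_neg_distrib, ← Finset.sum_add_distrib,
    ← Finset.sum_add_distrib]
  refine Finset.sum_congr rfl fun k _ => ?_
  rw [← neg_smul, ← neg_smul, ← add_smul, ← add_smul]
  congr 1
  ring

/-- The generators occurring in the connection. -/
def kzGen : (Fin n ⊕ Fin n) ⊕ Unit → TLie n :=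
  Sum.elim (Sum.elim tz tw) fun _ => tzw

theorem sum_kzGen (φ : (Fin n ⊕ Fin n) ⊕ Unit → ℂ) :
    ∑ k, φ k • kzGen k = (∑ k, φ (.inl (.inl k)) • tz k) + (∑ k, φ (.inl (.inr k)) • tw k) +
      φ (.inr ()) • tzw := by
  simp [Fintype.sum_sum_type, kzGen]

end Relations

/-! ### Partial derivatives -/

section Partial

set_option linter.unusedSectionVars false

variable {𝕜 : Type*} [RCLike 𝕜]

theorem fderiv_apply_fst {W : Type*} [NormedAddCommGroup W] [NormedSpace 𝕜 W] {g : 𝕜 × 𝕜 → W}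
    {p : 𝕜 × 𝕜} {d : W} (hg : DifferentiableAt 𝕜 g p)
    (hd : HasDerivAt (fun x => g (x, p.2)) d p.1) : fderiv 𝕜 g p (1, 0) = d :=
  (HasFDerivAt.comp_hasDerivAt (f := fun x : 𝕜 => (x, p.2)) p.1 hg.hasFDerivAt
    ((hasDerivAt_id' p.1).prodMk (hasDerivAt_const p.1 p.2))).unique hd

theorem fderiv_apply_snd {W : Type*} [NormedAddCommGroup W] [NormedSpace 𝕜 W] {g : 𝕜 × 𝕜 → W}
    {p : 𝕜 × 𝕜} {d : W} (hg : DifferentiableAt 𝕜 g p)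
    (hd : HasDerivAt (fun y => g (p.1, y)) d p.2) : fderiv 𝕜 g p (0, 1) = d :=
  (HasFDerivAt.comp_hasDerivAt (f := fun y : 𝕜 => (p.1, y)) p.2 hg.hasFDerivAt
    ((hasDerivAt_const p.2 p.1).prodMk (hasDerivAt_id' p.2))).unique hd

variable [NormedAlgebra 𝕜 ℂ] [IsScalarTower ℝ 𝕜 ℂ]
  {L : Type*} [LieRing L] [LieAlgebra ℂ L] [FiniteTrunc L]
  [∀ N, NormedAlgebra 𝕜 (Trunc L N)] [∀ N, IsScalarTower ℝ 𝕜 (Trunc L N)]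
  [∀ N, IsScalarTower 𝕜 ℂ (Trunc L N)]

/-- A continuous function which vanishes off a hyperplane vanishes. -/
theorem eq_zero_of_linear_smul_eq_zero {E W : Type*} [NormedAddCommGroup E] [NormedSpace 𝕜 E]
    [NormedAddCommGroup W] [NormedSpace 𝕜 W] {D : Set E} (hD : IsOpen D) {g : E → W}
    (hg : ContinuousOn g D) (m : E →L[𝕜] 𝕜) {v : E} (hv : m v = 1)
    (h0 : ∀ p ∈ D, m p • g p = 0) : ∀ p ∈ D, g p = 0 := by
  intro p hp
  have hc : Continuous fun x : 𝕜 => p + (x - m p) • v := by fun_prop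
  have key := eq_zero_of_smul_eq_zero (𝕜 := 𝕜) (hD.preimage hc)
    (g := fun x => g (p + (x - m p) • v)) (hg.comp hc.continuousOn fun x hx => hx) (by
      intro x hx
      have h1 := h0 _ hx
      rw [map_add, map_smul, hv] at h1
      simpa using h1) (m p) (by simpa using hp)
  simpa using key

/-- At a coordinate hyperplane where the connection has no residue, the factor vanishing on it can
be divided out of the differential equation. -/
theorem fderiv_eq_of_smul_eq {K E : Type*} [Fintype K] [NormedAddCommGroup E] [NormedSpace 𝕜 E]
    {T : K → L} {φ : K → E → ℂ} {D : Set E} (hD : IsOpen D)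
    (hφ : ∀ k, ContinuousOn (φ k) D) {f : E → CompletedU L} {N : ℕ}
    (hf : ContDiffOn 𝕜 (⊤ : ℕ∞) (fun p => (f p).1 N) D) (m : E →L[𝕜] 𝕜) {v : E} (hv : m v = 1)
    (h : ∀ p ∈ D, m p • fderiv 𝕜 (fun p => (f p).1 N) p v =
      toTrunc L N (∑ k, (m p • φ k p) • T k) * (f p).1 N - (f p).1 N * toTrunc L N 0) :
    ∀ p ∈ D, fderiv 𝕜 (fun p => (f p).1 N) p v =
      toTrunc L N (∑ k, φ k p • T k) * (f p).1 N := by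
  have hc : ContinuousOn (fun p => fderiv 𝕜 (fun p => (f p).1 N) p v) D :=
    (hf.continuousOn_fderiv_of_isOpen hD (by simp)).clm_apply continuousOn_const
  have hA : ContinuousOn (fun x => toTrunc L N (∑ k, φ k x • T k)) D := by
    simp only [map_sum, map_smul]
    exact continuousOn_finsetSum _ fun k _ => (hφ k).fun_smul continuousOn_const
  have key := eq_zero_of_linear_smul_eq_zero hD (hc.sub (hA.mul hf.continuousOn)) m hv
    fun x hx => by
      simp only [Pi.sub_apply, Pi.mul_apply, smul_sub, h x hx, map_zero, mul_zero, sub_zero]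
      simp only [map_sum, map_smul, Finset.sum_mul, Finset.smul_sum, smul_mul_assoc, smul_assoc,
        sub_self]
  exact fun p hp => sub_eq_zero.1 (key p hp)

end Partial

/-! ### Multiplication with the singular factors -/

section Assembly

variable {L : Type*} [LieRing L] [LieAlgebra ℂ L] [FiniteTrunc L]

/-- The differential of `f(x, y) exp(log x S₁) exp(log y S₂)`. -/
theorem hasFDerivAt_mul_exp_mul_exp {N : ℕ} {E : Type*} [NormedAddCommGroup E] [NormedSpace ℂ E]
    {f : ℂ × ℂ → CompletedU L} {X : E → ℂ × ℂ} {X₁ X₂ : E →L[ℂ] ℂ} {p : E} {S₁ S₂ : L}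
    (hS : ⁅S₁, S₂⁆ = 0) {l₁ l₂ : E → ℂ} {c₁ c₂ : ℂ} {a₁ a₂ : L}
    (hX : HasFDerivAt X (X₁.prod X₂) p) (hl₁ : HasFDerivAt l₁ (c₁ • X₁) p)
    (hl₂ : HasFDerivAt l₂ (c₂ • X₂) p)
    (hf : DifferentiableAt ℂ (fun q => (f q).1 N) (X p))
    (h₁ : fderiv ℂ (fun q => (f q).1 N) (X p) (1, 0) =
      toTrunc L N a₁ * (f (X p)).1 N - c₁ • ((f (X p)).1 N * toTrunc L N S₁))
    (h₂ : fderiv ℂ (fun q => (f q).1 N) (X p) (0, 1) =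
      toTrunc L N a₂ * (f (X p)).1 N - c₂ • ((f (X p)).1 N * toTrunc L N S₂)) :
    ∃ F' : E →L[ℂ] Trunc L N,
      HasFDerivAt (fun p => (f (X p) * expLie (l₁ p • S₁) * expLie (l₂ p • S₂)).1 N) F' p ∧
      ∀ h, F' h = toTrunc L N (X₁ h • a₁ + X₂ h • a₂) *
        (f (X p) * expLie (l₁ p • S₁) * expLie (l₂ p • S₂)).1 N := by
  have hfX : HasFDerivAt (fun p => (f (X p)).1 N) _ p := hf.hasFDerivAt.comp p hX
  have he₁ : HasFDerivAt (fun p => (expLie (l₁ p • S₁)).1 N) _ p :=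
    (hasDerivAt_expLie N S₁ (l₁ p)).hasFDerivAt.comp p hl₁
  have he₂ : HasFDerivAt (fun p => (expLie (l₂ p • S₂)).1 N) _ p :=
    (hasDerivAt_expLie N S₂ (l₂ p)).hasFDerivAt.comp p hl₂
  refine ⟨_, (hfX.mul' he₁).mul' he₂, fun h => ?_⟩
  have hc₁ : Commute ((expLie (l₁ p • S₁)).1 N) (toTrunc L N S₁) := by
    refine expLie_commute ?_
    rw [map_smul]
    exact (Commute.refl _).smul_left _
  have hc₂ : Commute ((expLie (l₂ p • S₂)).1 N) (toTrunc L N S₂) := by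
    refine expLie_commute ?_
    rw [map_smul]
    exact (Commute.refl _).smul_left _
  have hc₁₂ : Commute ((expLie (l₁ p • S₁)).1 N) (toTrunc L N S₂) := by
    refine expLie_commute ?_
    rw [map_smul]
    exact (toTrunc_commute N hS).smul_left _
  have hsplit : fderiv ℂ (fun q => (f q).1 N) (X p) (X₁ h, X₂ h) =
      X₁ h • fderiv ℂ (fun q => (f q).1 N) (X p) (1, 0) +
        X₂ h • fderiv ℂ (fun q => (f q).1 N) (X p) (0, 1) := by
    rw [← map_smul, ← map_smul, ← map_add]
    simp
  simp only [mul_val, add_apply, smul_apply, ContinuousLinearMap.comp_apply,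
    ContinuousLinearMap.prod_apply, Pi.mul_apply, hsplit, h₁, h₂, map_add, map_smul,
    ContinuousLinearMap.toSpanSingleton_apply, MulOpposite.smul_eq_mul_unop, MulOpposite.unop_op,
    smul_eq_mul]
  -- the remaining identity is purely algebraic
  generalize (f (X p)).1 N = u at *
  generalize (expLie (l₁ p • S₁)).1 N = e₁ at *
  generalize (expLie (l₂ p • S₂)).1 N = e₂ at *
  rw [hc₁.eq, hc₂.eq]
  simp only [add_mul, smul_sub, sub_mul, smul_mul_assoc, mul_smul_comm, mul_assoc]
  have h₃ : toTrunc L N S₂ * (e₁ * e₂) = e₁ * (toTrunc L N S₂ * e₂) := by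
    rw [← mul_assoc, ← hc₁₂.eq, mul_assoc]
  rw [h₃]
  module

end Assembly

/-! ### The local solution at a pair of distinct marked points -/

section LocalSolutions

variable {n : ℕ}

/-- The components of the two-point connection in the directions `dz` and `dw`. -/
theorem conn2_eq (z : Fin n → ℂ) (p h : ℂ × ℂ) :
    conn2 z p h =
      h.1 • ((∑ k, ((2 * Real.pi * I : ℂ)⁻¹ * (1 / (p.1 - z k))) • tz k) +
        ((2 * Real.pi * I : ℂ)⁻¹ * (1 / (p.1 - p.2))) • tzw) +
      h.2 • ((∑ k, ((2 * Real.pi * I : ℂ)⁻¹ * (1 / (p.2 - z k))) • tw k) +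
        ((2 * Real.pi * I : ℂ)⁻¹ * (-(1 / (p.1 - p.2)))) • tzw) := by
  simp only [conn2, Finset.sum_add_distrib, smul_add, Finset.smul_sum, smul_smul]
  generalize (2 * Real.pi * I : ℂ)⁻¹ = c
  have h1 : ∀ k, c * (h.1 / (p.1 - z k)) = h.1 * (c * (1 / (p.1 - z k))) := fun k => by ring
  have h2 : ∀ k, c * (h.2 / (p.2 - z k)) = h.2 * (c * (1 / (p.2 - z k))) := fun k => by ring
  have h3 : c * ((h.1 - h.2) / (p.1 - p.2)) =
      h.1 * (c * (1 / (p.1 - p.2))) + h.2 * (c * (-(1 / (p.1 - p.2)))) := by ring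
  simp only [h1, h2, h3, add_smul]
  abel

/-- In the coordinates `((z - z_i) / v_i, (w - z_j) / v_j)` the connection is logarithmic along the axes,
with commuting residues `t_{iz} / 2πi` and `t_{jw} / 2πi`; `z - w` does not vanish because
`z_i ≠ z_j`. -/
theorem exists_psi5 {z : Fin n → ℂ} (hz : Function.Injective z) {i j : Fin n} (hij : i ≠ j)
    {vi vj : ℂ} (hvi : vi ≠ 0) (hvj : vj ≠ 0) :
    ∃ ε > 0, ∃ Ψ, IsPsi5 z i j vi vj ε Ψ := by
  classical
  obtain ⟨ε, hε, hεk⟩ := exists_pos_le_dist (P := fun k : Fin n × Fin n => k.1 ≠ k.2)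
    (d := fun k => ‖z k.1 - z k.2‖ / 2)
    (fun k hk => half_pos (norm_pos_iff.2 (sub_ne_zero.2 fun h => hk (hz h))))
  have hfar : ∀ k l, k ≠ l → ∀ x y : ℂ, ‖x‖ < ε → ‖y‖ < ε → z k + x - (z l + y) ≠ 0 := by
    intro k l hkl x y hx hy h
    have h1 : z k - z l = y - x := by linear_combination h
    have h2 := hεk (k, l) hkl
    simp only [h1] at h2
    have h3 := norm_sub_le y x
    linarith
  have hvi' : 0 < ‖vi‖ := norm_pos_iff.2 hvi
  have hvj' : 0 < ‖vj‖ := norm_pos_iff.2 hvj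
  set D : Set (ℂ × ℂ) := Metric.ball 0 (ε / ‖vi‖) ×ˢ Metric.ball 0 (ε / ‖vj‖) with hDdef
  have hD : IsOpen D := Metric.isOpen_ball.prod Metric.isOpen_ball
  have hD1 : ∀ q ∈ D, ‖q.1 * vi‖ < ε := fun q hq => by
    have := hq.1
    rwa [mem_ball_zero_iff, lt_div_iff₀ hvi', ← norm_mul] at this
  have hD2 : ∀ q ∈ D, ‖q.2 * vj‖ < ε := fun q hq => by
    have := hq.2
    rwa [mem_ball_zero_iff, lt_div_iff₀ hvj', ← norm_mul] at this
  have hZ : ∀ q ∈ D, ∀ k, k ≠ i → z i + q.1 * vi - z k ≠ 0 := fun q hq k hk => by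
    simpa using hfar i k hk.symm (q.1 * vi) 0 (hD1 q hq) (by simpa using hε)
  have hW : ∀ q ∈ D, ∀ k, k ≠ j → z j + q.2 * vj - z k ≠ 0 := fun q hq k hk => by
    simpa using hfar j k hk.symm (q.2 * vj) 0 (hD2 q hq) (by simpa using hε)
  have hZW : ∀ q ∈ D, z i + q.1 * vi - (z j + q.2 * vj) ≠ 0 := fun q hq =>
    hfar i j hij _ _ (hD1 q hq) (hD2 q hq)
  set c : ℂ := (2 * Real.pi * I : ℂ)⁻¹ with hc
  -- the components of the connection, multiplied with the coordinates; the coordinate cancels the pole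
  -- of the summands with `k = i` and `k = j`
  let φ : (Fin n ⊕ Fin n) ⊕ Unit → ℂ × ℂ → ℂ :=
    Sum.elim (Sum.elim
      (fun k q => c * (if k = i then 1 else q.1 * vi / (z i + q.1 * vi - z k))) (fun _ _ => 0))
      (fun _ q => c * (q.1 * vi / (z i + q.1 * vi - (z j + q.2 * vj))))
  let ψ : (Fin n ⊕ Fin n) ⊕ Unit → ℂ × ℂ → ℂ :=
    Sum.elim (Sum.elim (fun _ _ => 0)
      (fun k q => c * (if k = j then 1 else q.2 * vj / (z j + q.2 * vj - z k))))
      (fun _ q => c * (-(q.2 * vj / (z i + q.1 * vi - (z j + q.2 * vj)))))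
  have hφ : ∀ k, ContDiffOn ℂ (⊤ : ℕ∞) (φ k) D := by
    rintro ((k | k) | _)
    · rcases eq_or_ne k i with hk | hk
      · simp only [φ, Sum.elim_inl, hk, if_true]
        exact contDiffOn_const
      · simp only [φ, Sum.elim_inl, hk, if_false]
        exact contDiffOn_const.mul (ContDiffOn.div (by fun_prop) (by fun_prop)
          fun q hq => hZ q hq k hk)
    · exact contDiffOn_const
    · exact contDiffOn_const.mul (ContDiffOn.div (by fun_prop) (by fun_prop) fun q hq => hZW q hq)
  have hψ : ∀ k, ContDiffOn ℂ (⊤ : ℕ∞) (ψ k) D := by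
    rintro ((k | k) | _)
    · exact contDiffOn_const
    · rcases eq_or_ne k j with hk | hk
      · simp only [ψ, Sum.elim_inl, Sum.elim_inr, hk, if_true]
        exact contDiffOn_const
      · simp only [ψ, Sum.elim_inl, Sum.elim_inr, hk, if_false]
        exact contDiffOn_const.mul (ContDiffOn.div (by fun_prop) (by fun_prop)
          fun q hq => hW q hq k hk)
    · exact contDiffOn_const.mul
        (ContDiffOn.div (by fun_prop) (by fun_prop) fun q hq => hZW q hq).neg
  have hdiff : ∀ {χ : ℂ × ℂ → ℂ} {q}, ContDiffOn ℂ (⊤ : ℕ∞) χ D → q ∈ D → DifferentiableAt ℂ χ q :=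
    fun h hq => (h.differentiableOn (by simp)).differentiableAt (hD.mem_nhds hq)
  obtain ⟨f, hf0, -, hfs, hfx⟩ := exists_completed_solution (𝕜 := ℂ) (kzGen (n := n))
    (φ := φ) (ψ := ψ) (D := D) (S₁ := c • tz i) (S₂ := c • tw j) hD
    (by constructor <;> simp [hε, hvi', hvj'])
    (fun p hp r hr => ⟨star_ball p.1 hp.1 r hr, star_ball p.2 hp.2 r hr⟩) hφ hψ
    (by simp [kzGen, φ]) (by simp [kzGen, ψ])
    (by
      intro q hq
      simp only [sum_kzGen, φ, ψ, Sum.elim_inl, Sum.elim_inr, zero_smul, Finset.sum_const_zero,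
        add_zero, zero_add]
      rw [kz_lie_kz]
      -- flatness: the coefficient of `⁅t_{kz}, t_{kw}⁆` vanishes by a partial fraction identity
      refine Finset.sum_eq_zero fun k _ => ?_
      have h3 := hZW q hq
      rcases eq_or_ne k i with rfl | hki
      · have h2 := hW q hq k hij
        simp only [if_true, if_neg hij]
        convert zero_smul ℂ _
        field_simp
        ring
      rcases eq_or_ne k j with rfl | hkj
      · have h2 := hZ q hq k hij.symm
        simp only [if_true, if_neg hki]
        convert zero_smul ℂ _
        field_simp
        ring
      · have h1 := hZ q hq k hki
        have h2 := hW q hq k hkj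
        simp only [if_neg hki, if_neg hkj]
        convert zero_smul ℂ _
        field_simp
        ring)
    (by
      rintro q hq ((k | k) | _)
      · rw [fderiv_apply_snd (hdiff (hφ (.inl (.inl k))) hq)
            (hasDerivAt_const q.2 (φ (.inl (.inl k)) q)),
          fderiv_apply_fst (hdiff (hψ (.inl (.inl k))) hq) (hasDerivAt_const q.1 0),
          smul_zero, smul_zero]
      · rw [fderiv_apply_snd (hdiff (hφ (.inl (.inr k))) hq) (hasDerivAt_const q.2 0),
          fderiv_apply_fst (hdiff (hψ (.inl (.inr k))) hq)
            (hasDerivAt_const q.1 (ψ (.inl (.inr k)) q)), smul_zero, smul_zero]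
      · have h3 := hZW q hq
        have h4 : HasDerivAt (fun y => z i + q.1 * vi - (z j + y * vj)) (-vj) q.2 := by
          simpa using (((hasDerivAt_id' q.2).mul_const vj).const_add (z j)).const_sub
            (z i + q.1 * vi)
        have h5 : HasDerivAt (fun x => z i + x * vi - (z j + q.2 * vj)) vi q.1 := by
          simpa using (((hasDerivAt_id' q.1).mul_const vi).const_add (z i)).sub_const
            (z j + q.2 * vj)
        rw [fderiv_apply_snd (hdiff (hφ (.inr ())) hq)
            (((hasDerivAt_const q.2 (q.1 * vi)).fun_div h4 h3).const_mul c),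
          fderiv_apply_fst (hdiff (hψ (.inr ())) hq)
            (((hasDerivAt_const q.1 (q.2 * vj)).fun_div h5 h3).fun_neg.const_mul c)]
        simp only [smul_eq_mul]
        ring)
  refine ⟨ε, hε, _, isFlatOn_iff.2 fun p hp N => ?_, f, isHolomorphicOn_of_contDiffOn hfs, hf0,
    fun p _ => rfl⟩
  obtain ⟨⟨hp1, hx⟩, hp2, hy⟩ := hp
  have hx0 := slitPlane_ne_zero hx
  have hy0 := slitPlane_ne_zero hy
  set X : ℂ × ℂ → ℂ × ℂ := fun p => ((p.1 - z i) / vi, (p.2 - z j) / vj) with hX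
  have hZp : z i + (X p).1 * vi = p.1 := by simp only [hX]; field_simp; ring
  have hWp : z j + (X p).2 * vj = p.2 := by simp only [hX]; field_simp; ring
  have hq : X p ∈ D := by
    refine ⟨?_, ?_⟩
    · rw [mem_ball_zero_iff, norm_div]
      rw [mem_ball_iff_norm] at hp1
      gcongr
    · rw [mem_ball_zero_iff, norm_div]
      rw [mem_ball_iff_norm] at hp2
      gcongr
  have hX1 : HasFDerivAt (fun p : ℂ × ℂ => (p.1 - z i) / vi)
      (vi⁻¹ • ContinuousLinearMap.fst ℂ ℂ ℂ) p := by
    simpa only [div_eq_inv_mul, smul_eq_mul] using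
      ((hasFDerivAt_fst (𝕜 := ℂ) (p := p)).sub_const (z i)).fun_const_smul vi⁻¹
  have hX2 : HasFDerivAt (fun p : ℂ × ℂ => (p.2 - z j) / vj)
      (vj⁻¹ • ContinuousLinearMap.snd ℂ ℂ ℂ) p := by
    simpa only [div_eq_inv_mul, smul_eq_mul] using
      ((hasFDerivAt_snd (𝕜 := ℂ) (p := p)).sub_const (z j)).fun_const_smul vj⁻¹
  have hl₁ : HasFDerivAt (fun p : ℂ × ℂ => log ((p.1 - z i) / vi) / (2 * Real.pi * I))
      ((c * ((X p).1)⁻¹) • vi⁻¹ • ContinuousLinearMap.fst ℂ ℂ ℂ) p := by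
    have := ((hasDerivAt_log hx).comp_hasFDerivAt p hX1).fun_const_smul c
    rw [smul_smul] at this
    simpa only [div_eq_inv_mul _ (2 * Real.pi * I : ℂ), smul_eq_mul, Function.comp_apply] using this
  have hl₂ : HasFDerivAt (fun p : ℂ × ℂ => log ((p.2 - z j) / vj) / (2 * Real.pi * I))
      ((c * ((X p).2)⁻¹) • vj⁻¹ • ContinuousLinearMap.snd ℂ ℂ ℂ) p := by
    have := ((hasDerivAt_log hy).comp_hasFDerivAt p hX2).fun_const_smul c
    rw [smul_smul] at this
    simpa only [div_eq_inv_mul _ (2 * Real.pi * I : ℂ), smul_eq_mul, Function.comp_apply] using this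
  obtain ⟨F', hF', hF'h⟩ := hasFDerivAt_mul_exp_mul_exp (N := N) (f := f) (X := X) (p := p)
    (S₁ := tz i) (S₂ := tw j) (tz_lie_tw hij) (a₁ := ((X p).1)⁻¹ • ∑ k, φ k (X p) • kzGen k)
    (a₂ := ((X p).2)⁻¹ • ∑ k, ψ k (X p) • kzGen k) (hX1.prodMk hX2) hl₁ hl₂
    (((hfs N).differentiableOn (by simp)).differentiableAt (hD.mem_nhds hq))
    (by
      have h1 := (hfx N (X p) hq).1
      rw [map_smul, mul_smul_comm] at h1
      rw [map_smul, smul_mul_assoc, mul_comm c, mul_smul, ← smul_sub, ← h1, smul_smul,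
        inv_mul_cancel₀ hx0, one_smul])
    (by
      have h1 := (hfx N (X p) hq).2
      rw [map_smul, mul_smul_comm] at h1
      rw [map_smul, smul_mul_assoc, mul_comm c, mul_smul, ← smul_sub, ← h1, smul_smul,
        inv_mul_cancel₀ hy0, one_smul])
  refine ⟨F', hF', fun h => ?_⟩
  rw [hF'h]
  congr 2
  rw [conn2_eq, sum_kzGen, sum_kzGen, ← hc]
  simp only [φ, ψ, Sum.elim_inl, Sum.elim_inr, zero_smul, Finset.sum_const_zero, add_zero,
    zero_add, hZp, hWp, smul_apply, ContinuousLinearMap.coe_fst', ContinuousLinearMap.coe_snd',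
    smul_eq_mul, smul_add, Finset.smul_sum, smul_smul]
  change (X p).1 ≠ 0 at hx0
  change (X p).2 ≠ 0 at hy0
  have h3 := hZW _ hq
  rw [hZp, hWp] at h3
  congr 2
  · refine Finset.sum_congr rfl fun k _ => ?_
    congr 1
    split_ifs with hk
    · rw [hk, ← hZp, add_sub_cancel_left]
      field_simp
    · have h1 := hZ _ hq k hk
      rw [hZp] at h1
      field_simp
  · congr 1
    field_simp
  · refine Finset.sum_congr rfl fun k _ => ?_
    congr 1
    split_ifs with hk
    · rw [hk, ← hWp, add_sub_cancel_left]
      field_simp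
    · have h1 := hW _ hq k hk
      rw [hWp] at h1
      field_simp
  · congr 1
    field_simp

end LocalSolutions

/-! ### The local solution at a self-intersection -/

section LocalSolutionsA

variable {n : ℕ}

/-- In the coordinates `(z - a, w - z)` the connection is regular along the first axis direction and
logarithmic in the second one, with residue `t_{zw} / 2πi`. In these coordinates `dw` contributes to
both directions. -/
theorem exists_psiA {z : Fin n → ℂ} {γ : ℝ → ℂ} {l : ℝ × ℝ} (ha : ∀ k, γ l.1 ≠ z k)
    (hu : lineVelocity γ l ≠ 0) :
    ∃ ε > 0, ∃ Ψ, IsPsiA z γ l ε Ψ ∧ ∀ p, IsUnit (Ψ p) := by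
  obtain ⟨ε, hε, hεk⟩ := exists_pos_le_dist (P := fun _ => True)
    (d := fun k => ‖z k - γ l.1‖ / 2)
    (fun k _ => half_pos (norm_pos_iff.2 (sub_ne_zero.2 (ha k).symm)))
  set a := γ l.1
  set u := lineVelocity γ l
  have hfar : ∀ k, ∀ x y : ℂ, ‖x‖ < ε → ‖y‖ < ε → a + x + y - z k ≠ 0 := by
    intro k x y hx hy h
    have h1 : z k - a = x + y := by linear_combination -h
    have h2 := hεk k trivial
    rw [h1] at h2
    have h3 := norm_add_le x y
    linarith
  set D : Set (ℂ × ℂ) := Metric.ball 0 ε ×ˢ Metric.ball 0 ε with hDdef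
  have hD : IsOpen D := Metric.isOpen_ball.prod Metric.isOpen_ball
  have hZ : ∀ q ∈ D, ∀ k, a + q.1 - z k ≠ 0 := fun q hq k => by
    simpa using hfar k q.1 0 (mem_ball_zero_iff.1 hq.1) (by simpa using hε)
  have hW : ∀ q ∈ D, ∀ k, a + q.1 + q.2 - z k ≠ 0 := fun q hq k =>
    hfar k q.1 q.2 (mem_ball_zero_iff.1 hq.1) (mem_ball_zero_iff.1 hq.2)
  set c : ℂ := (2 * Real.pi * I : ℂ)⁻¹ with hc
  -- the first component of the connection, and the second one multiplied with its coordinate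
  let φ : (Fin n ⊕ Fin n) ⊕ Unit → ℂ × ℂ → ℂ :=
    Sum.elim (Sum.elim (fun k q => c * (1 / (a + q.1 - z k)))
      (fun k q => c * (1 / (a + q.1 + q.2 - z k)))) (fun _ _ => 0)
  let ψ : (Fin n ⊕ Fin n) ⊕ Unit → ℂ × ℂ → ℂ :=
    Sum.elim (Sum.elim (fun _ _ => 0) (fun k q => c * (q.2 / (a + q.1 + q.2 - z k))))
      (fun _ _ => c)
  have hφ : ∀ k, ContDiffOn ℂ (⊤ : ℕ∞) (φ k) D := by
    rintro ((k | k) | _)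
    · exact contDiffOn_const.mul (ContDiffOn.div (by fun_prop) (by fun_prop)
        fun q hq => hZ q hq k)
    · exact contDiffOn_const.mul (ContDiffOn.div (by fun_prop) (by fun_prop)
        fun q hq => hW q hq k)
    · exact contDiffOn_const
  have hφ' : ∀ k, ContDiffOn ℂ (⊤ : ℕ∞) (fun q => q.1 • φ k q) D :=
    fun k => contDiffOn_fst.smul (hφ k)
  have hψ : ∀ k, ContDiffOn ℂ (⊤ : ℕ∞) (ψ k) D := by
    rintro ((k | k) | _)
    · exact contDiffOn_const
    · exact contDiffOn_const.mul (ContDiffOn.div (by fun_prop) (by fun_prop)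
        fun q hq => hW q hq k)
    · exact contDiffOn_const
  have hdiff : ∀ {χ : ℂ × ℂ → ℂ} {q}, ContDiffOn ℂ (⊤ : ℕ∞) χ D → q ∈ D → DifferentiableAt ℂ χ q :=
    fun h hq => (h.differentiableOn (by simp)).differentiableAt (hD.mem_nhds hq)
  obtain ⟨f, hf0, hfu, hfs, hfx⟩ := exists_completed_solution (𝕜 := ℂ) (kzGen (n := n))
    (φ := fun k q => q.1 • φ k q) (ψ := ψ) (D := D) (S₁ := 0) (S₂ := c • tzw) hD
    (by constructor <;> simp [hε])
    (fun p hp r hr => ⟨star_ball p.1 hp.1 r hr, star_ball p.2 hp.2 r hr⟩) hφ' hψ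
    (by simp) (by simp [kzGen, ψ])
    (by
      intro q hq
      simp only [smul_assoc, ← Finset.smul_sum]
      rw [smul_lie]
      simp only [sum_kzGen, φ, ψ, Sum.elim_inl, Sum.elim_inr, zero_smul, Finset.sum_const_zero,
        add_zero, zero_add]
      have h1 := kz_lie_kz (fun k => c * (1 / (a + q.1 - z k)))
        (fun k => c * (q.2 / (a + q.1 + q.2 - z k))) 0 c
      have h2 := tw_sum_lie_tzw (fun k => c * (1 / (a + q.1 + q.2 - z k))) c
      have h3 : ∑ k, (c * (q.2 / (a + q.1 + q.2 - z k))) • tw k =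
          q.2 • ∑ k, (c * (1 / (a + q.1 + q.2 - z k))) • tw k := by
        rw [Finset.smul_sum]
        refine Finset.sum_congr rfl fun k _ => ?_
        rw [smul_smul]
        congr 1
        ring
      rw [zero_smul, add_zero] at h1
      rw [add_lie, h1, lie_add, h2, h3, lie_smul, lie_self, smul_zero, zero_add,
        ← Finset.sum_add_distrib]
      convert smul_zero q.1
      refine Finset.sum_eq_zero fun k _ => ?_
      rw [← add_smul]
      convert zero_smul ℂ _
      have h4 := hZ q hq k
      have h5 := hW q hq k
      field_simp
      ring)
    (by
      rintro q hq ((k | k) | _)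
      · rw [fderiv_apply_snd (hdiff (hφ' (.inl (.inl k))) hq)
            (hasDerivAt_const q.2 (q.1 • φ (.inl (.inl k)) q)),
          fderiv_apply_fst (hdiff (hψ (.inl (.inl k))) hq) (hasDerivAt_const q.1 0),
          smul_zero, smul_zero]
      · have h3 := hW q hq k
        have h4 : HasDerivAt (fun y => a + q.1 + y - z k) 1 q.2 :=
          ((hasDerivAt_id' q.2).const_add (a + q.1)).sub_const (z k)
        have h5 : HasDerivAt (fun x => a + x + q.2 - z k) 1 q.1 :=
          (((hasDerivAt_id' q.1).const_add a).add_const q.2).sub_const (z k)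
        rw [fderiv_apply_snd (hdiff (hφ' (.inl (.inr k))) hq)
            ((((hasDerivAt_const q.2 1).fun_div h4 h3).const_mul c).const_mul q.1),
          fderiv_apply_fst (hdiff (hψ (.inl (.inr k))) hq)
            (((hasDerivAt_const q.1 q.2).fun_div h5 h3).const_mul c)]
        simp only [smul_eq_mul]
        ring
      · rw [fderiv_apply_snd (hdiff (hφ' (.inr ())) hq) (hasDerivAt_const q.2 (q.1 • 0)),
          fderiv_apply_fst (hdiff (hψ (.inr ())) hq) (hasDerivAt_const q.1 c),
          smul_zero, smul_zero])
  -- the first component of the connection has no pole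
  have hfx₁ : ∀ N, ∀ p ∈ D, fderiv ℂ (fun p => (f p).1 N) p (1, 0) =
      toTrunc _ N (∑ k, φ k p • kzGen k) * (f p).1 N := fun N =>
    fderiv_eq_of_smul_eq (𝕜 := ℂ) hD (fun k => (hφ k).continuousOn) (hfs N)
      (ContinuousLinearMap.fst ℂ ℂ ℂ) rfl fun p hp => (hfx N p hp).1
  refine ⟨ε, hε, fun p => f (p.1 - a, p.2 - p.1) *
    expLie ((log ((p.2 - p.1) / u) / (2 * Real.pi * I) + (intersectionSign γ l : ℂ) / 2) • tzw),
    ⟨isFlatOn_iff.2 fun p hp N => ?_, f, isHolomorphicOn_of_contDiffOn hfs, hf0,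
    fun p _ => rfl⟩, fun p => (hfu _).mul (isUnit_expLie _)⟩
  obtain ⟨hp1, hp2, hy⟩ := hp
  have hy0 : p.2 - p.1 ≠ 0 := fun h => slitPlane_ne_zero hy (by simp [h])
  set X : ℂ × ℂ → ℂ × ℂ := fun p => (p.1 - a, p.2 - p.1) with hX
  have hq : X p ∈ D := ⟨hp1, hp2⟩
  have hX1 : HasFDerivAt (fun p : ℂ × ℂ => p.1 - a) (ContinuousLinearMap.fst ℂ ℂ ℂ) p :=
    (hasFDerivAt_fst (𝕜 := ℂ) (p := p)).sub_const a
  have hX2 : HasFDerivAt (fun p : ℂ × ℂ => p.2 - p.1)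
      (ContinuousLinearMap.snd ℂ ℂ ℂ - ContinuousLinearMap.fst ℂ ℂ ℂ) p :=
    (hasFDerivAt_snd (𝕜 := ℂ) (p := p)).fun_sub (hasFDerivAt_fst (𝕜 := ℂ) (p := p))
  have hl₂ : HasFDerivAt (fun p : ℂ × ℂ => log ((p.2 - p.1) / u) / (2 * Real.pi * I) +
        (intersectionSign γ l : ℂ) / 2)
      ((c * (p.2 - p.1)⁻¹) • (ContinuousLinearMap.snd ℂ ℂ ℂ - ContinuousLinearMap.fst ℂ ℂ ℂ))
      p := by
    have h1 : HasFDerivAt (fun p : ℂ × ℂ => (p.2 - p.1) / u)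
        (u⁻¹ • (ContinuousLinearMap.snd ℂ ℂ ℂ - ContinuousLinearMap.fst ℂ ℂ ℂ)) p := by
      simpa only [div_eq_inv_mul, smul_eq_mul] using hX2.fun_const_smul u⁻¹
    have := (((hasDerivAt_log hy).comp_hasFDerivAt p h1).fun_const_smul c).add_const
      ((intersectionSign γ l : ℂ) / 2)
    rw [smul_smul, smul_smul, show c * ((p.2 - p.1) / u)⁻¹ * u⁻¹ = c * (p.2 - p.1)⁻¹ by
      field_simp] at this
    simpa only [div_eq_inv_mul _ (2 * Real.pi * I : ℂ), smul_eq_mul, Function.comp_apply] using this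
  have hl₁ : HasFDerivAt (fun _ : ℂ × ℂ => (0 : ℂ)) ((0 : ℂ) • ContinuousLinearMap.fst ℂ ℂ ℂ) p :=
    (hasFDerivAt_const (0 : ℂ) p).congr_fderiv (by ext <;> simp)
  obtain ⟨F', hF', hF'h⟩ := hasFDerivAt_mul_exp_mul_exp (N := N) (f := f) (X := X) (p := p)
    (S₁ := (0 : TLie n)) (S₂ := tzw) (zero_lie _) (a₁ := ∑ k, φ k (X p) • kzGen k)
    (a₂ := (p.2 - p.1)⁻¹ • ∑ k, ψ k (X p) • kzGen k) (hX1.prodMk hX2) (l₁ := fun _ => 0) (c₁ := 0)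
    hl₁ hl₂
    (((hfs N).differentiableOn (by simp)).differentiableAt (hD.mem_nhds hq))
    (by rw [hfx₁ N _ hq, zero_smul, sub_zero])
    (by
      have h1 := (hfx N (X p) hq).2
      rw [map_smul, mul_smul_comm] at h1
      rw [map_smul, smul_mul_assoc, mul_comm c, mul_smul, ← smul_sub, ← h1, smul_smul,
        inv_mul_cancel₀ hy0, one_smul])
  simp only [smul_zero, expLie_zero, mul_one] at hF' hF'h
  refine ⟨F', hF', fun h => ?_⟩
  rw [hF'h]
  congr 2
  rw [conn2_eq, sum_kzGen, sum_kzGen, ← hc]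
  have hZp : a + (X p).1 = p.1 := by simp [hX]
  have hWp : p.1 + (X p).2 = p.2 := by simp [hX]
  simp only [φ, ψ, Sum.elim_inl, Sum.elim_inr, zero_smul, Finset.sum_const_zero, add_zero,
    zero_add, hZp, hWp, sub_apply, ContinuousLinearMap.coe_fst', ContinuousLinearMap.coe_snd']
  have h3 : ∑ k, (c * ((X p).2 / (p.2 - z k))) • tw k =
      (p.2 - p.1) • ∑ k, (c * (1 / (p.2 - z k))) • tw k := by
    rw [Finset.smul_sum]
    refine Finset.sum_congr rfl fun k _ => ?_
    rw [smul_smul]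
    congr 1
    simp only [hX]
    ring
  have h4 : 1 / (p.1 - p.2) = -(p.2 - p.1)⁻¹ := by
    rw [one_div, ← inv_neg, neg_sub]
  rw [h3, h4, smul_add ((p.2 - p.1)⁻¹), smul_smul ((p.2 - p.1)⁻¹), inv_mul_cancel₀ hy0]
  module

end LocalSolutionsA

/-! ### Flat sections on convex sets of pairs of parameters -/

section SectorSolution

variable {n : ℕ} {z : Fin n → ℂ} {i j : Fin n} {vi vj : ℂ} {γ : ℝ → ℂ}

/-- The pullback of the two-point connection along `(t, s) ↦ (γ t, γ s)`. -/
def pathConn (z : Fin n → ℂ) (γ : ℝ → ℂ) (q h : ℝ × ℝ) : TLie n :=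
  conn2 z (γ q.1, γ q.2) (h.1 * deriv γ q.1, h.2 * deriv γ q.2)

/-- The pairs of parameters with distinct values. -/
def regularPairs (γ : ℝ → ℂ) : Set (ℝ × ℝ) :=
  {q | q.1 ∈ Ioo (0 : ℝ) 1 ∧ q.2 ∈ Ioo (0 : ℝ) 1 ∧ γ q.1 ≠ γ q.2}

/-- On a convex set of pairs `(t, s)` with `γ t ≠ γ s` the pulled back connection is regular, and has a
global flat section normalized at a given point. -/
theorem exists_pair_solution (hγ : IsAdmissiblePath z i j vi vj γ) {V : Set (ℝ × ℝ)}
    (hV : IsOpen V) (hconv : Convex ℝ V) (hreg : V ⊆ regularPairs γ) {q₀ : ℝ × ℝ} (hq₀ : q₀ ∈ V) :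
    ∃ U : ℝ × ℝ → CompletedU (TLie n), U q₀ = 1 ∧ IsFlatOn ℝ (pathConn z γ) U V := by
  have hsh : Continuous fun x : ℝ × ℝ => q₀ + x := by fun_prop
  set D : Set (ℝ × ℝ) := {x | q₀ + x ∈ V} with hDdef
  have hD : IsOpen D := hV.preimage hsh
  have hm : ∀ q ∈ D, (q₀ + q).1 ∈ Ioo (0 : ℝ) 1 ∧ (q₀ + q).2 ∈ Ioo (0 : ℝ) 1 ∧
      γ (q₀ + q).1 ≠ γ (q₀ + q).2 := fun q hq => hreg hq
  have hA : ∀ q ∈ D, ∀ k, γ (q₀ + q).1 - z k ≠ 0 := fun q hq k =>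
    sub_ne_zero.2 (hγ.avoids _ (hm q hq).1 k)
  have hB : ∀ q ∈ D, ∀ k, γ (q₀ + q).2 - z k ≠ 0 := fun q hq k =>
    sub_ne_zero.2 (hγ.avoids _ (hm q hq).2.1 k)
  have hAB : ∀ q ∈ D, γ (q₀ + q).1 - γ (q₀ + q).2 ≠ 0 := fun q hq =>
    sub_ne_zero.2 (hm q hq).2.2
  have hs1 : ContDiffOn ℝ (⊤ : ℕ∞) (fun x : ℝ × ℝ => (q₀ + x).1) D := by fun_prop
  have hs2 : ContDiffOn ℝ (⊤ : ℕ∞) (fun x : ℝ × ℝ => (q₀ + x).2) D := by fun_prop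
  have hg1 : ContDiffOn ℝ (⊤ : ℕ∞) (fun x : ℝ × ℝ => γ (q₀ + x).1) D :=
    hγ.smoothOn_Ioo.comp hs1 fun q hq => (hm q hq).1
  have hg2 : ContDiffOn ℝ (⊤ : ℕ∞) (fun x : ℝ × ℝ => γ (q₀ + x).2) D :=
    hγ.smoothOn_Ioo.comp hs2 fun q hq => (hm q hq).2.1
  have hd1 : ContDiffOn ℝ (⊤ : ℕ∞) (fun x : ℝ × ℝ => deriv γ (q₀ + x).1) D :=
    hγ.smoothOn_deriv.comp hs1 fun q hq => (hm q hq).1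
  have hd2 : ContDiffOn ℝ (⊤ : ℕ∞) (fun x : ℝ × ℝ => deriv γ (q₀ + x).2) D :=
    hγ.smoothOn_deriv.comp hs2 fun q hq => (hm q hq).2.1
  set c : ℂ := (2 * Real.pi * I : ℂ)⁻¹ with hc
  -- the two components of the connection, with the base point shifted to the origin
  let φ : (Fin n ⊕ Fin n) ⊕ Unit → ℝ × ℝ → ℂ :=
    Sum.elim (Sum.elim (fun k q => c * (deriv γ (q₀ + q).1 * (γ (q₀ + q).1 - z k)⁻¹))
      (fun _ _ => 0)) (fun _ q => c * (deriv γ (q₀ + q).1 * (γ (q₀ + q).1 - γ (q₀ + q).2)⁻¹))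
  let ψ : (Fin n ⊕ Fin n) ⊕ Unit → ℝ × ℝ → ℂ :=
    Sum.elim (Sum.elim (fun _ _ => 0)
      (fun k q => c * (deriv γ (q₀ + q).2 * (γ (q₀ + q).2 - z k)⁻¹)))
      (fun _ q => c * (-deriv γ (q₀ + q).2 * (γ (q₀ + q).1 - γ (q₀ + q).2)⁻¹))
  have hφ : ∀ k, ContDiffOn ℝ (⊤ : ℕ∞) (φ k) D := by
    rintro ((k | k) | _)
    · exact contDiffOn_const.mul (hd1.mul ((hg1.sub contDiffOn_const).inv fun q hq => hA q hq k))
    · exact contDiffOn_const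
    · exact contDiffOn_const.mul (hd1.mul ((hg1.sub hg2).inv hAB))
  have hψ : ∀ k, ContDiffOn ℝ (⊤ : ℕ∞) (ψ k) D := by
    rintro ((k | k) | _)
    · exact contDiffOn_const
    · exact contDiffOn_const.mul (hd2.mul ((hg2.sub contDiffOn_const).inv fun q hq => hB q hq k))
    · exact contDiffOn_const.mul (hd2.neg.mul ((hg1.sub hg2).inv hAB))
  have hφ' : ∀ k, ContDiffOn ℝ (⊤ : ℕ∞) (fun q => q.1 • φ k q) D :=
    fun k => contDiffOn_fst.smul (hφ k)
  have hψ' : ∀ k, ContDiffOn ℝ (⊤ : ℕ∞) (fun q => q.2 • ψ k q) D :=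
    fun k => contDiffOn_snd.smul (hψ k)
  have hdiff : ∀ {χ : ℝ × ℝ → ℂ} {q}, ContDiffOn ℝ (⊤ : ℕ∞) χ D → q ∈ D → DifferentiableAt ℝ χ q :=
    fun h hq => (h.differentiableOn (by simp)).differentiableAt (hD.mem_nhds hq)
  obtain ⟨f, hf0, -, hfs, hfx⟩ := exists_completed_solution (𝕜 := ℝ) (kzGen (n := n))
    (φ := fun k q => q.1 • φ k q) (ψ := fun k q => q.2 • ψ k q) (D := D) (S₁ := 0) (S₂ := 0) hD
    (by simpa [hDdef] using hq₀)
    (fun p hp r hr => by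
      have := hconv hq₀ hp (sub_nonneg.2 hr.2) hr.1 (by ring)
      change q₀ + r • p ∈ V
      convert this using 1
      rw [smul_add, ← add_assoc, ← add_smul]
      simp) hφ' hψ' (by simp) (by simp)
    (by
      intro q hq
      simp only [smul_assoc, ← Finset.smul_sum]
      rw [← Complex.coe_smul, ← Complex.coe_smul, smul_lie, lie_smul]
      simp only [sum_kzGen, φ, ψ, Sum.elim_inl, Sum.elim_inr, zero_smul, Finset.sum_const_zero,
        add_zero, zero_add]
      rw [kz_lie_kz, Finset.sum_eq_zero, smul_zero, smul_zero]
      intro k _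
      convert zero_smul ℂ _
      have h1 := hA q hq k
      have h2 := hB q hq k
      have h3 := hAB q hq
      field_simp
      ring)
    (by
      rintro q hq ((k | k) | _)
      · rw [fderiv_apply_snd (hdiff (hφ' (.inl (.inl k))) hq)
            (hasDerivAt_const q.2 (q.1 • φ (.inl (.inl k)) q)),
          fderiv_apply_fst (hdiff (hψ' (.inl (.inl k))) hq) (hasDerivAt_const q.1 (q.2 • 0)),
          smul_zero, smul_zero]
      · rw [fderiv_apply_snd (hdiff (hφ' (.inl (.inr k))) hq) (hasDerivAt_const q.2 (q.1 • 0)),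
          fderiv_apply_fst (hdiff (hψ' (.inl (.inr k))) hq)
            (hasDerivAt_const q.1 (q.2 • ψ (.inl (.inr k)) q)), smul_zero, smul_zero]
      · have h3 := hAB q hq
        have h4 : HasDerivAt (fun y => γ (q₀ + q).1 - γ (q₀.2 + y)) (-deriv γ (q₀ + q).2) q.2 :=
          (HasDerivAt.comp_const_add q₀.2 q.2 (hγ.hasDerivAt (hm q hq).2.1)).const_sub _
        have h5 : HasDerivAt (fun x => γ (q₀.1 + x) - γ (q₀ + q).2) (deriv γ (q₀ + q).1) q.1 :=
          (HasDerivAt.comp_const_add q₀.1 q.1 (hγ.hasDerivAt (hm q hq).1)).sub_const _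
        rw [fderiv_apply_snd (hdiff (hφ' (.inr ())) hq)
            (((h4.fun_inv h3).const_mul (deriv γ (q₀ + q).1)).const_mul c |>.fun_const_smul q.1),
          fderiv_apply_fst (hdiff (hψ' (.inr ())) hq)
            (((h5.fun_inv h3).const_mul (-deriv γ (q₀ + q).2)).const_mul c |>.fun_const_smul q.2)]
        simp only [smul_smul, mul_comm q.1 q.2, Prod.fst_add, Prod.snd_add]
        congr 1
        ring)
  -- the connection has no poles, so that the coordinates can be divided out
  have hfx₁ : ∀ N, ∀ p ∈ D, fderiv ℝ (fun p => (f p).1 N) p (1, 0) =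
      toTrunc _ N (∑ k, φ k p • kzGen k) * (f p).1 N := fun N =>
    fderiv_eq_of_smul_eq (𝕜 := ℝ) hD (fun k => (hφ k).continuousOn) (hfs N)
      (ContinuousLinearMap.fst ℝ ℝ ℝ) rfl fun p hp => (hfx N p hp).1
  have hfx₂ : ∀ N, ∀ p ∈ D, fderiv ℝ (fun p => (f p).1 N) p (0, 1) =
      toTrunc _ N (∑ k, ψ k p • kzGen k) * (f p).1 N := fun N =>
    fderiv_eq_of_smul_eq (𝕜 := ℝ) hD (fun k => (hψ k).continuousOn) (hfs N)
      (ContinuousLinearMap.snd ℝ ℝ ℝ) rfl fun p hp => (hfx N p hp).2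
  refine ⟨fun q => f (q - q₀), by simpa using hf0, isFlatOn_iff.2 fun p hp N => ?_⟩
  have hq : p - q₀ ∈ D := by simpa [hDdef] using hp
  have h1 : HasFDerivAt (fun p => (f p).1 N) (fderiv ℝ (fun p => (f p).1 N) (p - q₀)) (p - q₀) :=
    (((hfs N).differentiableOn (by simp)).differentiableAt (hD.mem_nhds hq)).hasFDerivAt
  refine ⟨_, HasFDerivAt.comp (f := fun p => p - q₀) p h1 (hasFDerivAt_sub_const q₀), fun h => ?_⟩
  have h2 : h = h.1 • ((1 : ℝ), (0 : ℝ)) + h.2 • ((0 : ℝ), (1 : ℝ)) := by simp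
  have h3 : pathConn z γ p h =
      (h.1 : ℂ) • ∑ k, φ k (p - q₀) • kzGen k + (h.2 : ℂ) • ∑ k, ψ k (p - q₀) • kzGen k := by
    rw [pathConn, conn2_eq, sum_kzGen, sum_kzGen, ← hc]
    simp only [φ, ψ, Sum.elim_inl, Sum.elim_inr, zero_smul, Finset.sum_const_zero, add_zero,
      zero_add, add_sub_cancel, mul_smul, one_div]
    simp only [← Finset.smul_sum, ← smul_add, neg_smul]
    module
  rw [ContinuousLinearMap.comp_apply, ContinuousLinearMap.id_apply, h3, map_add, map_smul,
    map_smul, add_mul, smul_mul_assoc, smul_mul_assoc, ← hfx₁ N _ hq, ← hfx₂ N _ hq,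
    Complex.coe_smul, Complex.coe_smul, ← map_smul, ← map_smul, ← map_add, ← h2]

end SectorSolution

/-! ### The sectors of the triangle -/

section Sector

variable {γ : ℝ → ℂ} {l : ℝ × ℝ}

theorem eventually_lt_of_continuous {f g : ℝ × ℝ → ℝ} (hf : Continuous f) (hg : Continuous g)
    (h : f l < g l) : ∀ᶠ q in 𝓝 l, f q < g q :=
  (isOpen_lt hf hg).mem_nhds h

/-- The sector is described by inequalities that are linear in `(t, s)`. -/
theorem mem_sectorAbove_iff {q : ℝ × ℝ} : q ∈ sectorAbove γ l ↔
    0 < q.1 ∧ q.1 < q.2 ∧ q.2 < 1 ∧ 1 - q.2 < raySlope l * q.1 ∧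
      ∀ r ∈ {r ∈ selfIntersections γ | raySlope r < raySlope l}, raySlope r * q.1 < 1 - q.2 := by
  simp only [sectorAbove, mem_ofPred_eq, and_imp]
  refine and_congr_right fun h => and_congr_right fun _ => and_congr_right fun _ => ?_
  have h1 : raySlope q < raySlope l ↔ 1 - q.2 < raySlope l * q.1 := by
    rw [raySlope, div_lt_iff₀ h]
  have h2 : ∀ x, x < raySlope q ↔ x * q.1 < 1 - q.2 := fun x => by
    rw [raySlope, lt_div_iff₀ h]
  simp only [h1, h2]

theorem isOpen_sectorAbove (hfin : (selfIntersections γ).Finite) : IsOpen (sectorAbove γ l) := by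
  have : sectorAbove γ l = {q | 0 < q.1} ∩ ({q | q.1 < q.2} ∩ ({q | q.2 < 1} ∩
      ({q | 1 - q.2 < raySlope l * q.1} ∩
        ⋂ r ∈ {r ∈ selfIntersections γ | raySlope r < raySlope l},
          {q | raySlope r * q.1 < 1 - q.2}))) := by
    ext q
    simp only [mem_sectorAbove_iff, mem_inter_iff, mem_iInter, mem_ofPred_eq]
  rw [this]
  refine (isOpen_lt (by fun_prop) (by fun_prop)).inter ((isOpen_lt (by fun_prop) (by fun_prop)).inter
    ((isOpen_lt (by fun_prop) (by fun_prop)).inter ((isOpen_lt (by fun_prop) (by fun_prop)).inter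
    ((hfin.subset (sep_subset _ _)).isOpen_biInter fun r _ =>
      isOpen_lt (by fun_prop) (by fun_prop)))))

theorem convex_sectorAbove : Convex ℝ (sectorAbove γ l) := by
  intro p hp q hq x y hx hy hxy
  rw [mem_sectorAbove_iff] at hp hq ⊢
  obtain ⟨hp1, hp2, hp3, hp4, hp5⟩ := hp
  obtain ⟨hq1, hq2, hq3, hq4, hq5⟩ := hq
  -- a strict affine inequality is inherited by convex combinations
  have key : ∀ a b : ℝ, 0 < a → 0 < b → 0 < x * a + y * b := by
    intro a b ha hb
    rcases hx.eq_or_lt with rfl | hx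
    · have : y = 1 := by linarith
      simpa [this] using hb
    · have := mul_pos hx ha
      have := mul_nonneg hy hb.le
      linarith
  simp only [Prod.fst_add, Prod.snd_add, Prod.smul_fst, Prod.smul_snd, smul_eq_mul]
  refine ⟨key _ _ hp1 hq1, ?_, ?_, ?_, fun r hr => ?_⟩
  · linarith [key _ _ (sub_pos.2 hp2) (sub_pos.2 hq2)]
  · linarith [key _ _ (sub_pos.2 hp3) (sub_pos.2 hq3)]
  · linarith [key _ _ (sub_pos.2 hp4) (sub_pos.2 hq4)]
  · linarith [key _ _ (sub_pos.2 (hp5 r hr)) (sub_pos.2 (hq5 r hr))]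

theorem sectorAbove_subset_regularPairs : sectorAbove γ l ⊆ regularPairs γ := by
  rintro q ⟨h1, h2, h3, h4, h5⟩
  exact ⟨⟨h1, h2.trans h3⟩, ⟨h1.trans h2, h3⟩, fun h =>
    lt_irrefl _ (h5 q ⟨h1, h2, h3, h⟩ h4)⟩

/-- Rays from `(0, 1)` inside the sector. -/
theorem exists_ray (hfin : (selfIntersections γ).Finite) (hl : l ∈ selfIntersections γ) :
    ∃ μ > 0, ∀ᶠ r in 𝓝[>] (0 : ℝ), (r, 1 - μ * r) ∈ sectorAbove γ l := by
  have hl0 : 0 < raySlope l := div_pos (sub_pos.2 hl.2.2.1) hl.1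
  have hfin' : {r ∈ selfIntersections γ | raySlope r < raySlope l}.Finite :=
    hfin.subset (sep_subset _ _)
  -- by finiteness there is a slope between `raySlope l` and the next smaller one
  obtain ⟨μ, hμ, h1⟩ : ∃ μ ∈ Ioo 0 (raySlope l),
      ∀ r ∈ {r ∈ selfIntersections γ | raySlope r < raySlope l}, raySlope r < μ := by
    have h2 : ∀ᶠ μ in 𝓝[<] raySlope l,
        ∀ r ∈ {r ∈ selfIntersections γ | raySlope r < raySlope l}, raySlope r < μ := by
      rw [hfin'.eventually_all]
      exact fun r hr => (Ioo_mem_nhdsLT hr.2 |> fun h => mem_of_superset h fun x hx => hx.1)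
    exact (Filter.Eventually.and (Ioo_mem_nhdsLT hl0) h2).exists
  refine ⟨μ, hμ.1, ?_⟩
  have hsm : ∀ᶠ r in 𝓝[>] (0 : ℝ), r + μ * r < 1 := by
    refine nhdsWithin_le_nhds (Continuous.tendsto (f := fun r : ℝ => r + μ * r) (by fun_prop) 0
      (gt_mem_nhds (by simp)) : ∀ᶠ r in 𝓝 (0 : ℝ), r + μ * r < 1)
  filter_upwards [hsm, self_mem_nhdsWithin] with r hr hr0
  have hr0 : 0 < r := hr0
  have h2 := mul_pos hμ.1 hr0
  refine mem_sectorAbove_iff.2 ⟨hr0, by simp only; linarith, by simp only; linarith, ?_,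
    fun x hx => ?_⟩
  · simp only [sub_sub_cancel]
    exact mul_lt_mul_of_pos_right hμ.2 hr0
  · simp only [sub_sub_cancel]
    exact mul_lt_mul_of_pos_right (h1 x hx) hr0

/-- A segment inside the sector which ends at the self-intersection. -/
def descent (l : ℝ × ℝ) (r : ℝ) : ℝ × ℝ :=
  (l.1 - r, l.2 + (raySlope l + 1) * r)

theorem hasDerivAt_descent (r : ℝ) : HasDerivAt (descent l) (-1, raySlope l + 1) r := by
  have h1 : HasDerivAt (fun r : ℝ => l.1 - r) (-1) r := (hasDerivAt_id' r).const_sub l.1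
  have h2 : HasDerivAt (fun r : ℝ => l.2 + (raySlope l + 1) * r) (raySlope l + 1) r := by
    simpa using ((hasDerivAt_id' r).const_mul (raySlope l + 1)).const_add l.2
  exact h1.prodMk h2

theorem tendsto_descent : Tendsto (descent l) (𝓝[>] 0) (𝓝 l) := by
  have := (hasDerivAt_descent (l := l) 0).continuousAt.tendsto.mono_left
    (nhdsWithin_le_nhds (s := Ioi 0))
  simpa [descent] using this

theorem eventually_descent_mem (hfin : (selfIntersections γ).Finite)
    (hl : l ∈ selfIntersections γ) : ∀ᶠ r in 𝓝[>] (0 : ℝ), descent l r ∈ sectorAbove γ l := by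
  have ht := tendsto_descent (l := l)
  have hm : raySlope l * l.1 = 1 - l.2 := div_mul_cancel₀ _ hl.1.ne'
  have h1 : ∀ᶠ q in 𝓝 l, 0 < q.1 ∧ q.1 < q.2 ∧ q.2 < 1 := by
    simp only [eventually_and]
    exact ⟨eventually_lt_of_continuous (by fun_prop) (by fun_prop) hl.1,
      eventually_lt_of_continuous (by fun_prop) (by fun_prop) hl.2.1,
      eventually_lt_of_continuous (by fun_prop) (by fun_prop) hl.2.2.1⟩
  have h2 : ∀ᶠ q in 𝓝 l, ∀ r ∈ {r ∈ selfIntersections γ | raySlope r < raySlope l},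
      raySlope r * q.1 < 1 - q.2 := by
    rw [(hfin.subset (sep_subset _ _)).eventually_all]
    intro r hr
    refine eventually_lt_of_continuous (by fun_prop) (by fun_prop) ?_
    rw [← hm]
    exact mul_lt_mul_of_pos_right hr.2 hl.1
  filter_upwards [ht.eventually h1, ht.eventually h2, self_mem_nhdsWithin] with r hr1 hr2 hr0
  have hr0 : 0 < r := hr0
  refine mem_sectorAbove_iff.2 ⟨hr1.1, hr1.2.1, hr1.2.2, ?_, hr2⟩
  simp only [descent]
  linarith

end Sector

/-! ### The endpoints of the sectors -/

section Endpoints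

variable {n : ℕ} {z : Fin n → ℂ} {i j : Fin n} {vi vj : ℂ} {γ : ℝ → ℂ} {l : ℝ × ℝ}

theorem lineVelocity_eq (hγ : IsAdmissiblePath z i j vi vj γ) (hl : l ∈ selfIntersections γ) :
    lineVelocity γ l = -(raySlope l : ℂ) * deriv γ l.2 - deriv γ l.1 := by
  have h0 : (l.2 - 1) / l.1 * l.1 + 1 = l.2 := by
    rw [div_mul_cancel₀ _ hl.1.ne']
    ring
  have h1 : HasDerivAt (fun t : ℝ => (l.2 - 1) / l.1 * t + 1) ((l.2 - 1) / l.1) l.1 := by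
    simpa using ((hasDerivAt_id' l.1).const_mul ((l.2 - 1) / l.1)).add_const 1
  have h2 : HasDerivAt γ (deriv γ l.2) ((l.2 - 1) / l.1 * l.1 + 1) := by
    rw [h0]
    exact hγ.hasDerivAt ⟨hl.1.trans hl.2.1, hl.2.2.1⟩
  have h3 : HasDerivAt γ (deriv γ l.1) l.1 := hγ.hasDerivAt ⟨hl.1, hl.2.1.trans hl.2.2.1⟩
  have h4 : HasDerivAt (fun t : ℝ => γ ((l.2 - 1) / l.1 * t + 1) - γ t) _ l.1 :=
    (h2.scomp (g₁ := γ) l.1 h1).sub h3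
  rw [lineVelocity, h4.deriv, raySlope, Complex.real_smul]
  push_cast
  ring

theorem im_mul_conj_ne (hγ : IsAdmissiblePath z i j vi vj γ) (hl : l ∈ selfIntersections γ) :
    (deriv γ l.2 * (starRingEnd ℂ) (deriv γ l.1)).im ≠ 0 := by
  have h := hγ.transverse l hl
  intro h0
  apply h
  rw [div_eq_mul_inv, Complex.inv_def, ← mul_assoc, Complex.im_mul_ofReal, h0,
    zero_mul]

/-- Transversality makes the velocity of `w - z` along `L_l` nonzero, being a combination of the two
independent velocities of `γ` with nonzero coefficients. -/
theorem lineVelocity_ne_zero (hγ : IsAdmissiblePath z i j vi vj γ) (hl : l ∈ selfIntersections γ) :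
    lineVelocity γ l ≠ 0 := by
  rw [lineVelocity_eq hγ hl]
  intro h
  have h1 : deriv γ l.1 = -(raySlope l : ℂ) * deriv γ l.2 := (sub_eq_zero.1 h).symm
  refine im_mul_conj_ne hγ hl ?_
  rw [h1]
  simp
  ring

/-- Above the ray of the self-intersection, `w - z` avoids the branch cut. -/
theorem eventually_domainA (hγ : IsAdmissiblePath z i j vi vj γ) (hl : l ∈ selfIntersections γ)
    {ε : ℝ} (hε : 0 < ε) : ∀ᶠ q in 𝓝 l, q ∈ sectorAbove γ l →
      (γ q.1, γ q.2) ∈ domainA (γ l.1) (lineVelocity γ l) ε := by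
  have hl1 : l.1 ∈ Ioo (0 : ℝ) 1 := ⟨hl.1, hl.2.1.trans hl.2.2.1⟩
  have hl2 : l.2 ∈ Ioo (0 : ℝ) 1 := ⟨hl.1.trans hl.2.1, hl.2.2.1⟩
  have hc1 : ContinuousAt (fun q : ℝ × ℝ => γ q.1) l :=
    (hγ.hasDerivAt hl1).continuousAt.comp continuousAt_fst
  have hc2 : ContinuousAt (fun q : ℝ × ℝ => γ q.2) l :=
    (hγ.hasDerivAt hl2).continuousAt.comp continuousAt_snd
  have h1 : ∀ᶠ q in 𝓝 l, γ q.1 - γ l.1 ∈ Metric.ball 0 ε :=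
    (hc1.sub continuousAt_const).eventually_mem (Metric.isOpen_ball.mem_nhds (by simpa using hε))
  have h2 : ∀ᶠ q in 𝓝 l, γ q.2 - γ q.1 ∈ Metric.ball 0 ε :=
    (hc2.sub hc1).eventually_mem (Metric.isOpen_ball.mem_nhds (by
      change γ l.2 - γ l.1 ∈ _
      rw [← hl.2.2.2]
      simpa using hε))
  obtain ⟨η, hη, hlin1, hlin2⟩ := hγ.linear l hl
  have h3 : ∀ᶠ q in 𝓝 l, |q.1 - l.1| < η ∧ |q.2 - l.2| < η := by
    simp only [eventually_and]
    exact ⟨eventually_lt_of_continuous (by fun_prop) (by fun_prop) (by simpa using hη),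
      eventually_lt_of_continuous (by fun_prop) (by fun_prop) (by simpa using hη)⟩
  filter_upwards [h1, h2, h3] with q hq1 hq2 hq3 hq
  refine ⟨hq1, hq2, ?_⟩
  have hslope := (mem_sectorAbove_iff.1 hq).2.2.2.1
  have hm : raySlope l * l.1 = 1 - l.2 := div_mul_cancel₀ _ hl.1.ne'
  have hu := lineVelocity_ne_zero hγ hl
  have himne := im_mul_conj_ne hγ hl
  rw [mem_slitPlane_iff]
  right
  rw [div_eq_mul_inv, Complex.inv_def, ← mul_assoc, Complex.im_mul_ofReal]
  refine mul_ne_zero ?_ (inv_ne_zero (normSq_pos.2 hu).ne')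
  -- `γ` is linear near both parameters, so that this is a multiple of the signed distance to `L_l`
  have hval : ((γ q.2 - γ q.1) * (starRingEnd ℂ) (lineVelocity γ l)).im =
      -((q.2 - l.2) + raySlope l * (q.1 - l.1)) *
        (deriv γ l.2 * (starRingEnd ℂ) (deriv γ l.1)).im := by
    rw [lineVelocity_eq hγ hl, hlin1 _ hq3.1, hlin2 _ hq3.2, ← hl.2.2.2]
    simp
    ring
  simp only
  rw [hval]
  refine mul_ne_zero (ne_of_lt ?_) himne
  linarith

theorem eventually_domain5 (hγ : IsAdmissiblePath z i j vi vj γ) {ε : ℝ} (hε : 0 < ε) :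
    ∀ᶠ q in 𝓝 ((0 : ℝ), (1 : ℝ)), q.1 ∈ Ioo (0 : ℝ) 1 → q.2 ∈ Ioo (0 : ℝ) 1 →
      (γ q.1, γ q.2) ∈ domain5 z i j vi vj ε ∧ (γ q.1 - z i) / vi = q.1 ∧
        (γ q.2 - z j) / vj = (1 - q.2 : ℝ) := by
  have hmid : (1 / 2 : ℝ) ∈ Ioo (0 : ℝ) 1 := by norm_num
  have h1 := (hγ.tangentialPath_start hmid).eventually_slit hε
  have h2 := (hγ.tangentialPath_end hmid).eventually_slit hε
  obtain ⟨a, ha, h1⟩ := (mem_nhdsGT_iff_exists_Ioo_subset).1 h1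
  obtain ⟨b, hb, h2⟩ := (mem_nhdsGT_iff_exists_Ioo_subset).1 h2
  have h3 : ∀ᶠ q in 𝓝 ((0 : ℝ), (1 : ℝ)), q.1 < a ∧ 1 - q.2 < b := by
    simp only [eventually_and]
    exact ⟨eventually_lt_of_continuous (by fun_prop) (by fun_prop) ha,
      eventually_lt_of_continuous (by fun_prop) (by fun_prop) (by simpa using hb)⟩
  filter_upwards [h3] with q hq hq1 hq2
  obtain ⟨h4, h5⟩ := h1 ⟨hq1.1, hq.1⟩
  obtain ⟨h6, h7⟩ := h2 (show 1 - q.2 ∈ Ioo 0 b from ⟨by linarith [hq2.2], hq.2⟩)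
  rw [sub_sub_cancel] at h6 h7
  exact ⟨⟨h4, h6⟩, h5, h7⟩

end Endpoints

/-! ### Uniqueness from the asymptotics along a ray -/

section RayUniqueness

set_option linter.unusedSectionVars false

variable {L : Type*} [LieRing L] [LieAlgebra ℂ L] [FiniteTrunc L]

theorem isUnit_val {x : CompletedU L} (hx : IsUnit x) (N : ℕ) : IsUnit (x.1 N) :=
  hx.map ((Pi.evalRingHom (fun N => Trunc L N) N).comp (completedSubalgebra L).subtype)

theorem hasDerivAt_expLie_comp (T : L) (N : ℕ) {f : ℝ → ℂ} {f' : ℂ} {r : ℝ}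
    (hf : HasDerivAt f f' r) :
    HasDerivAt (fun r => (expLie (f r • T)).1 N)
      (f' • ((expLie (f r • T)).1 N * toTrunc L N T)) r :=
  (hasDerivAt_expLie N T _).scomp r hf

theorem smul_expLie_mul_mem (T : L) (N : ℕ) (s x : ℂ) :
    s • ((expLie (x • T)).1 N * toTrunc L N T) ∈ augFiltration L N 1 := by
  have hFil := isNilFiltration_aug L N
  exact Submodule.smul_mem _ _ (hFil.mul_right 0 _ (toTrunc_mem N T) _ (by rw [hFil.zero]; trivial))

/-- Uniqueness along a ray from a point where two singular factors are present. -/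
theorem ray_eq_zero {N : ℕ} {T T' : L} {μ β : ℝ} (hμ : 0 < μ) (hβ : 0 < β) {F : ℝ → Trunc L N}
    {a : ℝ → L} (hF : ∀ r ∈ Ioo 0 β, HasDerivAt F (toTrunc L N (a r) * F r) r)
    (h0 : Tendsto (fun r => F r * (tangFactor T' (μ * r) * tangFactor T r).1 N) (𝓝[>] 0) (𝓝 0)) :
    ∀ r ∈ Ioo 0 β, F r = 0 := by
  have hFil := isNilFiltration_aug L N
  have htop : ∀ x : Trunc L N, x ∈ augFiltration L N 0 := fun x => by rw [hFil.zero]; trivial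
  refine curve_eq_zero hF (X := fun r => (tangFactor T' (μ * r)).1 N * (tangFactor T r).1 N)
    (Y := fun r => (expLie ((log (r : ℂ) / (2 * Real.pi * I)) • T)).1 N *
      (expLie ((log ((μ * r : ℝ) : ℂ) / (2 * Real.pi * I)) • T')).1 N)
    (X' := fun r => (μ • ((-((μ * r : ℝ) : ℂ)⁻¹ / (2 * Real.pi * I)) •
      ((tangFactor T' (μ * r)).1 N * toTrunc L N T'))) * (tangFactor T r).1 N +
      (tangFactor T' (μ * r)).1 N *
        ((-(r : ℂ)⁻¹ / (2 * Real.pi * I)) • ((tangFactor T r).1 N * toTrunc L N T)))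
    (fun r hr => ?_) (fun r hr => ?_) (fun r _ => ?_) (le_principal_iff.2 (Ioo_mem_nhdsGT hβ)) h0
  · have h1 : HasDerivAt (fun r : ℝ => μ * r) μ r := by
      simpa using (hasDerivAt_id' r).const_mul μ
    have h2 : HasDerivAt (fun r => (tangFactor T' (μ * r)).1 N) _ r :=
      (hasDerivAt_tangFactor T' N (mul_pos hμ hr.1)).scomp (h := fun r => μ * r) r h1
    exact h2.mul (hasDerivAt_tangFactor T N hr.1)
  · refine Submodule.add_mem _ (hFil.mul_left 0 _ ?_ _ (htop _)) (hFil.mul_right 0 _ ?_ _ (htop _))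
    · rw [← Complex.coe_smul]
      exact Submodule.smul_mem _ _ (tangFactor_deriv_mem T' N _ _)
    · exact tangFactor_deriv_mem T N _ _
  · rw [← mul_val, ← mul_val, ← mul_val, mul_assoc, ← mul_assoc (tangFactor T r), tangFactor_mul,
      one_mul, tangFactor_mul, one_val]

/-- The ray from `(0, 1)` with slope parameter `μ`. -/
def vertexRay (μ r : ℝ) : ℝ × ℝ := (r, 1 - μ * r)

theorem hasDerivAt_vertexRay (μ r : ℝ) : HasDerivAt (vertexRay μ) (1, -μ) r := by
  have h1 : HasDerivAt (fun r : ℝ => 1 - μ * r) (-μ) r := by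
    simpa using ((hasDerivAt_id' r).const_mul μ).const_sub 1
  exact (hasDerivAt_id' r).prodMk h1

theorem tendsto_vertexRay (μ : ℝ) : Tendsto (vertexRay μ) (𝓝[>] 0) (𝓝 (0, 1)) := by
  have := (hasDerivAt_vertexRay μ 0).continuousAt.tendsto.mono_left
    (nhdsWithin_le_nhds (s := Ioi 0))
  simpa [vertexRay] using this

/-- Two flat sections with the same asymptotics along a ray agree. -/
theorem flat_eq_of_ray {A : ℝ × ℝ → ℝ × ℝ → L} {F G : ℝ × ℝ → CompletedU L} {V : Set (ℝ × ℝ)}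
    (hV : IsOpen V) (hconv : Convex ℝ V) {μ : ℝ} (hμ : 0 < μ)
    (hray : ∀ᶠ r in 𝓝[>] (0 : ℝ), vertexRay μ r ∈ V) (hF : IsFlatOn ℝ A F V) (hG : IsFlatOn ℝ A G V)
    {T T' : L}
    (hF1 : ∀ N, Tendsto (fun r => (F (vertexRay μ r) * (tangFactor T' (μ * r) * tangFactor T r)).1 N)
      (𝓝[>] 0) (𝓝 1))
    (hG1 : ∀ N, Tendsto (fun r => (G (vertexRay μ r) * (tangFactor T' (μ * r) * tangFactor T r)).1 N)
      (𝓝[>] 0) (𝓝 1)) : ∀ q ∈ V, F q = G q := by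
  obtain ⟨β, hβ, hβV⟩ := (mem_nhdsGT_iff_exists_Ioo_subset).1 hray
  have hβ : 0 < β := hβ
  have hmid : β / 2 ∈ Ioo 0 β := ⟨half_pos hβ, half_lt_self hβ⟩
  refine flat_unique hV hconv hF hG (hβV hmid) (completedU_ext fun N => ?_)
  refine sub_eq_zero.1 (ray_eq_zero (T := T) (T' := T') hμ hβ
    (F := fun r => (F (vertexRay μ r)).1 N - (G (vertexRay μ r)).1 N) (a := fun r => A (vertexRay μ r) (1, -μ))
    (fun r hr => ?_) ?_ _ hmid)
  · rw [mul_sub]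
    exact (hF.hasDerivAt_curve (hasDerivAt_vertexRay μ r) (hβV hr) N).sub
      (hG.hasDerivAt_curve (hasDerivAt_vertexRay μ r) (hβV hr) N)
  · have := (hF1 N).sub (hG1 N)
    rw [sub_self] at this
    simpa only [mul_val, sub_mul] using this

end RayUniqueness

/-! ### Existence and uniqueness of the self-intersection factor -/

section Factor

variable {n : ℕ} {z : Fin n → ℂ} {i j : Fin n} {vi vj : ℂ} {γ : ℝ → ℂ} {l : ℝ × ℝ}

theorem IsPsi5.mono {ε ε' : ℝ} {Ψ : ℂ × ℂ → CompletedU (TLie n)} (h : IsPsi5 z i j vi vj ε Ψ)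
    (hε : ε' ≤ ε) : IsPsi5 z i j vi vj ε' Ψ := by
  obtain ⟨h1, f, hf, hf0, hΨ⟩ := h
  have hD : domain5 z i j vi vj ε' ⊆ domain5 z i j vi vj ε :=
    prod_mono (slitDisc_mono hε) (slitDisc_mono hε)
  exact ⟨h1.mono hD, f, fun N c => (hf N c).mono (prod_mono
    (Metric.ball_subset_ball (by gcongr)) (Metric.ball_subset_ball (by gcongr))), hf0,
    fun p hp => hΨ p (hD hp)⟩

theorem IsPsiA.mono {ε ε' : ℝ} {Ψ : ℂ × ℂ → CompletedU (TLie n)} (h : IsPsiA z γ l ε Ψ)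
    (hε : ε' ≤ ε) : IsPsiA z γ l ε' Ψ := by
  obtain ⟨h1, f, hf, hf0, hΨ⟩ := h
  have hD : domainA (γ l.1) (lineVelocity γ l) ε' ⊆ domainA (γ l.1) (lineVelocity γ l) ε :=
    fun p hp => ⟨Metric.ball_subset_ball hε hp.1, Metric.ball_subset_ball hε hp.2.1, hp.2.2⟩
  exact ⟨h1.mono hD, f, fun N c => (hf N c).mono (prod_mono
    (Metric.ball_subset_ball hε) (Metric.ball_subset_ball hε)), hf0, fun p hp => hΨ p (hD hp)⟩

theorem flat_pair_comp (hγ : IsAdmissiblePath z i j vi vj γ) {D : Set (ℂ × ℂ)}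
    {Ψ : ℂ × ℂ → CompletedU (TLie n)} (hΨ : IsFlatOn ℂ (conn2 z) Ψ D) {S : Set (ℝ × ℝ)}
    (hS : ∀ q ∈ S, q.1 ∈ Ioo (0 : ℝ) 1 ∧ q.2 ∈ Ioo (0 : ℝ) 1 ∧ (γ q.1, γ q.2) ∈ D) :
    IsFlatOn ℝ (pathConn z γ) (fun q => Ψ (γ q.1, γ q.2)) S := by
  have h1 : ∀ q ∈ S, HasFDerivAt (fun q : ℝ × ℝ => (γ q.1, γ q.2))
      (((ContinuousLinearMap.toSpanSingleton ℝ (deriv γ q.1)).comp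
        (ContinuousLinearMap.fst ℝ ℝ ℝ)).prod
        ((ContinuousLinearMap.toSpanSingleton ℝ (deriv γ q.2)).comp
        (ContinuousLinearMap.snd ℝ ℝ ℝ))) q := fun q hq =>
    (HasFDerivAt.comp (f := fun q : ℝ × ℝ => q.1) q (hγ.hasDerivAt (hS q hq).1).hasFDerivAt
      hasFDerivAt_fst).prodMk
    (HasFDerivAt.comp (f := fun q : ℝ × ℝ => q.2) q (hγ.hasDerivAt (hS q hq).2.1).hasFDerivAt
      hasFDerivAt_snd)
  exact (hΨ.pullback h1 fun q hq => (hS q hq).2.2).congr_form fun q _ h => by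
    simp [pathConn]

/-- A flat section that coincides with `Ψ_5` near `(0, 1)` is asymptotic to the singular factor of `Ψ_5`
along rays from `(0, 1)`. -/
theorem tendsto_psi5_ray (hγ : IsAdmissiblePath z i j vi vj γ) {V : Set (ℝ × ℝ)}
    (hVr : V ⊆ regularPairs γ) {μ : ℝ} (hray : ∀ᶠ r in 𝓝[>] (0 : ℝ), vertexRay μ r ∈ V)
    {ε : ℝ} (hε : 0 < ε) {Ψ : ℂ × ℂ → CompletedU (TLie n)} (hΨ : IsPsi5 z i j vi vj ε Ψ)
    {G : ℝ × ℝ → CompletedU (TLie n)}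
    (hG : ∀ᶠ q in 𝓝[V] ((0 : ℝ), (1 : ℝ)), G q = Ψ (γ q.1, γ q.2)) (N : ℕ) :
    Tendsto (fun r => (G (vertexRay μ r) * (tangFactor (tw j) (μ * r) * tangFactor (tz i) r)).1 N)
      (𝓝[>] 0) (𝓝 1) := by
  obtain ⟨-, f, hf, hf0, hfΨ⟩ := hΨ
  have hvi : 0 < ‖vi‖ := norm_pos_iff.2 hγ.vi_ne
  have hvj : 0 < ‖vj‖ := norm_pos_iff.2 hγ.vj_ne
  have h1 : ContinuousAt (fun q => (f q).1 N) (0, 0) :=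
    hf.continuousAt (prod_mem_nhds (Metric.ball_mem_nhds _ (div_pos hε hvi))
      (Metric.ball_mem_nhds _ (div_pos hε hvj))) N
  have h2 : Tendsto (fun r : ℝ => (f ((r : ℂ), ((μ * r : ℝ) : ℂ))).1 N) (𝓝[>] 0) (𝓝 1) := by
    have h3 : Tendsto (fun r : ℝ => ((r : ℂ), ((μ * r : ℝ) : ℂ))) (𝓝[>] 0) (𝓝 (0, 0)) := by
      have : ContinuousAt (fun r : ℝ => ((r : ℂ), ((μ * r : ℝ) : ℂ))) 0 := by fun_prop
      simpa using this.tendsto.mono_left nhdsWithin_le_nhds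
    have h4 := h1.tendsto.comp h3
    rw [hf0] at h4
    exact h4
  refine h2.congr' ?_
  have hVray : Tendsto (vertexRay μ) (𝓝[>] 0) (𝓝[V] (0, 1)) :=
    tendsto_nhdsWithin_iff.2 ⟨tendsto_vertexRay μ, hray⟩
  filter_upwards [hVray.eventually hG, (tendsto_vertexRay μ).eventually (eventually_domain5 hγ hε), hray]
    with r hr1 hr2 hr3
  obtain ⟨h5, h6, h7⟩ := hr2 (hVr hr3).1 (hVr hr3).2.1
  rw [hr1, hfΨ _ h5]
  simp only [h6, h7]
  simp only [vertexRay, sub_sub_cancel]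
  rw [mul_assoc (f _), mul_assoc (f _), mul_assoc (expLie _), ← mul_assoc (expLie _) (tangFactor _ _),
    mul_tangFactor, one_mul, mul_tangFactor, mul_one]

/-- The logarithm of `(w - z) / u` in the exponent of `Ψ_{a,u}`, along the descent to the
self-intersection. -/
def descentLog (γ : ℝ → ℂ) (l : ℝ × ℝ) (r : ℝ) : ℂ :=
  log ((γ (descent l r).2 - γ (descent l r).1) / lineVelocity γ l) / (2 * Real.pi * I) +
    (intersectionSign γ l : ℂ) / 2

theorem exists_hasDerivAt_descentLog (hγ : IsAdmissiblePath z i j vi vj γ) {ε r : ℝ}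
    (h1 : (descent l r).1 ∈ Ioo (0 : ℝ) 1) (h2 : (descent l r).2 ∈ Ioo (0 : ℝ) 1)
    (h3 : (γ (descent l r).1, γ (descent l r).2) ∈ domainA (γ l.1) (lineVelocity γ l) ε) :
    ∃ d, HasDerivAt (descentLog γ l) d r := by
  have h4 := hasDerivAt_descent (l := l) r
  have h5 : HasDerivAt (fun r => γ (descent l r).1) _ r :=
    (hγ.hasDerivAt h1).scomp (h := fun r => (descent l r).1) r
      ((hasFDerivAt_fst (𝕜 := ℝ)).comp_hasDerivAt r h4)
  have h6 : HasDerivAt (fun r => γ (descent l r).2) _ r :=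
    (hγ.hasDerivAt h2).scomp (h := fun r => (descent l r).2) r
      ((hasFDerivAt_snd (𝕜 := ℝ)).comp_hasDerivAt r h4)
  exact ⟨_, (((((h6.fun_sub h5).div_const (lineVelocity γ l)).clog_real h3.2.2).div_const
    (2 * Real.pi * I)).add_const ((intersectionSign γ l : ℂ) / 2))⟩

theorem eventually_descent_domainA (hγ : IsAdmissiblePath z i j vi vj γ)
    (hl : l ∈ selfIntersections γ) {ε : ℝ} (hε : 0 < ε) :
    ∀ᶠ r in 𝓝[>] (0 : ℝ), descent l r ∈ sectorAbove γ l ∧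
      (γ (descent l r).1, γ (descent l r).2) ∈ domainA (γ l.1) (lineVelocity γ l) ε := by
  filter_upwards [eventually_descent_mem hγ.finite hl,
    (tendsto_descent (l := l)).eventually (eventually_domainA hγ hl hε)] with r h1 h2
  exact ⟨h1, h2 h1⟩

/-- Along the descent, `Ψ_{a,u}` is asymptotic to its singular factor. -/
theorem tendsto_psiA (hγ : IsAdmissiblePath z i j vi vj γ) (hl : l ∈ selfIntersections γ) {ε : ℝ}
    (hε : 0 < ε) {Ψ : ℂ × ℂ → CompletedU (TLie n)} (hΨ : IsPsiA z γ l ε Ψ) (N : ℕ) :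
    Tendsto (fun r => (Ψ (γ (descent l r).1, γ (descent l r).2) *
      expLie (-(descentLog γ l r • tzw))).1 N) (𝓝[>] 0) (𝓝 1) := by
  obtain ⟨-, f, hf, hf0, hfΨ⟩ := hΨ
  have h1 : ContinuousAt (fun q => (f q).1 N) (0, 0) :=
    hf.continuousAt (prod_mem_nhds (Metric.ball_mem_nhds _ hε) (Metric.ball_mem_nhds _ hε)) N
  have hc1 : ContinuousAt (fun q : ℝ × ℝ => γ q.1) l :=
    (hγ.hasDerivAt ⟨hl.1, hl.2.1.trans hl.2.2.1⟩).continuousAt.comp continuousAt_fst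
  have hc2 : ContinuousAt (fun q : ℝ × ℝ => γ q.2) l :=
    (hγ.hasDerivAt ⟨hl.1.trans hl.2.1, hl.2.2.1⟩).continuousAt.comp continuousAt_snd
  have h2 : Tendsto (fun q : ℝ × ℝ => (γ q.1 - γ l.1, γ q.2 - γ q.1)) (𝓝 l) (𝓝 (0, 0)) := by
    have h3 : Tendsto (fun q : ℝ × ℝ => (γ q.1 - γ l.1, γ q.2 - γ q.1)) (𝓝 l)
        (𝓝 (γ l.1 - γ l.1, γ l.2 - γ l.1)) :=
      (hc1.tendsto.sub tendsto_const_nhds).prodMk_nhds (hc2.tendsto.sub hc1.tendsto)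
    rwa [sub_self, ← hl.2.2.2, sub_self] at h3
  have h4 := (h1.tendsto.comp h2).comp (tendsto_descent (l := l))
  rw [hf0] at h4
  refine h4.congr' ?_
  filter_upwards [eventually_descent_domainA hγ hl hε] with r hr
  rw [hfΨ _ hr.2]
  change _ = (f _ * expLie (descentLog γ l r • tzw) * expLie (-(descentLog γ l r • tzw))).1 N
  rw [mul_assoc, expLie_mul_neg, mul_one]
  rfl

/-- The solution `Ψ_{a,u}` is uniquely determined near the self-intersection, along the descent. -/
theorem psiA_eq (hγ : IsAdmissiblePath z i j vi vj γ) (hl : l ∈ selfIntersections γ) {ε ε' : ℝ}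
    (hε : 0 < ε) (hε' : 0 < ε') {Ψ Ψ' : ℂ × ℂ → CompletedU (TLie n)} (hΨ : IsPsiA z γ l ε Ψ)
    (hΨ' : IsPsiA z γ l ε' Ψ') (N : ℕ) :
    ∀ᶠ r in 𝓝[>] (0 : ℝ), (Ψ (γ (descent l r).1, γ (descent l r).2)).1 N =
      (Ψ' (γ (descent l r).1, γ (descent l r).2)).1 N := by
  obtain ⟨β, hβ, hβV⟩ := (mem_nhdsGT_iff_exists_Ioo_subset).1
    ((eventually_descent_domainA hγ hl hε).and (eventually_descent_domainA hγ hl hε'))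
  have hβ : 0 < β := hβ
  have hreg : ∀ r ∈ Ioo 0 β, (descent l r).1 ∈ Ioo (0 : ℝ) 1 ∧ (descent l r).2 ∈ Ioo (0 : ℝ) 1 :=
    fun r hr => ⟨(sectorAbove_subset_regularPairs (hβV hr).1.1).1,
      (sectorAbove_subset_regularPairs (hβV hr).1.1).2.1⟩
  have hflat : ∀ {ε : ℝ} {Ψ : ℂ × ℂ → CompletedU (TLie n)}, IsPsiA z γ l ε Ψ → ∀ r ∈ Ioo 0 β,
      (γ (descent l r).1, γ (descent l r).2) ∈ domainA (γ l.1) (lineVelocity γ l) ε →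
      HasDerivAt (fun r => (Ψ (γ (descent l r).1, γ (descent l r).2)).1 N)
        (toTrunc _ N (pathConn z γ (descent l r) (-1, raySlope l + 1)) *
          (Ψ (γ (descent l r).1, γ (descent l r).2)).1 N) r := by
    intro ε Ψ hΨ r hr hrA
    exact (flat_pair_comp (S := {descent l r}) hγ hΨ.1 (by
      rintro q rfl
      exact ⟨(hreg r hr).1, (hreg r hr).2, hrA⟩)).hasDerivAt_curve (hasDerivAt_descent r) rfl N
  choose! d hd using fun r (hr : r ∈ Ioo 0 β) =>
    exists_hasDerivAt_descentLog hγ (hreg r hr).1 (hreg r hr).2 (hβV hr).1.2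
  have key := curve_eq_zero (N := N) (α := 0) (β := β)
    (F := fun r => (Ψ (γ (descent l r).1, γ (descent l r).2)).1 N -
      (Ψ' (γ (descent l r).1, γ (descent l r).2)).1 N)
    (a := fun r => pathConn z γ (descent l r) (-1, raySlope l + 1))
    (X := fun r => (expLie (-descentLog γ l r • tzw)).1 N)
    (Y := fun r => (expLie (descentLog γ l r • tzw)).1 N)
    (X' := fun r => (-d r) • ((expLie (-descentLog γ l r • tzw)).1 N * toTrunc _ N tzw))
    (fun r hr => by
      rw [mul_sub]
      exact (hflat hΨ r hr (hβV hr).1.2).sub (hflat hΨ' r hr (hβV hr).2.2))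
    (fun r hr => hasDerivAt_expLie_comp tzw N (hd r hr).fun_neg)
    (fun r hr => smul_expLie_mul_mem _ _ _ _)
    (fun r _ => by
      rw [← mul_val, neg_smul]
      have := expLie_mul_neg (-(descentLog γ l r • (tzw : TLie n)))
      rw [neg_neg] at this
      rw [this, one_val])
    (l := 𝓝[>] 0) (le_principal_iff.2 (Ioo_mem_nhdsGT hβ))
    (by
      have := (tendsto_psiA hγ hl hε hΨ N).sub (tendsto_psiA hγ hl hε' hΨ' N)
      rw [sub_self] at this
      simpa only [mul_val, sub_mul, neg_smul] using this)
  filter_upwards [Ioo_mem_nhdsGT hβ] with r hr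
  exact sub_eq_zero.1 (key r hr)

theorem tendsto_descent_within (hγ : IsAdmissiblePath z i j vi vj γ)
    (hl : l ∈ selfIntersections γ) : Tendsto (descent l) (𝓝[>] 0) (𝓝[sectorAbove γ l] l) :=
  tendsto_nhdsWithin_iff.2 ⟨tendsto_descent, eventually_descent_mem hγ.finite hl⟩

/-- `Ψ_{5,l+1}` is determined on the sector by its asymptotics at `(0, 1)`, and `Ψ_{a,u}` by those at
the self-intersection, where it is invertible. -/
theorem factor_unique (hγ : IsAdmissiblePath z i j vi vj γ) (hl : l ∈ selfIntersections γ)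
    {C C' : CompletedU (TLie n)} (hC : IsSelfIntersectionFactor z i j vi vj γ l C)
    (hC' : IsSelfIntersectionFactor z i j vi vj γ l C') : C = C' := by
  obtain ⟨ε, hε, Ψ5, ΨA, G, h5, hA, hG, hG5, hGA⟩ := hC
  obtain ⟨ε', hε', Ψ5', ΨA', G', h5', hA', hG', hG5', hGA'⟩ := hC'
  obtain ⟨μ, hμ, hray⟩ := exists_ray hγ.finite hl
  -- the sections on the sector agree, and so do the local solutions along the descent
  have hGG : ∀ q ∈ sectorAbove γ l, G q = G' q :=
    flat_eq_of_ray (isOpen_sectorAbove hγ.finite) convex_sectorAbove hμ hray hG hG'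
      (tendsto_psi5_ray hγ sectorAbove_subset_regularPairs hray hε h5 hG5)
      (tendsto_psi5_ray hγ sectorAbove_subset_regularPairs hray hε' h5' hG5')
  refine completedU_ext fun N => ?_
  have : CompleteSpace (Trunc (TLie n) N) := FiniteDimensional.complete ℂ _
  have hunit := (tendsto_psiA hγ hl hε hA N).eventually
    (Units.isOpen.mem_nhds (isUnit_one : IsUnit (1 : Trunc (TLie n) N)))
  obtain ⟨r, hr1, hr2, hr3, hr4, hr5⟩ := (hunit.and ((psiA_eq hγ hl hε hε' hA hA' N).and
    (((tendsto_descent_within hγ hl).eventually hGA).and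
    (((tendsto_descent_within hγ hl).eventually hGA').and
      (eventually_descent_mem hγ.finite hl))))).exists
  have h1 := congrArg (fun x : CompletedU (TLie n) => x.1 N)
    (hr3.symm.trans ((hGG _ hr5).trans hr4))
  simp only [mul_val, ← hr2] at h1
  obtain ⟨e, he⟩ := isUnit_val (isUnit_expLie (-(descentLog γ l r • (tzw : TLie n)))) N
  rw [mul_val, ← he] at hr1
  exact ((Units.isUnit_mul_units _ e).1 hr1).mul_left_cancel h1

/-- Existence: a global flat section on the sector is normalized by `Ψ_5` near `(0, 1)`, and then
compared with `Ψ_{a,u}` at one point near the self-intersection. -/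
theorem existsUnique_factor (hz : Function.Injective z) (hij : i ≠ j)
    (hγ : IsAdmissiblePath z i j vi vj γ) (hl : l ∈ selfIntersections γ) :
    ∃! C, IsSelfIntersectionFactor z i j vi vj γ l C := by
  suffices h : ∃ C, IsSelfIntersectionFactor z i j vi vj γ l C from
    h.imp fun C hC => ⟨hC, fun C' hC' => factor_unique hγ hl hC' hC⟩
  obtain ⟨ε₁, hε₁, Ψ5, h5⟩ := exists_psi5 hz hij hγ.vi_ne hγ.vj_ne
  obtain ⟨ε₂, hε₂, ΨA, hA, hAu⟩ := exists_psiA (z := z) (γ := γ) (l := l)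
    (hγ.avoids l.1 ⟨hl.1, hl.2.1.trans hl.2.2.1⟩) (lineVelocity_ne_zero hγ hl)
  have hV := isOpen_sectorAbove (l := l) hγ.finite
  have hreg := sectorAbove_subset_regularPairs (γ := γ) (l := l)
  -- a convex neighbourhood of `(0, 1)` on which the first solution is defined
  obtain ⟨η₁, hη₁, h1⟩ := Metric.eventually_nhds_iff_ball.1 (eventually_domain5 hγ hε₁)
  obtain ⟨μ, -, hray⟩ := exists_ray hγ.finite hl
  obtain ⟨r, hr1, hr2⟩ := (hray.and ((tendsto_vertexRay μ).eventually
    (Metric.ball_mem_nhds _ hη₁))).exists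
  have hflat5 : IsFlatOn ℝ (pathConn z γ) (fun q => Ψ5 (γ q.1, γ q.2))
      (sectorAbove γ l ∩ Metric.ball (0, 1) η₁) := flat_pair_comp hγ h5.1 fun q hq =>
    ⟨(hreg hq.1).1, (hreg hq.1).2.1, (h1 q hq.2 (hreg hq.1).1 (hreg hq.1).2.1).1⟩
  obtain ⟨U, hU1, hU⟩ := exists_pair_solution hγ hV convex_sectorAbove hreg hr1
  set q₀ : ℝ × ℝ := (r, 1 - μ * r) with hq₀
  set G : ℝ × ℝ → CompletedU (TLie n) := fun q => U q * Ψ5 (γ q₀.1, γ q₀.2) with hGdef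
  have hG : IsFlatOn ℝ (pathConn z γ) G (sectorAbove γ l) := hU.mul_const _
  have hG5 : ∀ q ∈ sectorAbove γ l ∩ Metric.ball (0, 1) η₁, G q = Ψ5 (γ q.1, γ q.2) :=
    flat_unique (hV.inter Metric.isOpen_ball) (convex_sectorAbove.inter (convex_ball _ _))
      (hG.mono inter_subset_left) hflat5 ⟨hr1, hr2⟩ (by simp [hGdef, hU1])
  -- a convex neighbourhood of the self-intersection on which the second solution is defined
  obtain ⟨η₂, hη₂, h2⟩ := Metric.eventually_nhds_iff_ball.1 (eventually_domainA hγ hl hε₂)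
  obtain ⟨r₁, hr₁V, hr₁⟩ := ((eventually_descent_mem hγ.finite hl).and
    ((tendsto_descent (l := l)).eventually (Metric.ball_mem_nhds _ hη₂))).exists
  obtain ⟨q₁, hq₁V, hq₁⟩ : ∃ q₁ ∈ sectorAbove γ l, q₁ ∈ Metric.ball l η₂ :=
    ⟨descent l r₁, hr₁V, hr₁⟩
  have hflatA : IsFlatOn ℝ (pathConn z γ) (fun q => ΨA (γ q.1, γ q.2))
      (sectorAbove γ l ∩ Metric.ball l η₂) := flat_pair_comp hγ hA.1 fun q hq =>
    ⟨(hreg hq.1).1, (hreg hq.1).2.1, h2 q hq.2 hq.1⟩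
  obtain ⟨v, hv⟩ := hAu (γ q₁.1, γ q₁.2)
  refine ⟨↑v⁻¹ * G q₁, min ε₁ ε₂, lt_min hε₁ hε₂, Ψ5, ΨA, G, h5.mono (min_le_left _ _),
    hA.mono (min_le_right _ _), hG, ?_, ?_⟩
  · filter_upwards [self_mem_nhdsWithin, nhdsWithin_le_nhds (Metric.ball_mem_nhds _ hη₁)]
      with q hqV hq using hG5 q ⟨hqV, hq⟩
  · have hGA := flat_unique (hV.inter Metric.isOpen_ball)
      (convex_sectorAbove.inter (convex_ball _ _)) (hG.mono inter_subset_left)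
      (hflatA.mul_const (↑v⁻¹ * G q₁)) ⟨hq₁V, hq₁⟩ (by rw [← hv, ← mul_assoc, Units.mul_inv, one_mul])
    filter_upwards [self_mem_nhdsWithin, nhdsWithin_le_nhds (Metric.ball_mem_nhds _ hη₂)]
      with q hqV hq using hGA q ⟨hqV, hq⟩

end Factor

/-! ### Naturality -/

section Naturality

variable {L : Type*} [LieRing L] [LieAlgebra ℂ L] {L' : Type*} [LieRing L'] [LieAlgebra ℂ L']
  (π : L →ₗ⁅ℂ⁆ L')

theorem mapCompleted_one : mapCompleted π 1 = 1 :=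
  completedU_ext fun N => map_one (mapTrunc π N)

theorem mapCompleted_mul (x y : CompletedU L) :
    mapCompleted π (x * y) = mapCompleted π x * mapCompleted π y :=
  completedU_ext fun N => map_mul (mapTrunc π N) _ _

theorem mapCompleted_ofLie (y : L) : mapCompleted π (ofLie y) = ofLie (π y) := by
  refine completedU_ext fun N => ?_
  change Ideal.Quotient.mk _ (mapU π (UniversalEnvelopingAlgebra.ι ℂ y)) = Ideal.Quotient.mk _ _
  simp [mapU]

theorem mapCompleted_expLie (y : L) : mapCompleted π (expLie y) = expLie (π y) := by
  refine completedU_ext fun N => ?_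
  change Ideal.Quotient.mk _ (mapU π (∑ k ∈ Finset.range N, _)) = Ideal.Quotient.mk _ _
  simp [mapU]

theorem IsFlatOn.map {𝕜 : Type*} [NontriviallyNormedField 𝕜] [NormedAlgebra 𝕜 ℂ]
    {E : Type*} [NormedAddCommGroup E] [NormedSpace 𝕜 E] {A : E → E → L} {F : E → CompletedU L}
    {D : Set E} (h : IsFlatOn 𝕜 A F D) :
    IsFlatOn 𝕜 (fun p v => π (A p v)) (fun p => mapCompleted π (F p)) D := by
  intro p hp N c
  obtain ⟨F', hF', hF'h⟩ := h p hp N (c.comp (mapTrunc π N).toLinearMap)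
  refine ⟨F', hF', fun v => ?_⟩
  rw [hF'h, ← mapCompleted_ofLie, ← mapCompleted_mul]
  rfl

theorem IsHolomorphicOn.map {E : Type*} [NormedAddCommGroup E] [NormedSpace ℂ E]
    {f : E → CompletedU L} {D : Set E} (h : IsHolomorphicOn f D) :
    IsHolomorphicOn (fun p => mapCompleted π (f p)) D :=
  fun N c => h N (c.comp (mapTrunc π N).toLinearMap)

variable {n : ℕ} {z : Fin n → ℂ} {T : Fin n → L}

theorem map_conn1 (x h : ℂ) : π (conn1 z T x h) = conn1 z (fun k => π (T k)) x h := by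
  simp [conn1]

theorem IsLocalSolution.map {ε : ℝ} {Ψ : ℂ → CompletedU L} {P : BasePoint n}
    (h : IsLocalSolution z T ε Ψ P) :
    IsLocalSolution z (fun k => π (T k)) ε (fun x => mapCompleted π (Ψ x)) P := by
  cases P with
  | regular p =>
    exact ⟨(h.1.map π).congr_form fun _ _ _ => map_conn1 π _ _, by
      simp only [h.2, mapCompleted_one]⟩
  | tangential i v =>
    obtain ⟨h1, f, hf, hf0, hΨ⟩ := h
    refine ⟨(h1.map π).congr_form fun _ _ _ => map_conn1 π _ _, _, hf.map π, ?_, fun x hx => ?_⟩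
    · simp only [hf0, mapCompleted_one]
    · simp only [hΨ x hx, mapCompleted_mul, mapCompleted_expLie, map_smul]

theorem IsRegHol.map {δ : ℝ → ℂ} {c : ℝ} {P Q : BasePoint n} {H : CompletedU L}
    (h : IsRegHol z T δ c P Q H) :
    IsRegHol z (fun k => π (T k)) δ c P Q (mapCompleted π H) := by
  obtain ⟨ε, hε, ΨP, ΨQ, FP, FQ, hΨP, hΨQ, hFP, hFQ, hP, hQ, hPQ⟩ := h
  refine ⟨ε, hε, _, _, _, _, hΨP.map π, hΨQ.map π,
    (hFP.map π).congr_form fun _ _ _ => map_conn1 π _ _,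
    (hFQ.map π).congr_form fun _ _ _ => map_conn1 π _ _, ?_, ?_, fun t ht => ?_⟩
  · filter_upwards [hP] with t ht using by rw [ht]
  · filter_upwards [hQ] with t ht using by rw [ht]
  · rw [hPQ t ht, mapCompleted_mul]

theorem tendsto_mapCompleted [FiniteTrunc L] [FiniteTrunc L'] {X : Type*} {F : X → CompletedU L}
    {lf : Filter X} {N : ℕ} {x : CompletedU L}
    (h : Tendsto (fun r => (F r).1 N) lf (𝓝 (x.1 N))) :
    Tendsto (fun r => (mapCompleted π (F r)).1 N) lf (𝓝 ((mapCompleted π x).1 N)) :=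
  ((mapTrunc π N).toLinearMap.continuous_of_finiteDimensional.tendsto _).comp h

end Naturality

/-! ### Commuting connections -/

section Commutation

variable {n : ℕ} {z : Fin n → ℂ} {L : Type*} [LieRing L] [LieAlgebra ℂ L] [FiniteTrunc L]
  {T : Fin n → L} {i : Fin n} {v : ℂ} {δ : ℝ → ℂ} {c c' : ℝ}

/-- A tangentially normalized flat section commutes with everything its connection commutes
with. -/
theorem flat_commute (hδ : IsTangentialPath z i v δ c c') {ε : ℝ} (hε : 0 < ε)
    {Ψ : ℂ → CompletedU L} (hΨ : IsLocalSolution z T ε Ψ (BasePoint.tangential i v))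
    {F : ℝ → CompletedU L}
    (hF : IsFlatOn ℝ (fun t h => conn1 z T (δ t) (h * deriv δ t)) F (Ioo 0 c))
    (hP : ∀ᶠ t in 𝓝[>] (0 : ℝ), F t = Ψ (δ t)) {N : ℕ} {b : Trunc L N}
    (hb : ∀ k, Commute (toTrunc L N (T k)) b) : ∀ t ∈ Ioo 0 c, Commute ((F t).1 N) b := by
  have hbc : ∀ x h, Commute (toTrunc L N (conn1 z T x h)) b := by
    intro x h
    rw [conn1_eq_sum, map_sum]
    refine Commute.sum_left _ _ _ fun k _ => ?_
    rw [map_smul]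
    exact (hb k).smul_left _
  have key := tangential_eq_zero (T := T i) hδ.pos
    (F := fun t => (F t).1 N * b - b * (F t).1 N)
    (a := fun t => conn1 z T (δ t) (deriv δ t)) (fun t ht => by
      have h1 := hF.hasDerivAt_path (N := N) ht
      have h2 := (h1.mul_const b).sub (h1.const_mul b)
      have h3 : b * (toTrunc L N (conn1 z T (δ t) (deriv δ t)) * (F t).1 N) =
          toTrunc L N (conn1 z T (δ t) (deriv δ t)) * (b * (F t).1 N) := by
        rw [← mul_assoc, ← (hbc _ _).eq, mul_assoc]
      rw [h3, mul_assoc, ← mul_sub] at h2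
      exact h2) (by
      have h1 := tendsto_tangential hδ hε hΨ hP N
      have h2 := (h1.mul_const b).sub (h1.const_mul b)
      rw [one_mul, mul_one, sub_self] at h2
      refine h2.congr fun t => ?_
      have h3 : Commute ((tangFactor (T i) t).1 N) b := by
        refine expLie_commute ?_
        rw [map_neg, map_smul]
        exact ((hb i).smul_left _).neg_left
      rw [mul_val, sub_mul, mul_assoc, mul_assoc, mul_assoc, h3.eq])
  exact fun t ht => sub_eq_zero.1 (key t ht)

/-- The product of two flat sections in separate variables, the second one reversed, is flat for
the sum of the connections, provided that the first section commutes with the second connection. -/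
theorem isFlatOn_mul_of_commute {P P' : ℝ → CompletedU L} {a b : ℝ → L} {S S' : Set ℝ}
    {V : Set (ℝ × ℝ)} (hV : ∀ q ∈ V, q.1 ∈ S ∧ 1 - q.2 ∈ S')
    (hP : ∀ N, ∀ t ∈ S, HasDerivAt (fun t => (P t).1 N) (toTrunc L N (a t) * (P t).1 N) t)
    (hP' : ∀ N, ∀ t ∈ S', HasDerivAt (fun t => (P' t).1 N) (toTrunc L N (b t) * (P' t).1 N) t)
    (hcomm : ∀ N, ∀ t ∈ S, ∀ t' ∈ S', Commute ((P t).1 N) (toTrunc L N (b t'))) :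
    IsFlatOn ℝ (fun q h => (h.1 : ℂ) • a q.1 - (h.2 : ℂ) • b (1 - q.2))
      (fun q => P q.1 * P' (1 - q.2)) V := by
  refine isFlatOn_iff.2 fun q hq N => ?_
  obtain ⟨hq1, hq2⟩ := hV q hq
  have h1 : HasFDerivAt (fun q : ℝ × ℝ => (P q.1).1 N) _ q :=
    HasFDerivAt.comp (f := fun q : ℝ × ℝ => q.1) q (hP N _ hq1).hasFDerivAt hasFDerivAt_fst
  have h2 : HasFDerivAt (fun q : ℝ × ℝ => (P' (1 - q.2)).1 N) _ q :=
    HasFDerivAt.comp (f := fun q : ℝ × ℝ => 1 - q.2) q (hP' N _ hq2).hasFDerivAt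
      ((hasFDerivAt_snd (𝕜 := ℝ) (p := q)).const_sub 1)
  refine ⟨_, h1.mul' h2, fun h => ?_⟩
  have h3 := (hcomm N _ hq1 _ hq2).eq
  rw [mul_val, map_sub, map_smul, map_smul, sub_mul, smul_mul_assoc, smul_mul_assoc,
    ← mul_assoc (toTrunc L N (b (1 - q.2))), ← h3]
  simp only [add_apply, smul_apply, ContinuousLinearMap.comp_apply,
    ContinuousLinearMap.toSpanSingleton_apply, ContinuousLinearMap.coe_fst',
    ContinuousLinearMap.coe_snd', neg_apply, MulOpposite.smul_eq_mul_unop, MulOpposite.unop_op,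
    smul_eq_mul, Complex.coe_smul, neg_smul, mul_neg, smul_mul_assoc, mul_smul_comm, mul_assoc]
  abel

end Commutation

/-! ### The factorization in the quotient -/

section Factorization

variable {n : ℕ}

theorem proj_tzw : proj n tzw = 0 :=
  (LieSubmodule.Quotient.mk_eq_zero _).2 (LieSubmodule.subset_lieSpan rfl)

/-- Modulo `t_{zw}`, the two families of generators commute. -/
theorem proj_tz_lie_tw (k l : Fin n) : ⁅proj n (tz k), proj n (tw l)⁆ = 0 := by
  rw [← LieHom.map_lie]
  rcases eq_or_ne k l with rfl | h
  · rw [← tw_lie_tzw, LieHom.map_lie, proj_tzw, lie_zero]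
  · rw [tz_lie_tw h, map_zero]

theorem proj_tw_lie_tz (k l : Fin n) : ⁅proj n (tw k), proj n (tz l)⁆ = 0 := by
  rw [← lie_skew, proj_tz_lie_tw, neg_zero]

variable {z : Fin n → ℂ} {i j : Fin n} {vi vj : ℂ} {γ : ℝ → ℂ} {l : ℝ × ℝ}

/-- Modulo `t_{zw}`, the two-point connection is the sum of two commuting one-point connections. -/
theorem proj_pathConn (q h : ℝ × ℝ) : proj n (pathConn z γ q h) =
    conn1 z (fun k => proj n (tz k)) (γ q.1) (h.1 * deriv γ q.1) +
      conn1 z (fun k => proj n (tw k)) (γ q.2) (h.2 * deriv γ q.2) := by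
  simp [pathConn, conn2, conn1, proj_tzw, Finset.sum_add_distrib]

theorem tendsto_sub_nhdsLT (c : ℝ) {k : ℝ} (hk : 0 < k) :
    Tendsto (fun r : ℝ => c - k * r) (𝓝[>] 0) (𝓝[<] c) := by
  refine tendsto_nhdsWithin_iff.2 ⟨?_, ?_⟩
  · have : ContinuousAt (fun r : ℝ => c - k * r) 0 := by fun_prop
    simpa using this.tendsto.mono_left (nhdsWithin_le_nhds (s := Ioi 0))
  · filter_upwards [self_mem_nhdsWithin] with r hr
    have := mul_pos hk hr
    simp only [mem_Iio]
    linarith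

set_option maxHeartbeats 2000000 in
/-- Under the projection, `Ψ_{5,l+1}` becomes the product of the one-variable flat sections that compute
the two regularized holonomies, and `Ψ_{a,u}` becomes regular. -/
theorem proj_factor (hγ : IsAdmissiblePath z i j vi vj γ) (hl : l ∈ selfIntersections γ)
    {C : CompletedU (TLie n)} (hC : IsSelfIntersectionFactor z i j vi vj γ l C)
    {Hz Hw : CompletedU (TauLie n)}
    (hz : IsHolStart z (fun k => proj n (tz k)) i vi γ l.1 Hz)
    (hw : IsHolEnd z (fun k => proj n (tw k)) j vj γ l.2 Hw) :
    mapCompleted (proj n) C = Hz * Hw := by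
  have hl1 : l.1 ∈ Ioo (0 : ℝ) 1 := ⟨hl.1, hl.2.1.trans hl.2.2.1⟩
  have hl2 : l.2 ∈ Ioo (0 : ℝ) 1 := ⟨hl.1.trans hl.2.1, hl.2.2.1⟩
  have hδ := hγ.tangentialPath_start hl1
  have hδ' := hγ.tangentialPath_end hl2
  obtain ⟨ε, hε, Ψ5, ΨA, G, h5, hA, hG, hG5, hGA⟩ := hC
  obtain ⟨ε₁, hε₁, ΨP, ΨQ, P, Q, hΨP, hΨQ, hP, hQ, hP0, hQ0, hPQ⟩ := hz
  obtain ⟨ε₂, hε₂, ΨP', ΨQ', P', Q', hΨP', hΨQ', hP', hQ', hP0', hQ0', hPQ'⟩ := hw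
  obtain ⟨μ, hμ, hray⟩ := exists_ray hγ.finite hl
  -- the two flat sections commute with the coefficients of the other connection
  have hcw : ∀ N, ∀ t ∈ Ioo 0 l.1, ∀ k, Commute ((P t).1 N) (toTrunc _ N (proj n (tw k))) :=
    fun N t ht k => flat_commute hδ hε₁ hΨP hP hP0
      (fun m => toTrunc_commute N (proj_tz_lie_tw m k)) t ht
  have hcz : ∀ N, ∀ t ∈ Ioo 0 (1 - l.2), ∀ k,
      Commute ((P' t).1 N) (toTrunc _ N (proj n (tz k))) :=
    fun N t ht k => flat_commute hδ' hε₂ hΨP' hP' hP0'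
      (fun m => toTrunc_commute N (proj_tw_lie_tz m k)) t ht
  -- the part of the sector on which both one-variable sections are defined
  set V : Set (ℝ × ℝ) := sectorAbove γ l ∩ ({q | q.1 < l.1} ∩ {q | l.2 < q.2}) with hVdef
  have hV : IsOpen V := (isOpen_sectorAbove hγ.finite).inter
    ((isOpen_lt (by fun_prop) (by fun_prop)).inter (isOpen_lt (by fun_prop) (by fun_prop)))
  have hconv : Convex ℝ V := convex_sectorAbove.inter
    (((convex_Iio l.1).is_linear_preimage (IsLinearMap.mk (fun _ _ => rfl) fun _ _ => rfl :
        IsLinearMap ℝ (Prod.fst : ℝ × ℝ → ℝ))).inter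
      ((convex_Ioi l.2).is_linear_preimage (IsLinearMap.mk (fun _ _ => rfl) fun _ _ => rfl :
        IsLinearMap ℝ (Prod.snd : ℝ × ℝ → ℝ))))
  have hVm : ∀ q ∈ V, q.1 ∈ Ioo 0 l.1 ∧ 1 - q.2 ∈ Ioo 0 (1 - l.2) := by
    rintro q ⟨hq, hq1, hq2⟩
    have hq1 : q.1 < l.1 := hq1
    have hq2 : l.2 < q.2 := hq2
    exact ⟨⟨hq.1, hq1⟩, by linarith [hq.2.2.1], by linarith⟩
  -- the product of the two one-variable solutions is flat
  have hflat : IsFlatOn ℝ (fun q h => proj n (pathConn z γ q h))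
      (fun q => P q.1 * P' (1 - q.2)) V := by
    refine (isFlatOn_mul_of_commute hVm (fun N t ht => hP.hasDerivAt_path ht)
      (fun N t ht => hP'.hasDerivAt_path ht) fun N t ht t' _ => ?_).congr_form fun q _ h => ?_
    · rw [conn1_eq_sum, map_sum]
      refine Commute.sum_right _ _ _ fun k _ => ?_
      rw [map_smul]
      exact (hcw N _ ht k).smul_right _
    · have hd : deriv (fun t => γ (1 - t)) (1 - q.2) = -deriv γ q.2 := by
        rw [deriv_comp_const_sub, sub_sub_cancel]
      rw [proj_pathConn, conn1_mul, conn1_mul, hd, sub_sub_cancel, ← neg_one_mul (deriv γ q.2),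
        conn1_mul, neg_one_smul, smul_neg, sub_neg_eq_add]
  have hray' : ∀ᶠ r in 𝓝[>] (0 : ℝ), vertexRay μ r ∈ V := by
    have h1 : ∀ᶠ q : ℝ × ℝ in 𝓝 (0, 1), q.1 < l.1 ∧ l.2 < q.2 := by
      simp only [eventually_and]
      exact ⟨eventually_lt_of_continuous (by fun_prop) (by fun_prop) hl1.1,
        eventually_lt_of_continuous (by fun_prop) (by fun_prop) hl2.2⟩
    filter_upwards [hray, (tendsto_vertexRay μ).eventually h1] with r h2 h3
    exact ⟨h2, h3⟩
  have hdesc : ∀ᶠ r in 𝓝[>] (0 : ℝ), descent l r ∈ V := by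
    filter_upwards [eventually_descent_mem hγ.finite hl, self_mem_nhdsWithin] with r hr hr0
    have hr0 : 0 < r := hr0
    have hm : 0 < raySlope l := div_pos (sub_pos.2 hl2.2) hl.1
    refine ⟨hr, ?_, ?_⟩
    · change l.1 - r < l.1
      linarith
    · change l.2 < l.2 + (raySlope l + 1) * r
      have := mul_pos (add_pos hm one_pos) hr0
      linarith
  have hμr : Tendsto (fun r : ℝ => μ * r) (𝓝[>] 0) (𝓝[>] 0) := by
    refine tendsto_nhdsWithin_iff.2 ⟨?_, ?_⟩
    · have : ContinuousAt (fun r : ℝ => μ * r) 0 := by fun_prop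
      simpa using this.tendsto.mono_left (nhdsWithin_le_nhds (s := Ioi 0))
    · filter_upwards [self_mem_nhdsWithin] with r hr using mul_pos hμ hr
  have hπtang : ∀ (T : TLie n) t, mapCompleted (proj n) (tangFactor T t) =
      tangFactor (proj n T) t := fun T t => by
    simp only [tangFactor, mapCompleted_expLie, map_neg, map_smul]
  -- it has the asymptotics of the projection of `Ψ_5`
  have heq : ∀ q ∈ V, mapCompleted (proj n) (G q) = P q.1 * P' (1 - q.2) := by
    refine flat_eq_of_ray hV hconv hμ hray' ((hG.mono inter_subset_left).map (proj n)) hflat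
      (T := proj n (tz i)) (T' := proj n (tw j)) (fun N => ?_) (fun N => ?_)
    · have h1 := tendsto_mapCompleted (proj n) (x := 1)
        (tendsto_psi5_ray hγ sectorAbove_subset_regularPairs hray hε h5 hG5 N)
      simp only [mapCompleted_mul, hπtang, mapCompleted_one] at h1
      exact h1
    · have h1 := (tendsto_tangential hδ hε₁ hΨP hP0 N).mul
        ((tendsto_tangential hδ' hε₂ hΨP' hP0' N).comp hμr)
      rw [one_mul] at h1
      refine h1.congr' ?_
      filter_upwards [hray'] with r hr
      have h2 := (hVm _ hr).2
      have h3 : Commute ((P' (1 - (vertexRay μ r).2) * tangFactor (proj n (tw j)) (μ * r)).1 N)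
          ((tangFactor (proj n (tz i)) r).1 N) := by
        refine (expLie_commute ?_).symm
        rw [map_neg, map_smul, mul_val]
        refine ((Commute.mul_right (hcz N _ h2 i).symm ?_).smul_left _).neg_left
        refine (expLie_commute ?_).symm
        rw [map_neg, map_smul]
        exact ((toTrunc_commute N (proj_tw_lie_tz j i)).smul_left _).neg_left
      simp only [Function.comp_apply, ← mul_val]
      simp only [vertexRay, sub_sub_cancel] at h3 ⊢
      rw [mul_val, mul_val, mul_assoc, ← h3.eq]
      simp only [mul_val, mul_assoc]
  -- compare the limits at the self-intersection
  refine completedU_ext fun N => ?_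
  have hlim1 : Tendsto (fun r => (mapCompleted (proj n) (G (descent l r))).1 N) (𝓝[>] 0)
      (𝓝 ((mapCompleted (proj n) C).1 N)) := by
    have h1 := (tendsto_mapCompleted (proj n) (x := 1) (tendsto_psiA hγ hl hε hA N)).mul_const
      ((mapCompleted (proj n) C).1 N)
    rw [mapCompleted_one, one_val, one_mul] at h1
    refine h1.congr' ?_
    filter_upwards [(tendsto_descent_within hγ hl).eventually hGA] with r hr
    -- the singular factor of `Ψ_{a,u}` projects to `1`
    rw [hr, mapCompleted_mul, mapCompleted_mul, mapCompleted_expLie, map_neg, map_smul, proj_tzw,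
      smul_zero, neg_zero, expLie_zero, mul_one, mul_val]
  have hlim2 : Tendsto (fun r => (mapCompleted (proj n) (G (descent l r))).1 N) (𝓝[>] 0)
      (𝓝 ((Hz * Hw).1 N)) := by
    have hm : 0 < raySlope l + 1 := add_pos (div_pos (sub_pos.2 hl2.2) hl.1) one_pos
    have h1 := (tendsto_regular hδ hε₁ hΨQ hQ0 N).comp (tendsto_sub_nhdsLT l.1 one_pos)
    have h2 := (tendsto_regular hδ' hε₂ (by simpa using hΨQ') hQ0' N).comp
      (tendsto_sub_nhdsLT (1 - l.2) hm)
    have h3 := (h1.mul_const (Hz.1 N)).mul (h2.mul_const (Hw.1 N))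
    rw [one_mul, one_mul] at h3
    refine h3.congr' ?_
    filter_upwards [hdesc] with r hr
    obtain ⟨h4, h5⟩ := hVm _ hr
    rw [heq _ hr, hPQ _ h4, hPQ' _ h5]
    simp only [Function.comp_apply, ← mul_val]
    simp only [descent, one_mul, sub_sub]
  exact tendsto_nhds_unique hlim1 hlim2

end Factorization

/-! ### The kernel of the projection of truncations -/

section Kernel

variable {L : Type*} [LieRing L] [LieAlgebra ℂ L] {L' : Type*} [LieRing L'] [LieAlgebra ℂ L']
  {π : L →ₗ⁅ℂ⁆ L'}

theorem exists_lift_of_surjective {K : Type*} [LieRing K] [LieAlgebra ℂ K]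
    (hπ : Function.Surjective π) (g : L →ₗ⁅ℂ⁆ K) (hg : ∀ x, π x = 0 → g x = 0) :
    ∃ g' : L' →ₗ⁅ℂ⁆ K, ∀ x, g' (π x) = g x := by
  let s : L' → L := Function.surjInv hπ
  have hs : ∀ x, π (s x) = x := Function.surjInv_eq hπ
  have hgs : ∀ x w, π w = x → g w = g (s x) := fun x w hw => by
    rw [← sub_eq_zero, ← map_sub]
    exact hg _ (by rw [map_sub, hw, hs, sub_self])
  refine ⟨{ toFun := fun x => g (s x), map_add' := fun a b => ?_, map_smul' := fun c a => ?_,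
            map_lie' := fun {a b} => ?_ }, fun x => (hgs _ x rfl).symm⟩
  · rw [← hgs (a + b) (s a + s b) (by rw [map_add, hs, hs]), map_add]
  · rw [← hgs (c • a) (c • s a) (by rw [map_smul, hs]), map_smul]
    rfl
  · rw [← hgs ⁅a, b⁆ ⁅s a, s b⁆ (by rw [LieHom.map_lie, hs, hs]), LieHom.map_lie]

/-- A morphism that vanishes on `S` vanishes on the Lie ideal generated by `S`. -/
theorem map_eq_zero_of_mem_lieSpan {K : Type*} [LieRing K] [LieAlgebra ℂ K] (g : L →ₗ⁅ℂ⁆ K)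
    {S : Set L} (hS : ∀ y ∈ S, g y = 0) {x : L}
    (hx : x ∈ (LieSubmodule.lieSpan ℂ L S : LieIdeal ℂ L)) : g x = 0 := by
  have h : (LieSubmodule.lieSpan ℂ L S : LieIdeal ℂ L) ≤ g.ker := by
    rw [LieSubmodule.lieSpan_le]
    exact fun y hy => LieHom.mem_ker.2 (hS y hy)
  exact LieHom.mem_ker.1 (h hx)

theorem mapU_surjective (hπ : Function.Surjective π) : Function.Surjective (mapU π) := by
  rw [← AlgHom.range_eq_top, eq_top_iff, ← adjoin_range_ι_eq_top (g := fun y : L' => y)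
    (eq_top_iff.2 fun x _ => LieSubalgebra.subset_lieSpan ⟨x, rfl⟩), Algebra.adjoin_le_iff]
  rintro _ ⟨y, rfl⟩
  obtain ⟨x, rfl⟩ := hπ y
  exact ⟨UniversalEnvelopingAlgebra.ι ℂ x, by simp [mapU]⟩

theorem augIdeal_pow_le_map (hπ : Function.Surjective π) (N : ℕ) :
    augIdeal L' ^ N ≤ (augIdeal L ^ N).map (mapU π) := by
  have hs := mapU_surjective hπ
  induction N with
  | zero =>
    intro x _
    obtain ⟨y, rfl⟩ := hs x
    exact Ideal.mem_map_of_mem _ (by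
      simp only [Submodule.pow_zero, Ideal.one_eq_top, Submodule.mem_top])
  | succ N ih =>
    rw [Submodule.pow_succ, Submodule.pow_succ, Ideal.mul_le]
    intro r hr s hsm
    obtain ⟨r, hr', rfl⟩ := (Ideal.mem_map_iff_of_surjective _ hs).1 (ih hr)
    obtain ⟨s, rfl⟩ := hs s
    rw [← map_mul]
    refine Ideal.mem_map_of_mem _ (Ideal.mul_mem_mul hr' ?_)
    have h := DFunLike.congr_fun (counit_comp_mapU π) s
    simp only [augIdeal, RingHom.mem_ker] at hsm ⊢
    exact h.symm.trans hsm

/-- The kernel of the map of truncations induced by the quotient by the Lie ideal generated by `y`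
is contained in the two-sided ideal generated by `y`: both have the same universal property. -/
theorem mem_span_of_mapTrunc_eq_zero {y : L} (hπ : Function.Surjective π)
    (hker : ∀ x, π x = 0 → x ∈ (LieSubmodule.lieSpan ℂ L {y} : LieIdeal ℂ L)) {N : ℕ}
    {x : Trunc L N} (hx : mapTrunc π N x = 0) : x ∈ TwoSidedIdeal.span {(ofLie y).1 N} := by
  set J := TwoSidedIdeal.span {(ofLie y).1 N}
  let q : Trunc L N →ₐ[ℂ] Trunc L N ⧸ J.asIdeal := Ideal.Quotient.mkₐ ℂ J.asIdeal
  have hq : ∀ x, q x = 0 ↔ x ∈ J := fun x => by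
    rw [← TwoSidedIdeal.mem_asIdeal]
    exact Ideal.Quotient.eq_zero_iff_mem
  let p : UniversalEnvelopingAlgebra ℂ L →ₐ[ℂ] Trunc L N := Ideal.Quotient.mkₐ ℂ (augIdeal L ^ N)
  let g : L →ₗ⁅ℂ⁆ Trunc L N ⧸ J.asIdeal :=
    ((q.comp p : UniversalEnvelopingAlgebra ℂ L →ₐ[ℂ] _) : _ →ₗ⁅ℂ⁆ _).comp
      (UniversalEnvelopingAlgebra.ι ℂ)
  have hgy : g y = 0 := (hq _).2 (TwoSidedIdeal.subset_span rfl)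
  have hg : ∀ x, π x = 0 → g x = 0 := fun x hx =>
    map_eq_zero_of_mem_lieSpan g (by rintro _ rfl; exact hgy) (hker x hx)
  obtain ⟨g', hg'⟩ := exists_lift_of_surjective hπ g hg
  have hcomp : (UniversalEnvelopingAlgebra.lift ℂ g').comp (mapU π) = q.comp p := by
    apply UniversalEnvelopingAlgebra.hom_ext
    ext w
    simp only [LieHom.comp_apply, AlgHom.coe_toLieHom, AlgHom.comp_apply, mapU,
      UniversalEnvelopingAlgebra.lift_ι_apply]
    exact hg' w
  obtain ⟨u, rfl⟩ := Ideal.Quotient.mk_surjective x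
  have hu : mapU π u ∈ augIdeal L' ^ N := Ideal.Quotient.eq_zero_iff_mem.1 hx
  -- a representative can be changed by an element of `I ^ N` to lie in the kernel of `U(L) → U(L')`
  obtain ⟨v, hv, hvu⟩ := (Ideal.mem_map_iff_of_surjective _ (mapU_surjective hπ)).1
    (augIdeal_pow_le_map hπ N hu)
  have hpv : p v = 0 := Ideal.Quotient.eq_zero_iff_mem.2 hv
  have h1 : q (p u) = q (p v) := by
    rw [← AlgHom.comp_apply, ← AlgHom.comp_apply, ← hcomp, AlgHom.comp_apply, AlgHom.comp_apply]
    congr 1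
    exact hvu.symm
  rw [hpv, map_zero] at h1
  exact (hq _).1 h1

end Kernel

/-! ### The factorization modulo the ideal of the additional generator -/

section

variable {n : ℕ} {z : Fin n → ℂ} {i j : Fin n} {vi vj : ℂ} {γ : ℝ → ℂ} {l : ℝ × ℝ}

/-- The difference lies in the kernel of the projection, by naturality of the regularized holonomy. -/
theorem isBigOLie_factor (hγ : IsAdmissiblePath z i j vi vj γ) (hl : l ∈ selfIntersections γ)
    {C Hz Hw : CompletedU (TLie n)} (hC : IsSelfIntersectionFactor z i j vi vj γ l C)
    (hz : IsHolStart z tz i vi γ l.1 Hz) (hw : IsHolEnd z tw j vj γ l.2 Hw) :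
    IsBigOLie (C - Hz * Hw) (tzw (n := n)) := by
  intro N
  refine mem_span_of_mapTrunc_eq_zero (proj_surjective n)
    (fun x hx => (LieSubmodule.Quotient.mk_eq_zero _).1 hx) ?_
  have h := proj_factor hγ hl hC (hz.map (proj n)) (hw.map (proj n))
  have h' := congrArg (fun x : CompletedU (TauLie n) => x.1 N) h
  rw [← mapCompleted_mul] at h'
  rw [sub_val, map_sub]
  exact sub_eq_zero.2 h'

end

/-! ### Derivations of free Lie algebras -/

section Derivation

/-- The Lie algebra `L ⊗ ℂ[ε]` of dual numbers over `L`: the pair `(a, x)` stands for `a + ε x`. -/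
def DualLie (L : Type*) : Type _ := L × L

variable {L : Type*}

/-- The element `a + ε x`. -/
def DualLie.mk (a x : L) : DualLie L := (a, x)

theorem DualLie.ext {p q : DualLie L} (h₁ : p.1 = q.1) (h₂ : p.2 = q.2) : p = q := Prod.ext h₁ h₂

variable [LieRing L]

instance : AddCommGroup (DualLie L) := inferInstanceAs (AddCommGroup (L × L))

instance : Bracket (DualLie L) (DualLie L) where
  bracket p q := DualLie.mk ⁅p.1, q.1⁆ (⁅p.1, q.2⁆ + ⁅p.2, q.1⁆)

theorem DualLie.lie_fst (p q : DualLie L) : ⁅p, q⁆.1 = ⁅p.1, q.1⁆ := rfl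

theorem DualLie.lie_snd (p q : DualLie L) : ⁅p, q⁆.2 = ⁅p.1, q.2⁆ + ⁅p.2, q.1⁆ := rfl

theorem DualLie.add_fst (p q : DualLie L) : (p + q).1 = p.1 + q.1 := rfl

theorem DualLie.add_snd (p q : DualLie L) : (p + q).2 = p.2 + q.2 := rfl

instance : LieRing (DualLie L) where
  add_lie p q r := DualLie.ext (add_lie _ _ _) (by
    simp only [DualLie.lie_snd, DualLie.add_fst, DualLie.add_snd, add_lie]; abel)
  lie_add p q r := DualLie.ext (lie_add _ _ _) (by
    simp only [DualLie.lie_snd, DualLie.add_fst, DualLie.add_snd, lie_add]; abel)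
  lie_self p := DualLie.ext (lie_self _) (by
    rw [DualLie.lie_snd, ← lie_skew, neg_add_cancel]; rfl)
  leibniz_lie p q r := DualLie.ext (leibniz_lie _ _ _) (by
    simp only [DualLie.lie_snd, DualLie.lie_fst, DualLie.add_snd, lie_add, add_lie,
      leibniz_lie p.1 q.1, leibniz_lie p.1 q.2, leibniz_lie p.2 q.1]
    abel)

variable [LieAlgebra ℂ L]

instance : Module ℂ (DualLie L) := inferInstanceAs (Module ℂ (L × L))

theorem DualLie.smul_fst (c : ℂ) (p : DualLie L) : (c • p).1 = c • p.1 := rfl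

theorem DualLie.smul_snd (c : ℂ) (p : DualLie L) : (c • p).2 = c • p.2 := rfl

instance : LieAlgebra ℂ (DualLie L) where
  lie_smul c p q := DualLie.ext (lie_smul _ _ _) (by
    simp only [DualLie.lie_snd, DualLie.smul_fst, DualLie.smul_snd, lie_smul, smul_add])

variable {X : Type*}

/-- The morphism `a ↦ a + ε D a`, where `D` is the derivation with the values `d` on generators. -/
def dualLift (d : X → FreeLieAlgebra ℂ X) :
    FreeLieAlgebra ℂ X →ₗ⁅ℂ⁆ DualLie (FreeLieAlgebra ℂ X) :=
  FreeLieAlgebra.lift ℂ fun x => DualLie.mk (FreeLieAlgebra.of ℂ x) (d x)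

theorem dualLift_fst (d : X → FreeLieAlgebra ℂ X) (a : FreeLieAlgebra ℂ X) :
    (dualLift d a).1 = a := by
  let f : DualLie (FreeLieAlgebra ℂ X) →ₗ⁅ℂ⁆ FreeLieAlgebra ℂ X :=
    { toFun := Prod.fst
      map_add' := fun _ _ => rfl
      map_smul' := fun _ _ => rfl
      map_lie' := rfl }
  have h : f.comp (dualLift d) = LieHom.id := by
    ext x
    simp only [LieHom.comp_apply, dualLift, FreeLieAlgebra.lift_of_apply]
    rfl
  exact LieHom.congr_fun h a

/-- The derivation of a free Lie algebra with prescribed values on the generators. -/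
def freeDerivation (d : X → FreeLieAlgebra ℂ X) :
    LieDerivation ℂ (FreeLieAlgebra ℂ X) (FreeLieAlgebra ℂ X) where
  toFun a := (dualLift d a).2
  map_add' a b := by rw [map_add]; rfl
  map_smul' c a := by rw [map_smul]; rfl
  leibniz' a b := by
    change (dualLift d ⁅a, b⁆).2 = ⁅a, (dualLift d b).2⁆ - ⁅b, (dualLift d a).2⁆
    rw [LieHom.map_lie, DualLie.lie_snd, dualLift_fst, dualLift_fst, ← lie_skew b, sub_neg_eq_add]

theorem freeDerivation_of (d : X → FreeLieAlgebra ℂ X) (x : X) :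
    freeDerivation d (FreeLieAlgebra.of ℂ x) = d x := by
  change (dualLift d (FreeLieAlgebra.of ℂ x)).2 = d x
  rw [dualLift, FreeLieAlgebra.lift_of_apply, DualLie.mk]

theorem freeDerivation_ext {D₁ D₂ : LieDerivation ℂ (FreeLieAlgebra ℂ X) (FreeLieAlgebra ℂ X)}
    (h : ∀ x, D₁ (FreeLieAlgebra.of ℂ x) = D₂ (FreeLieAlgebra.of ℂ x)) : D₁ = D₂ :=
  LieDerivation.ext_of_lieSpan_eq_top _ (freeLie_lieSpan_eq_top X) (by
    rintro _ ⟨x, rfl⟩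
    exact h x)

end Derivation

/-! ### Infinitesimal braids acting on a free Lie algebra -/

section Braid

variable {X : Type*} [DecidableEq X]

/-- The infinitesimal braiding of the generators `x_k` and `x_l`: the derivation that annihilates
`x_k + x_l` and the other generators, and sends `x_l` to `⁅x_l, x_k⁆`. -/
def braidDer (k l : X) : LieDerivation ℂ (FreeLieAlgebra ℂ X) (FreeLieAlgebra ℂ X) :=
  freeDerivation fun m =>
    if m = l then ⁅FreeLieAlgebra.of ℂ l, FreeLieAlgebra.of ℂ k⁆
    else if m = k then ⁅FreeLieAlgebra.of ℂ k, FreeLieAlgebra.of ℂ l⁆ else 0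

theorem braidDer_of (k l m : X) : braidDer k l (FreeLieAlgebra.of ℂ m) =
    if m = l then ⁅FreeLieAlgebra.of ℂ l, FreeLieAlgebra.of ℂ k⁆
    else if m = k then ⁅FreeLieAlgebra.of ℂ k, FreeLieAlgebra.of ℂ l⁆ else 0 :=
  freeDerivation_of _ m

theorem braidDer_self (k : X) : braidDer k k = 0 :=
  freeDerivation_ext fun m => by
    rw [braidDer_of, lie_self, ite_self, ite_self, LieDerivation.zero_apply]

theorem braidDer_symm (k l : X) : braidDer k l = braidDer l k :=
  freeDerivation_ext fun m => by
    rw [braidDer_of, braidDer_of]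
    split_ifs <;> simp_all

theorem braidDer_lie_of_distinct {a b c d : X} (hac : a ≠ c) (had : a ≠ d)
    (hbc : b ≠ c) (hbd : b ≠ d) : ⁅braidDer a b, braidDer c d⁆ = 0 :=
  freeDerivation_ext fun m => by
    rw [LieDerivation.lie_apply, LieDerivation.zero_apply, braidDer_of c d, braidDer_of a b]
    split_ifs <;> simp_all [LieDerivation.apply_lie_eq_sub, braidDer_of, Ne.symm]

/-- On the generator `x_b` this is the Jacobi identity for `x_a`, `x_b`, `x_c`, and likewise for `x_c`. -/
theorem braidDer_add_lie {a b c : X} (hab : a ≠ b) (hac : a ≠ c) (hbc : b ≠ c) :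
    ⁅braidDer a b + braidDer a c, braidDer b c⁆ = 0 :=
  freeDerivation_ext fun m => by
    simp only [LieDerivation.lie_apply, LieDerivation.zero_apply, LieDerivation.add_apply,
      braidDer_of]
    have hba := hab.symm
    have hca := hac.symm
    have hcb := hbc.symm
    by_cases h1 : m = a
    · subst h1
      simp [LieDerivation.apply_lie_eq_sub, braidDer_of, *]
    by_cases h2 : m = b
    · subst h2
      simp [LieDerivation.apply_lie_eq_sub, braidDer_of, *]
      rw [leibniz_lie (FreeLieAlgebra.of ℂ m) (FreeLieAlgebra.of ℂ a),
        ← lie_skew ⁅FreeLieAlgebra.of ℂ m, FreeLieAlgebra.of ℂ a⁆]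
      abel
    by_cases h3 : m = c
    · subst h3
      simp [LieDerivation.apply_lie_eq_sub, braidDer_of, *]
      rw [leibniz_lie (FreeLieAlgebra.of ℂ m) (FreeLieAlgebra.of ℂ a),
        ← lie_skew ⁅FreeLieAlgebra.of ℂ m, FreeLieAlgebra.of ℂ a⁆]
      abel
    simp [h1, h2, h3]

/-- The values on the generators `t_{ab}` of the action of the infinitesimal braids on the free Lie
algebra `f` on `X`, with values in `f ⋊ Der f`. The strands are `none`, which is forgotten,
`some none`, the moving strand, and `some (some k)`, the marked points. -/
def braidValue : Option (Option X) → Option (Option X) →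
    LieAlgebra.SemiDirectSum (FreeLieAlgebra ℂ X)
      (LieDerivation ℂ (FreeLieAlgebra ℂ X) (FreeLieAlgebra ℂ X)) LieHom.id
  | some none, some (some k) => ⟨FreeLieAlgebra.of ℂ k, 0⟩
  | some (some k), some none => ⟨FreeLieAlgebra.of ℂ k, 0⟩
  | some (some k), some (some l) => ⟨0, braidDer k l⟩
  | _, _ => 0

theorem braidValue_self (a : Option (Option X)) : braidValue a a = 0 := by
  rcases a with _ | _ | k
  · rfl
  · rfl
  · simp only [braidValue, braidDer_self]; rfl

theorem braidValue_symm (a b : Option (Option X)) : braidValue a b = braidValue b a := by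
  rcases a with _ | _ | k <;> rcases b with _ | _ | l <;> try rfl
  simp only [braidValue, braidDer_symm k l]

theorem braidValue_lie_of_distinct {a b c d : Option (Option X)} (hab : a ≠ b) (hac : a ≠ c)
    (had : a ≠ d) (hbc : b ≠ c) (hbd : b ≠ d) (hcd : c ≠ d) :
    ⁅braidValue a b, braidValue c d⁆ = 0 := by
  rcases a with _ | _ | a <;> rcases b with _ | _ | b <;> rcases c with _ | _ | c <;>
    rcases d with _ | _ | d <;>
    simp_all [braidValue, braidDer_of, braidDer_lie_of_distinct, Ne.symm]

/-- The cases with the moving strand hold by the choice of the derivations `braidDer`. -/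
theorem braidValue_add_lie {a b c : Option (Option X)} (hab : a ≠ b) (hac : a ≠ c)
    (hbc : b ≠ c) : ⁅braidValue a b + braidValue a c, braidValue b c⁆ = 0 := by
  rcases a with _ | _ | a <;> rcases b with _ | _ | b <;> rcases c with _ | _ | c <;>
    simp_all [braidValue, braidDer_of]
  iterate 3 rw [← lie_skew, neg_add_cancel]
  rw [← add_lie]
  exact braidDer_add_lie hab hac hbc

end Braid

/-! ### The product of two free Lie algebras inside the quotient -/

section Product

variable {n : ℕ}

/-- The action of the infinitesimal braids, for a labelling `c` of the strands. -/
theorem exists_braidHom (c : Strand n → Option (Option (Fin n))) (hc : Function.Injective c) :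
    ∃ ρ : TLie n →ₗ⁅ℂ⁆ _, ∀ a b, ρ (gen a b) = braidValue (c a) (c b) := by
  let f := FreeLieAlgebra.lift ℂ fun p : Strand n × Strand n => braidValue (c p.1) (c p.2)
  have hf : ∀ p, f (FreeLieAlgebra.of ℂ p) = braidValue (c p.1) (c p.2) := fun p =>
    FreeLieAlgebra.lift_of_apply _ p
  obtain ⟨ρ, hρ⟩ := exists_lift_of_surjective (toDK_surjective (Strand n)) f fun x hx =>
    map_eq_zero_of_mem_lieSpan f (S := {x | DKRel (Strand n) x}) (by
      intro y hy
      induction hy with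
      | diag i => rw [hf, braidValue_self]
      | symm i j => rw [map_sub, hf, hf, braidValue_symm, sub_self]
      | comm i j k l hij hik hil hjk hjl hkl =>
        rw [LieHom.map_lie, hf, hf]
        exact braidValue_lie_of_distinct (hc.ne hij) (hc.ne hik) (hc.ne hil) (hc.ne hjk)
          (hc.ne hjl) (hc.ne hkl)
      | triple i j k hij hik hjk =>
        rw [LieHom.map_lie, map_add, hf, hf, hf]
        exact braidValue_add_lie (hc.ne hij) (hc.ne hik) (hc.ne hjk))
      ((LieSubmodule.Quotient.mk_eq_zero _).1 hx)
  exact ⟨ρ, fun a b => (hρ _).trans (hf (a, b))⟩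

/-- The labelling of the strands for which `z` moves and `w` is forgotten. -/
def labelZ : Strand n → Option (Option (Fin n))
  | .pt k => some (some k)
  | .z => some none
  | .w => none

/-- The labelling of the strands for which `w` moves and `z` is forgotten. -/
def labelW : Strand n → Option (Option (Fin n))
  | .pt k => some (some k)
  | .z => none
  | .w => some none

theorem labelZ_injective : Function.Injective (labelZ (n := n)) := by
  rintro (k | _ | _) (l | _ | _) h <;> simp_all [labelZ]

theorem labelW_injective : Function.Injective (labelW (n := n)) := by
  rintro (k | _ | _) (l | _ | _) h <;> simp_all [labelW]

/-- A braid action that kills `t_{zw}` descends to the quotient. -/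
theorem exists_tauHom (c : Strand n → Option (Option (Fin n))) (hc : Function.Injective c)
    (h0 : braidValue (c .z) (c .w) = 0) :
    ∃ ρ : TauLie n →ₗ⁅ℂ⁆ _, ∀ a b, ρ (proj n (gen a b)) = braidValue (c a) (c b) := by
  obtain ⟨ρ, hρ⟩ := exists_braidHom c hc
  obtain ⟨ρ', hρ'⟩ := exists_lift_of_surjective (proj_surjective n) ρ fun x hx =>
    map_eq_zero_of_mem_lieSpan ρ (S := {tzw}) (by rintro _ rfl; rw [tzw, hρ, h0])
      ((LieSubmodule.Quotient.mk_eq_zero _).1 hx)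
  exact ⟨ρ', fun a b => (hρ' _).trans (hρ a b)⟩

/-- The morphism from the free Lie algebra to the quotient, given by the generators `t_{kz}`. -/
def freeZ (n : ℕ) : FreeLieAlgebra ℂ (Fin n) →ₗ⁅ℂ⁆ TauLie n :=
  FreeLieAlgebra.lift ℂ fun k => proj n (tz k)

/-- The morphism from the free Lie algebra to the quotient, given by the generators `t_{kw}`. -/
def freeW (n : ℕ) : FreeLieAlgebra ℂ (Fin n) →ₗ⁅ℂ⁆ TauLie n :=
  FreeLieAlgebra.lift ℂ fun k => proj n (tw k)

theorem freeZ_of (k : Fin n) : freeZ n (FreeLieAlgebra.of ℂ k) = proj n (tz k) :=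
  FreeLieAlgebra.lift_of_apply _ k

theorem freeW_of (k : Fin n) : freeW n (FreeLieAlgebra.of ℂ k) = proj n (tw k) :=
  FreeLieAlgebra.lift_of_apply _ k

theorem mem_of_forall_of {X : Type*}
    (S : LieSubalgebra ℂ (FreeLieAlgebra ℂ X)) (hS : ∀ x, FreeLieAlgebra.of ℂ x ∈ S)
    (a : FreeLieAlgebra ℂ X) : a ∈ S := by
  have h : LieSubalgebra.lieSpan ℂ _ (range (FreeLieAlgebra.of ℂ)) ≤ S :=
    LieSubalgebra.lieSpan_le.2 (by rintro _ ⟨x, rfl⟩; exact hS x)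
  exact h (by rw [freeLie_lieSpan_eq_top]; trivial)

/-- The elements whose image under `f` commutes with `y`. -/
def commutant {L L' : Type*} [LieRing L] [LieAlgebra ℂ L] [LieRing L'] [LieAlgebra ℂ L']
    (f : L →ₗ⁅ℂ⁆ L') (y : L') : LieSubalgebra ℂ L where
  carrier := {a | ⁅f a, y⁆ = 0}
  add_mem' := fun {a b} ha hb => by
    simp only [mem_ofPred_eq] at *
    rw [map_add, add_lie, ha, hb, add_zero]
  zero_mem' := by simp
  smul_mem' := fun c a ha => by
    simp only [mem_ofPred_eq] at *
    rw [map_smul, smul_lie, ha, smul_zero]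
  lie_mem' := fun {a b} ha hb => by
    simp only [mem_ofPred_eq] at *
    rw [LieHom.map_lie, lie_lie, (show ⁅f b, y⁆ = 0 from hb), (show ⁅f a, y⁆ = 0 from ha), lie_zero,
      lie_zero, sub_zero]

theorem freeZ_lie_freeW (a b : FreeLieAlgebra ℂ (Fin n)) : ⁅freeZ n a, freeW n b⁆ = 0 := by
  have h1 : ∀ k a, ⁅freeZ n a, proj n (tw k)⁆ = 0 := fun k a =>
    mem_of_forall_of (commutant (freeZ n) (proj n (tw k))) (fun x => by
      change ⁅freeZ n _, _⁆ = 0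
      rw [freeZ_of, proj_tz_lie_tw]) a
  have h2 : ⁅freeW n b, freeZ n a⁆ = 0 :=
    mem_of_forall_of (commutant (freeW n) (freeZ n a)) (fun x => by
      change ⁅freeW n _, _⁆ = 0
      rw [freeW_of, ← lie_skew, h1, neg_zero]) b
  rw [← lie_skew, h2, neg_zero]

/-- The sum of the two commuting morphisms from the free Lie algebra. -/
def freeProd (n : ℕ) :
    FreeLieAlgebra ℂ (Fin n) × FreeLieAlgebra ℂ (Fin n) →ₗ⁅ℂ⁆ TauLie n where
  toFun p := freeZ n p.1 + freeW n p.2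
  map_add' p q := by
    rw [Prod.fst_add, Prod.snd_add, map_add, map_add]; abel
  map_smul' c p := by
    rw [Prod.smul_fst, Prod.smul_snd, map_smul, map_smul, ← smul_add]; rfl
  map_lie' := fun {p q} => by
    change freeZ n ⁅p.1, q.1⁆ + freeW n ⁅p.2, q.2⁆ = _
    rw [LieHom.map_lie, LieHom.map_lie, add_lie, lie_add, lie_add, freeZ_lie_freeW,
      ← lie_skew (freeW n p.2) (freeZ n q.1), freeZ_lie_freeW, neg_zero, add_zero, zero_add]

theorem freeProd_apply (p : FreeLieAlgebra ℂ (Fin n) × FreeLieAlgebra ℂ (Fin n)) :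
    freeProd n p = freeZ n p.1 + freeW n p.2 := rfl

/-- The action for which `z` moves and `w` is forgotten recovers the first component in the ideal `f` of
`f ⋊ Der f`, and annihilates the image of the second one; symmetrically for `w`. -/
theorem freeProd_injective (n : ℕ) : Function.Injective (freeProd n) := by
  obtain ⟨ρ, hρ⟩ := exists_tauHom (labelZ (n := n)) labelZ_injective rfl
  obtain ⟨σ, hσ⟩ := exists_tauHom (labelW (n := n)) labelW_injective rfl
  have h1 : ρ.comp (freeZ n) = LieAlgebra.SemiDirectSum.inl _ := by
    ext1 k
    rw [LieHom.comp_apply, freeZ_of, tz, hρ]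
    rfl
  have h2 : ρ.comp (freeW n) = 0 := by
    ext1 k
    rw [LieHom.comp_apply, freeW_of, tw, hρ]
    rfl
  have h3 : σ.comp (freeZ n) = 0 := by
    ext1 k
    rw [LieHom.comp_apply, freeZ_of, tz, hσ]
    rfl
  have h4 : σ.comp (freeW n) = LieAlgebra.SemiDirectSum.inl _ := by
    ext1 k
    rw [LieHom.comp_apply, freeW_of, tw, hσ]
    rfl
  refine (injective_iff_map_eq_zero (freeProd n)).2 fun p hp => ?_
  have h5 := congrArg ρ hp
  have h6 := congrArg σ hp
  rw [freeProd_apply, map_add, map_zero, ← LieHom.comp_apply, ← LieHom.comp_apply, h1, h2,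
    LieHom.zero_apply, add_zero] at h5
  rw [freeProd_apply, map_add, map_zero, ← LieHom.comp_apply, ← LieHom.comp_apply, h3, h4,
    LieHom.zero_apply, zero_add] at h6
  exact Prod.ext (congrArg LieAlgebra.SemiDirectSum.left h5)
    (congrArg LieAlgebra.SemiDirectSum.left h6)

theorem freeProd_range (n : ℕ) : (freeProd n).range = LieSubalgebra.lieSpan ℂ (TauLie n)
    (range (fun k => proj n (tz k)) ∪ range (fun k => proj n (tw k))) := by
  refine le_antisymm ?_ (LieSubalgebra.lieSpan_le.2 ?_)
  · set S := LieSubalgebra.lieSpan ℂ (TauLie n)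
      (range (fun k => proj n (tz k)) ∪ range (fun k => proj n (tw k)))
    rintro _ ⟨p, rfl⟩
    refine S.add_mem ?_ ?_
    · exact mem_of_forall_of (S.comap (freeZ n)) (fun k => LieSubalgebra.subset_lieSpan
        (Or.inl ⟨k, (freeZ_of k).symm⟩)) p.1
    · exact mem_of_forall_of (S.comap (freeW n)) (fun k => LieSubalgebra.subset_lieSpan
        (Or.inr ⟨k, (freeW_of k).symm⟩)) p.2
  · rintro _ (⟨k, rfl⟩ | ⟨k, rfl⟩)
    · exact ⟨(FreeLieAlgebra.of ℂ k, 0), by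
        change freeZ n _ + freeW n 0 = _
        rw [freeZ_of, map_zero, add_zero]⟩
    · exact ⟨(0, FreeLieAlgebra.of ℂ k), by
        change freeZ n 0 + freeW n _ = _
        rw [freeW_of, map_zero, zero_add]⟩

end Product

end KZ

end

theorem mainTheorem2 (n : ℕ) (z : Fin n → ℂ) (hz : Function.Injective z)
    (i j : Fin n) (hij : i ≠ j) (vi vj : ℂ) (γ : ℝ → ℂ)
    (hγ : KZ.IsAdmissiblePath z i j vi vj γ)
    (tl sl : ℝ) (hl : (tl, sl) ∈ KZ.selfIntersections γ) :
    -- the images of the `t_{k,z}` and the `t_{k,w}` generate `f_z ⊕ f_w` in the quotient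
    (∃ φ : FreeLieAlgebra ℂ (Fin n) × FreeLieAlgebra ℂ (Fin n) →ₗ⁅ℂ⁆ KZ.TauLie n,
      Function.Injective φ ∧
      (∀ k, φ (FreeLieAlgebra.of ℂ k, 0) = KZ.proj n (KZ.tz k)) ∧
      (∀ k, φ (0, FreeLieAlgebra.of ℂ k) = KZ.proj n (KZ.tw k)) ∧
      φ.range = LieSubalgebra.lieSpan ℂ (KZ.TauLie n)
        (Set.range (fun k => KZ.proj n (KZ.tz k)) ∪
          Set.range (fun k => KZ.proj n (KZ.tw k)))) ∧
    -- the factor and the four regularized holonomies exist and are unique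
    (∃! C, KZ.IsSelfIntersectionFactor z i j vi vj γ (tl, sl) C) ∧
    (∃! H, KZ.IsHolStart z (fun k => KZ.proj n (KZ.tz k)) i vi γ tl H) ∧
    (∃! H, KZ.IsHolEnd z (fun k => KZ.proj n (KZ.tw k)) j vj γ sl H) ∧
    (∃! H, KZ.IsHolStart z (KZ.tz (n := n)) i vi γ tl H) ∧
    (∃! H, KZ.IsHolEnd z (KZ.tw (n := n)) j vj γ sl H) ∧
    -- the factorization in the quotient, and modulo `O(t_{zw})`
    (∀ C, KZ.IsSelfIntersectionFactor z i j vi vj γ (tl, sl) C →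
      (∀ Hz Hw, KZ.IsHolStart z (fun k => KZ.proj n (KZ.tz k)) i vi γ tl Hz →
        KZ.IsHolEnd z (fun k => KZ.proj n (KZ.tw k)) j vj γ sl Hw →
        KZ.mapCompleted (KZ.proj n) C = Hz * Hw) ∧
      (∀ Hz Hw, KZ.IsHolStart z (KZ.tz (n := n)) i vi γ tl Hz →
        KZ.IsHolEnd z (KZ.tw (n := n)) j vj γ sl Hw →
        KZ.IsBigOLie (C - Hz * Hw) (KZ.tzw (n := n)))) := by
  obtain ⟨h0t, hts, hs1, -⟩ := id hl
  have ht : tl ∈ Set.Ioo (0 : ℝ) 1 := ⟨h0t, hts.trans hs1⟩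
  have hs : sl ∈ Set.Ioo (0 : ℝ) 1 := ⟨h0t.trans hts, hs1⟩
  refine ⟨⟨KZ.freeProd n, KZ.freeProd_injective n, fun k => ?_, fun k => ?_, KZ.freeProd_range n⟩,
    KZ.existsUnique_factor hz hij hγ hl, KZ.existsUnique_holStart hz hγ _ ht,
    KZ.existsUnique_holEnd hz hγ _ hs, KZ.existsUnique_holStart hz hγ _ ht,
    KZ.existsUnique_holEnd hz hγ _ hs, fun C hC =>
      ⟨fun _ _ hHz hHw => KZ.proj_factor hγ hl hC hHz hHw,
        fun _ _ hHz hHw => KZ.isBigOLie_factor hγ hl hC hHz hHw⟩⟩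
  · rw [KZ.freeProd_apply, map_zero, add_zero, KZ.freeZ_of]
  · rw [KZ.freeProd_apply, map_zero, zero_add, KZ.freeW_of]
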